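/- **Setting.** Let $\alpha\in\mathbb C$, $\mathfrak g=\mathfrak{gl}(3)=\mathfrak{gl}(3,\mathbb C)$ with matrix units $E_{ij}$, $\mathbb N=\{0,1,2,\dots\}$. Let $S^\alpha(V)$ be the span of the formal monomials $x_1^{k_1}x_2^{k_2}x_3^{k_3}$ with $k_1+k_2+k_3=\alpha$, $k_2,k_3\in\mathbb N$ (and also $k_1\in\mathbb N$ if $\alpha\in\mathbb N$), on which $E_{ij}$ acts as $x_i\,\partial/\partial x_j$. Let $J^\alpha$ be the kernel of the representation of $U(\mathfrak g)$ on $S^\alpha(V)$ and $\mathfrak A^\alpha=U(\mathfrak g)/J^\alpha$, on which $U(\mathfrak g)$ acts by the extension $\mathrm{ad}$ of the adjoint action $(\mathrm{ad}\,x)(a)=xa-ax$, $x\in\mathfrak g$. Let $\omega$ be the antiautomorphism of $U(\mathfrak g)$ with $\omega(E_{ij})=E_{ji}$, let $u\mapsto u^\sharp$ be the projection of $U(\mathfrak g)=Z\oplus[U(\mathfrak g),U(\mathfrak g)]$ to the center $Z$, and for $z\in Z$ let $\varphi(z)(\alpha,0,0)$ be the scalar by which $z$ acts on $x_1^\alpha\in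 S^\alpha(V)$. Put $\langle u,v\rangle_\alpha=\varphi((u\,\omega(v))^\sharp)(\alpha,0,0)$. For $\nu=\nu_1\varepsilon_1+\nu_2\varepsilon_2+\nu_3\varepsilon_3$, $\nu_i\in\mathbb Z$, let $(\mathfrak A^\alpha)^+_\nu=\{a\in\mathfrak A^\alpha:[E_{ii},a]=\nu_i a\ (i=1,2,3),\ [E_{12},a]=0\}$, and let $Q^+$ be the set of all $\nu$ with $\nu_1+\nu_2+\nu_3=0$ and $(\mathfrak A^\alpha)^+_\nu\ne0$. For $\nu$ with $\nu_1+\nu_2+\nu_3=0$, $\nu_1\ge0$, $\nu_2\le0$ let $u^+_\nu\in\mathfrak A^\alpha$ be the class of $E_{12}^{-\nu_2}E_{13}^{-\nu_3}$ if $\nu_3\le0$, and of $E_{12}^{\nu_1}E_{32}^{\nu_3}$ if $\nu_3\ge0$. For polynomials $f,g\in\mathbb C[t]$ put $\langle f,g\rangle^+_\nu=\langle f(E_{33})u^+_\nu,\,g(E_{33})u^+_\nu\rangle_\alpha$, and write $f\equiv_\nu g$ if $f(E_{33})u^+_\nu=g(E_{33})u^+_\nu$. Let $$z_{31}=(E_{11}-E_{22}+2)E_{31}+E_{21}E_{32},\qquad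 z_{23}=(E_{11}-E_{22}+2)E_{23}-E_{21}E_{13}.$$ For $\nu\in Q^+$ and $k\in\mathbb N$ let $f_{k,\nu}\in\mathbb C[t]$ be a polynomial with $$f_{k,\nu}(E_{33})\,u^+_\nu=\begin{cases}(\mathrm{ad}\,z_{31})^k\,u^+_{\nu+k(\varepsilon_1-\varepsilon_3)}&\text{(for }\nu_3\le0),\\ (\mathrm{ad}\,z_{23})^k\,u^+_{\nu+k(\varepsilon_3-\varepsilon_2)}&\text{(for }\nu_3\ge0).\end{cases}$$ (For $\nu_3=0$ both choices are admitted, and what follows holds for each of them.) Let $\Delta f(t)=f(t+1)-f(t)$, $\nabla f(t)=f(t)-f(t-1)$, and $${}_3F_2\!\left(\begin{matrix}a_1,a_2,a_3\\ b_1,b_2\end{matrix}\,\Big|\,z\right)=\sum_{i\ge0}\frac{(a_1)_i(a_2)_i(a_3)_i}{(b_1)_i(b_2)_i}\frac{z^i}{i!},\qquad (a)_i=a(a+1)\cdots(a+i-1),$$ where for $a_1=-k$ the sum ends at $i=k$. **Theorem.** Let $\alpha\in\mathbb C$. One has $U(\mathfrak g)=Z+[U(\mathfrak g),U(\mathfrak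 g)]$, and $\langle\cdot,\cdot\rangle_\alpha$ is a well-defined form on $\mathfrak A^\alpha$ (its value depends neither on the representatives nor on the choice of the central component). A weight $\nu$ belongs to $Q^+$ if and only if $\nu_1+\nu_2+\nu_3=0$, $\nu_1\ge0$, $\nu_2\le0$ and, in case $\alpha\in\mathbb N$, also $\nu_1\le\alpha$ and $-\nu_2\le\alpha$. Moreover: 0) For $\nu\in Q^+$ one has $(\mathfrak A^\alpha)^+_\nu=\mathbb C[E_{33}]\,u^+_\nu$. If $\alpha\notin\mathbb N$, this $\mathbb C[E_{33}]$-module is free of rank one, and its generator is unique up to a nonzero constant factor. If $\alpha\in\mathbb N$, then $f(E_{33})u^+_\nu=0$ if and only if $f(m)=0$ for all integers $m$ with $\max(0,\nu_3)\le m\le\alpha-\nu_1$. 1) $\langle(\mathfrak A^\alpha)^+_\mu,(\mathfrak A^\alpha)^+_\nu\rangle_\alpha=0$ for $\mu\neq\nu$. 2) For $\nu\in Q^+$ and $k\in\mathbb N$ the polynomial $f_{k,\nu}$ exists; it is unique if $\alpha\notin\mathbb N$ (and unique modulo $\equiv_\nu$ always). For $k\ne l$ (and, for $\nu_3=0$,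 the same choice in the definition) $\langle f_{k,\nu},f_{l,\nu}\rangle^+_\nu=0$. 3) For $\nu\in Q^+$ and $k\in\mathbb N$ the polynomial $f=f_{k,\nu}$ satisfies $$(t-\nu_3+1)(t+\nu_1-\alpha)\,\Delta f-t\,(t+\nu_2-\alpha-2)\,\nabla f\equiv_\nu k(k+2\nu_1+2)\,f\quad\text{if }\nu_3\le0,$$ $$(t+1)(t+\nu_1-\alpha)\,\Delta f-(t-\nu_3)(t+\nu_2-\alpha-2)\,\nabla f\equiv_\nu k(k-2\nu_2+2)\,f\quad\text{if }\nu_3\ge0,$$ and for $\alpha\notin\mathbb N$ these are equalities of polynomials. 4) Let $\nu\in Q^+$ and $k\in\mathbb N$. If $\alpha\notin\mathbb N$, there is a constant $c\neq0$ such that $$f_{k,\nu}(t)=c\cdot{}_3F_2\!\left(\begin{matrix}-k,\;k+2\nu_1+2,\;-t\\ 1-\nu_3,\;\nu_1-\alpha\end{matrix}\,\Big|\,1\right)\ \text{ if }\nu_3\le0,\qquad f_{k,\nu}(t)=c\cdot{}_3F_2\!\left(\begin{matrix}-k,\;k-2\nu_2+2,\;\nu_3-t\\ 1+\nu_3,\;-\nu_2-\alpha\end{matrix}\,\Big|\,1\right)\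 \text{ if }\nu_3\ge0.$$ If $\alpha\in\mathbb N$, the same holds with $\equiv_\nu$ in place of equality as long as $\nu+k(\varepsilon_1-\varepsilon_3)\in Q^+$ (respectively $\nu+k(\varepsilon_3-\varepsilon_2)\in Q^+$), and otherwise $f_{k,\nu}\equiv_\nu0$. -/

import Mathlib

noncomputable section

namespace GL3

open Polynomial

attribute [local instance 100] LieRing.ofAssociativeRing

/-- The Lie algebra `gl(3)` of complex `3 × 3` matrices (with the commutator bracket).
The indices `1, 2, 3` of the matrix units are `0, 1, 2` here. -/
abbrev gl3 : Type := Matrix (Fin 3) (Fin 3) ℂ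

/-- Its universal enveloping algebra. -/
abbrev U : Type := UniversalEnvelopingAlgebra ℂ gl3

/-- The matrix unit `E i j`, as an element of the enveloping algebra. -/
def E (i j : Fin 3) : U := UniversalEnvelopingAlgebra.ι ℂ (Matrix.single i j (1 : ℂ) : gl3)

/-! ### The modules `S^α(V)` -/

/-- The space with basis all formal monomials `x₁^{k₁} x₂^{k₂} x₃^{k₃}`, with complex exponents. -/
def Mon : Type := (Fin 3 → ℂ) →₀ ℂ

instance : AddCommGroup Mon := inferInstanceAs (AddCommGroup ((Fin 3 → ℂ) →₀ ℂ))

instance : Module ℂ Mon := inferInstanceAs (Module ℂ ((Fin 3 → ℂ) →₀ ℂ))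

/-- The basis of monomials `x^k`. -/
def monBasis : Module.Basis (Fin 3 → ℂ) ℂ Mon := ⟨LinearEquiv.refl ℂ ((Fin 3 → ℂ) →₀ ℂ)⟩

/-- The monomial `x^k`. -/
def mono (k : Fin 3 → ℂ) : Mon := monBasis k

/-- Multiplication by `x_i`. -/
def mulX (i : Fin 3) : Module.End ℂ Mon :=
  monBasis.constr ℂ fun k => mono (k + Pi.single i 1)

/-- The formal partial derivative `∂/∂x_j`. -/
def pd (j : Fin 3) : Module.End ℂ Mon :=
  monBasis.constr ℂ fun k => k j • mono (k - Pi.single j 1)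

theorem mulX_mono (i : Fin 3) (k : Fin 3 → ℂ) : mulX i (mono k) = mono (k + Pi.single i 1) :=
  monBasis.constr_basis ℂ _ k

theorem pd_mono (j : Fin 3) (k : Fin 3 → ℂ) : pd j (mono k) = k j • mono (k - Pi.single j 1) :=
  monBasis.constr_basis ℂ _ k

/-- The linear action of `gl(3)` on formal monomials, `E_ij ↦ x_i ∂/∂x_j`. -/
def glAct : gl3 →ₗ[ℂ] Module.End ℂ Mon where
  toFun M := ∑ i, ∑ j, M i j • (mulX i * pd j)
  map_add' M N := by simp [add_smul, Finset.sum_add_distrib]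
  map_smul' c M := by simp [mul_smul, Finset.smul_sum]

/-- The exponents of the monomials which span `S^α(V)`: the sum is `α`, the second and the third
exponent are natural numbers, and so is the first one if `α` is a natural number. -/
def expo (α : ℂ) : Set (Fin 3 → ℂ) :=
  {k | k 0 + k 1 + k 2 = α ∧ (∃ b : ℕ, k 1 = b) ∧ (∃ c : ℕ, k 2 = c) ∧
    ((∃ n : ℕ, α = n) → ∃ a : ℕ, k 0 = a)}

/-- The space `S^α(V)`. -/
def S (α : ℂ) : Submodule ℂ Mon := Submodule.span ℂ (mono '' expo α)

theorem xpd_mono (i j : Fin 3) (k : Fin 3 → ℂ) :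
    mulX i (pd j (mono k)) = k j • mono (k - Pi.single j 1 + Pi.single i 1) := by
  rw [pd_mono, map_smul, mulX_mono]

theorem pd_mulX (i j : Fin 3) :
    pd j * mulX i = mulX i * pd j + (if j = i then (1 : Module.End ℂ Mon) else 0) := by
  refine monBasis.ext fun k => ?_
  change pd j (mulX i (mono k)) = mulX i (pd j (mono k)) + (if j = i then 1 else 0 :
    Module.End ℂ Mon) (mono k)
  rw [xpd_mono, mulX_mono, pd_mono]
  have h : k + Pi.single i 1 - Pi.single j 1 = k - Pi.single j 1 + Pi.single i 1 := by abel
  rw [h]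
  by_cases hji : j = i
  · subst hji; simp [add_smul]
  · simp [hji]

theorem mulX_comm (i k : Fin 3) : mulX i * mulX k = mulX k * mulX i := by
  refine monBasis.ext fun m => ?_
  change mulX i (mulX k (mono m)) = mulX k (mulX i (mono m))
  simp only [mulX_mono]
  rw [add_right_comm]

theorem pd_comm (j l : Fin 3) : pd j * pd l = pd l * pd j := by
  refine monBasis.ext fun m => ?_
  change pd j (pd l (mono m)) = pd l (pd j (mono m))
  simp only [pd_mono, map_smul, smul_smul, sub_right_comm m (Pi.single j 1)]
  congr 1
  by_cases hjl : j = l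
  · subst hjl; rfl
  · simp [hjl, Ne.symm hjl, mul_comm]

theorem xpd_mul (i j k l : Fin 3) :
    (mulX i * pd j) * (mulX k * pd l) =
      mulX i * mulX k * (pd j * pd l) + (if j = k then mulX i * pd l else 0) := by
  rw [mul_assoc, ← mul_assoc (pd j), pd_mulX]
  by_cases h : j = k <;> simp [h, mul_assoc, add_mul, mul_add]

theorem xpd_comm (i j k l : Fin 3) :
    (mulX i * pd j) * (mulX k * pd l) - (mulX k * pd l) * (mulX i * pd j) =
      (if j = k then mulX i * pd l else 0) - (if l = i then mulX k * pd j else 0) := by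
  rw [xpd_mul, xpd_mul, mulX_comm k i, pd_comm l j]
  abel

theorem glAct_single (i j : Fin 3) : glAct (Matrix.single i j (1 : ℂ)) = mulX i * pd j := by
  change ∑ a, ∑ b, (Matrix.single i j (1 : ℂ) : gl3) a b • (mulX a * pd b) = _
  rw [Finset.sum_eq_single i, Finset.sum_eq_single j]
  · simp
  · intro b _ hb; simp [Ne.symm hb]
  · simp
  · intro a _ ha; simp [Ne.symm ha]
  · simp

theorem glAct_lie (M N : gl3) : glAct ⁅M, N⁆ = ⁅glAct M, glAct N⁆ := by
  induction M using Matrix.induction_on' with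
  | h_zero => simp
  | h_add p q hp hq => rw [add_lie, map_add, hp, hq, map_add, add_lie]
  | h_std_basis i j c =>
    induction N using Matrix.induction_on' with
    | h_zero => simp
    | h_add p q hp hq => rw [lie_add, map_add, hp, hq, map_add, lie_add]
    | h_std_basis k l d =>
      have h1 : (Matrix.single i j c : gl3) = c • Matrix.single i j 1 := by simp
      have h2 : (Matrix.single k l d : gl3) = d • Matrix.single k l 1 := by simp
      rw [h1, h2]
      simp only [smul_lie, lie_smul, map_smul, glAct_single]
      congr 2
      simp only [LieRing.of_associative_ring_bracket]
      rw [xpd_comm, map_sub]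
      congr 1
      · by_cases h : j = k
        · subst h; simp [glAct_single]
        · simp [h, Matrix.single_mul_single_of_ne]
      · by_cases h : l = i
        · subst h; simp [glAct_single]
        · simp [h, Matrix.single_mul_single_of_ne]

theorem xpd_mem (α : ℂ) (i j : Fin 3) (k : Fin 3 → ℂ) (hk : k ∈ expo α) :
    mulX i (pd j (mono k)) ∈ S α := by
  rw [xpd_mono]
  by_cases h0 : k j = 0
  · simp [h0]
  refine Submodule.smul_mem _ _ (Submodule.subset_span ⟨_, ?_, rfl⟩)
  obtain ⟨h, ⟨b, hb⟩, ⟨c, hc⟩, ha⟩ := hk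
  have key : ∀ m : Fin 3, (∃ a : ℕ, k m = a) →
      ∃ a : ℕ, (k - Pi.single j 1 + Pi.single i 1 : Fin 3 → ℂ) m = a := by
    rintro m ⟨a, hm⟩
    have : ∃ a' : ℕ, (k - Pi.single j 1 : Fin 3 → ℂ) m = a' := by
      by_cases hjm : m = j
      · subst hjm
        cases a with
        | zero => exact absurd (by simpa using hm) h0
        | succ a => exact ⟨a, by simp [hm]⟩
      · exact ⟨a, by simp [hm, hjm]⟩
    obtain ⟨a', ha'⟩ := this
    by_cases him : m = i
    · subst him; exact ⟨a' + 1, by rw [Pi.add_apply, ha']; simp⟩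
    · exact ⟨a', by rw [Pi.add_apply, ha']; simp [him]⟩
  refine ⟨?_, key 1 ⟨b, hb⟩, key 2 ⟨c, hc⟩, fun hn => key 0 (ha hn)⟩
  rw [← h]
  fin_cases i <;> fin_cases j <;> simp <;> ring

theorem glAct_mem (α : ℂ) (M : gl3) (m : Mon) (hm : m ∈ S α) : glAct M m ∈ S α := by
  induction hm using Submodule.span_induction with
  | mem x hx =>
    obtain ⟨k, hk, rfl⟩ := hx
    change (∑ i, ∑ j, M i j • (mulX i * pd j)) (mono k) ∈ S α
    simp only [LinearMap.sum_apply, LinearMap.smul_apply]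
    exact Submodule.sum_mem _ fun i _ => Submodule.sum_mem _ fun j _ =>
      Submodule.smul_mem _ _ (xpd_mem α i j k hk)
  | zero => simp
  | add x y _ _ hx hy => rw [map_add]; exact Submodule.add_mem _ hx hy
  | smul c x _ hx => rw [map_smul]; exact Submodule.smul_mem _ c hx

/-- The representation of `gl(3)` on `S^α(V)`. -/
def glRep (α : ℂ) : gl3 →ₗ⁅ℂ⁆ Module.End ℂ (S α) where
  toFun M := (glAct M).restrict (glAct_mem α M)
  map_add' M N := by ext1 x; apply Subtype.ext; simp [LinearMap.restrict_apply]
  map_smul' c M := by ext1 x; apply Subtype.ext; simp [LinearMap.restrict_apply]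
  map_lie' := by
    intro M N
    ext1 x
    apply Subtype.ext
    change glAct ⁅M, N⁆ x = _
    rw [glAct_lie]
    simp [LinearMap.restrict_apply, LieRing.of_associative_ring_bracket]

/-- The representation of the enveloping algebra on `S^α(V)`. -/
def rep (α : ℂ) : U →ₐ[ℂ] Module.End ℂ (S α) := UniversalEnvelopingAlgebra.lift ℂ (glRep α)

/-- The kernel `J^α` of that representation, a two-sided ideal. -/
abbrev J (α : ℂ) : Ideal U := RingHom.ker (rep α)

/-- The algebra `𝔄^α = U(gl(3)) / J^α`. -/
abbrev A (α : ℂ) : Type := U ⧸ J α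

/-- The projection `U(gl(3)) → 𝔄^α`. -/
def proj (α : ℂ) : U →ₐ[ℂ] A α := Ideal.Quotient.mkₐ ℂ (J α)

/-- The adjoint action of `gl(3)` on `𝔄^α`, `x ↦ (a ↦ x a - a x)`. -/
def adA (α : ℂ) : gl3 →ₗ⁅ℂ⁆ Module.End ℂ (A α) :=
  (LieAlgebra.ad ℂ (A α)).comp
    ((proj α).toLieHom.comp (UniversalEnvelopingAlgebra.ι ℂ : gl3 →ₗ⁅ℂ⁆ U))

/-- The adjoint action extended to an action of the associative algebra `U(gl(3))`. -/
def adU (α : ℂ) : U →ₐ[ℂ] Module.End ℂ (A α) := UniversalEnvelopingAlgebra.lift ℂ (adA α)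

/-! ### The invariant bilinear form -/

theorem transpose_lie (X Y : gl3) :
    MulOpposite.op (UniversalEnvelopingAlgebra.ι ℂ (⁅X, Y⁆.transpose : gl3) : U) =
      ⁅MulOpposite.op (UniversalEnvelopingAlgebra.ι ℂ (X.transpose : gl3) : U),
        MulOpposite.op (UniversalEnvelopingAlgebra.ι ℂ (Y.transpose : gl3) : U)⁆ := by
  have h : (⁅X, Y⁆.transpose : gl3) = ⁅Y.transpose, X.transpose⁆ := by
    simp [LieRing.of_associative_ring_bracket, Matrix.transpose_sub, Matrix.transpose_mul]
  rw [h, LieHom.map_lie]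
  simp [LieRing.of_associative_ring_bracket]

/-- The antiautomorphism `ω` of `U(gl(3))` with `ω(E_ij) = E_ji`, as a homomorphism to the
opposite algebra. -/
def omegaOp : U →ₐ[ℂ] Uᵐᵒᵖ := UniversalEnvelopingAlgebra.lift ℂ
  { toFun := fun X => MulOpposite.op (UniversalEnvelopingAlgebra.ι ℂ (X.transpose : gl3) : U)
    map_add' := fun X Y => by simp
    map_smul' := fun c X => by simp
    map_lie' := fun {X Y} => transpose_lie X Y }

/-- The Chevalley antiautomorphism `ω` of `U(gl(3))`. -/
def omega (u : U) : U := (omegaOp u).unop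

/-- The center of `U(gl(3))`. -/
abbrev Z : Subalgebra ℂ U := Subalgebra.center ℂ U

/-- The span `[U, U]` of all commutators. -/
def comm : Submodule ℂ U := Submodule.span ℂ {x | ∃ a b : U, x = a * b - b * a}

open Classical in
/-- The projection `u ↦ u^♯` to the center along `U = Z ⊕ [U, U]`. -/
def sharp (u : U) : U := if h : ∃ z ∈ Z, u - z ∈ comm then h.choose else 0

theorem hw_mem (α : ℂ) : mono ![α, 0, 0] ∈ S α := by
  refine Submodule.subset_span ⟨_, ⟨by simp, ⟨0, by simp⟩, ⟨0, by simp⟩, ?_⟩, rfl⟩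
  rintro ⟨n, rfl⟩
  exact ⟨n, by simp⟩

/-- The highest weight vector `x₁^α` of `S^α(V)`. -/
def hwVec (α : ℂ) : S α := ⟨mono ![α, 0, 0], hw_mem α⟩

/-- The coefficient of `x₁^α` in `z · x₁^α`.  A central `z` acts on the highest weight vector by
`φ(z)(α, 0, 0)`, where `φ` is the (unshifted) Harish-Chandra homomorphism, so that this is
`φ(z)(α, 0, 0)`. -/
def hc (α : ℂ) (z : U) : ℂ := monBasis.coord ![α, 0, 0] (rep α z (hwVec α) : Mon)

/-- The form `⟨u, v⟩_α = φ((u ω(v))^♯)(α, 0, 0)` on `U(gl(3))`. -/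
def formU (α : ℂ) (u v : U) : ℂ := hc α (sharp (u * omega v))

/-- The form `⟨·,·⟩_α` on `𝔄^α`, computed on representatives. -/
def form (α : ℂ) (a b : A α) : ℂ :=
  formU α (Function.surjInv (Ideal.Quotient.mk_surjective (I := J α)) a)
    (Function.surjInv (Ideal.Quotient.mk_surjective (I := J α)) b)

/-! ### Highest vectors for `gl(2)` -/

/-- Weights `ν = ν₁ ε₁ + ν₂ ε₂ + ν₃ ε₃` with integer coefficients. -/
abbrev Wt : Type := Fin 3 → ℤ

/-- The basis weight `ε_i`. -/
def eps (i : Fin 3) : Wt := Pi.single i 1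

/-- `(𝔄^α)^+_ν`: the elements of weight `ν` with `[E₁₂, a] = 0`. -/
def hwSpace (α : ℂ) (ν : Wt) : Submodule ℂ (A α) where
  carrier := {a | (∀ i, adU α (E i i) a = (ν i : ℂ) • a) ∧ adU α (E 0 1) a = 0}
  zero_mem' := by simp
  add_mem' := by
    rintro a b ⟨h1, h2⟩ ⟨h3, h4⟩
    exact ⟨fun i => by rw [map_add, h1, h3, smul_add], by rw [map_add, h2, h4, add_zero]⟩
  smul_mem' := by
    rintro c a ⟨h1, h2⟩
    exact ⟨fun i => by rw [map_smul, h1, smul_comm], by rw [map_smul, h2, smul_zero]⟩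

/-- `Q^+`: the elements `ν` of the root lattice with `(𝔄^α)^+_ν ≠ 0`. -/
def Qplus (α : ℂ) : Set Wt := {ν | ν 0 + ν 1 + ν 2 = 0 ∧ hwSpace α ν ≠ ⊥}

/-- The element `f(E₃₃) a` of `𝔄^α`. -/
def act (α : ℂ) (f : ℂ[X]) (a : A α) : A α := aeval (proj α (E 2 2)) f * a

/-- The generator `u^+_ν`.  It acts as the differential operator
`x₁^{ν₁} ∂₂^{-ν₂} ∂₃^{-ν₃}` if `ν₃ ≤ 0`, and as `x₁^{ν₁} ∂₂^{-ν₂} x₃^{ν₃}` if `ν₃ ≥ 0`. -/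
def uPlus (α : ℂ) (ν : Wt) : A α :=
  if ν 2 ≤ 0 then proj α (E 0 1 ^ (-ν 1).toNat * E 0 2 ^ (-ν 2).toNat)
  else proj α (E 0 1 ^ (ν 0).toNat * E 2 1 ^ (ν 2).toNat)

/-- `z₃₁ = (E₁₁ - E₂₂ + 2) E₃₁ + E₂₁ E₃₂`. -/
def z31 : U := (E 0 0 - E 1 1 + 2) * E 2 0 + E 1 0 * E 2 1

/-- `z₂₃ = (E₁₁ - E₂₂ + 2) E₂₃ - E₂₁ E₁₃`. -/
def z23 : U := (E 0 0 - E 1 1 + 2) * E 1 2 - E 1 0 * E 0 2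

/-- The form `⟨f, g⟩^+_ν = ⟨f u^+_ν, g u^+_ν⟩_α` on polynomials. -/
def formPlus (α : ℂ) (ν : Wt) (f g : ℂ[X]) : ℂ :=
  form α (act α f (uPlus α ν)) (act α g (uPlus α ν))

/-- `f` is a polynomial `f_{k,ν}` defined with `z₃₁` (for `ν₃ ≤ 0`):
`f(E₃₃) u^+_ν = (ad z₃₁)^k (u^+_{ν + k(ε₁ - ε₃)})`. -/
def IsF31 (α : ℂ) (ν : Wt) (k : ℕ) (f : ℂ[X]) : Prop :=
  act α f (uPlus α ν) = (adU α z31 ^ k) (uPlus α (ν + k • (eps 0 - eps 2)))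

/-- `f` is a polynomial `f_{k,ν}` defined with `z₂₃` (for `ν₃ ≥ 0`):
`f(E₃₃) u^+_ν = (ad z₂₃)^k (u^+_{ν + k(ε₃ - ε₂)})`. -/
def IsF23 (α : ℂ) (ν : Wt) (k : ℕ) (f : ℂ[X]) : Prop :=
  act α f (uPlus α ν) = (adU α z23 ^ k) (uPlus α (ν + k • (eps 2 - eps 1)))

/-- The forward difference `Δf(x) = f(x + 1) - f(x)`. -/
def fwd (f : ℂ[X]) : ℂ[X] := f.comp (X + 1) - f

/-- The backward difference `∇f(x) = f(x) - f(x - 1)`. -/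
def bwd (f : ℂ[X]) : ℂ[X] := f - f.comp (X - 1)

/-- The difference operator for `ν₃ ≤ 0`. -/
def D31 (α : ℂ) (ν : Wt) (f : ℂ[X]) : ℂ[X] :=
  (X - C (ν 2 : ℂ) + 1) * (X + C ((ν 0 : ℂ) - α)) * fwd f
    - X * (X + C ((ν 1 : ℂ) - α - 2)) * bwd f

/-- The difference operator for `ν₃ ≥ 0`. -/
def D23 (α : ℂ) (ν : Wt) (f : ℂ[X]) : ℂ[X] :=
  (X + 1) * (X + C ((ν 0 : ℂ) - α)) * fwd f
    - (X - C (ν 2 : ℂ)) * (X + C ((ν 1 : ℂ) - α - 2)) * bwd f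

/-- The rising factorial `(a)_i = a (a + 1) ⋯ (a + i - 1)`. -/
def poch (a : ℂ) (i : ℕ) : ℂ := ∏ j ∈ Finset.range i, (a + j)

/-- The generalized hypergeometric function `₃F₂(a₁, a₂, a₃; b₁, b₂ | z)`.  It is only used with
`a₁ = -k` for a natural number `k` and with `(b₁)_i (b₂)_i ≠ 0` for `i ≤ k`: the terms with `i > k`
are then zero. -/
def hyp3F2 (a₁ a₂ a₃ b₁ b₂ z : ℂ) : ℂ :=
  ∑' i : ℕ, poch a₁ i * poch a₂ i * poch a₃ i / (poch b₁ i * poch b₂ i) * (z ^ i / i.factorial)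

/-- `₃F₂(-k, k + 2ν₁ + 2, -t; 1 - ν₃, ν₁ - α | 1)`. -/
def hahn31 (α : ℂ) (ν : Wt) (k : ℕ) (t : ℂ) : ℂ :=
  hyp3F2 (-k) (k + 2 * (ν 0 : ℂ) + 2) (-t) (1 - (ν 2 : ℂ)) ((ν 0 : ℂ) - α) 1

/-- `₃F₂(-k, k - 2ν₂ + 2, ν₃ - t; 1 + ν₃, -ν₂ - α | 1)`. -/
def hahn23 (α : ℂ) (ν : Wt) (k : ℕ) (t : ℂ) : ℂ :=
  hyp3F2 (-k) (k - 2 * (ν 1 : ℂ) + 2) ((ν 2 : ℂ) - t) (1 + (ν 2 : ℂ)) (-(ν 1 : ℂ) - α) 1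

end GL3
end

open Polynomial GL3

noncomputable section

namespace GL3

open Polynomial

attribute [local instance 100] LieRing.ofAssociativeRing

/-! ### Elementary facts on the enveloping algebra and its actions -/

/-! All modules S^α(V) lie in one module of formal monomials with complex exponents, on which E_ij
acts as the weighted shift x^k ↦ k_j x^{k+ε_i-ε_j}. Every element of U(𝔤) acts there as a finite sum
of shifts whose weights are polynomial in k, and J^α consists of those u that vanish on the
exponents (α-b-c, b, c) occurring in S^α(V). Thus identities in 𝔄^α are identities between functions
of b and c. For a gl(2)-highest element, commutation with E₁₂ is a first-order recurrence in b
(`cf_succ`); its solution is a function of c times a falling factorial of b. This yields the weights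
and the generator u^+_ν (`exists_poly_generic`, `exists_poly_nat`).

The elements z₃₁ and z₂₃ preserve the kernel of ad E₁₂, so they act on the polynomial f in
f(E₃₃)u^+_ν. Up to a nonzero scalar, and up to the substitution t ↦ t + ν₃ for z₂₃, both act by the
same ladder operator `lad` (`adU_z31_act`, `adU_z23_act`). It intertwines the difference operators
`hahnOp` for neighbouring parameters up to an additive constant (`hahnOp_lad`), so iterating it on 1
produces eigenfunctions. An eigenfunction is determined by its value at 0 on the range that matters
(`eigen_eq_zero`), and the ₃F₂ series is an eigenfunction for the same eigenvalue
(`hahnOp_hahnPoly`); hence the two are proportional there (`agree_hahnPoly`).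

The decomposition U = Z + [U,U] comes from the unitary trick (`exists_central_part`). A central
element of [U,U] has trace zero on each finite-dimensional S^n(V), so its scalar vanishes for α = n,
and then for all α because it is polynomial in α (`hc_eq_zero`). With the invariance of J^α under ω
(`omega_mem_J`) this makes the form well defined. The form is contravariant for the adjoint action,
and against highest vectors z₃₁ is adjoint to a multiple of E₁₃, which acts on polynomials as Δ;
likewise z₂₃ to a multiple of E₃₂, which acts as -∇. Pairing (ad z)^k a with a polynomial of degree
below k therefore gives zero. Since f_{l,ν} can be represented by a polynomial of degree at most l,
orthogonality follows. -/

theorem ι_mem_adjoin_E (X : gl3) :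
    UniversalEnvelopingAlgebra.ι ℂ X ∈ Algebra.adjoin ℂ {x : U | ∃ i j, x = E i j} := by
  induction X using Matrix.induction_on' with
  | h_zero => simp
  | h_add p q hp hq => rw [map_add]; exact add_mem hp hq
  | h_std_basis i j c =>
    have h1 : (Matrix.single i j c : gl3) = c • Matrix.single i j 1 := by simp
    rw [h1, map_smul]
    have h : E i j ∈ Algebra.adjoin ℂ {x : U | ∃ i j, x = E i j} :=
      Algebra.subset_adjoin ⟨i, j, rfl⟩
    exact Subalgebra.smul_mem _ h c

/-- The universal property lifts the map of `L` into the subalgebra `B`. Followed by the inclusion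
of `B` this lift is the identity by uniqueness, so `B` is everything. -/
theorem adjoin_ι {L : Type*} [LieRing L] [LieAlgebra ℂ L] :
    Algebra.adjoin ℂ (Set.range fun X : L => UniversalEnvelopingAlgebra.ι ℂ X) = ⊤ := by
  set B := Algebra.adjoin ℂ (Set.range fun X : L => UniversalEnvelopingAlgebra.ι ℂ X)
  let f : L →ₗ⁅ℂ⁆ B :=
    { toFun := fun X => ⟨UniversalEnvelopingAlgebra.ι ℂ X, Algebra.subset_adjoin ⟨X, rfl⟩⟩
      map_add' := fun X Y => Subtype.ext (by simp)
      map_smul' := fun c X => Subtype.ext (by simp)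
      map_lie' := fun {X Y} => Subtype.ext (by
        simp [LieRing.of_associative_ring_bracket]) }
  have h : B.val.comp (UniversalEnvelopingAlgebra.lift ℂ f) = AlgHom.id ℂ _ := by
    apply UniversalEnvelopingAlgebra.hom_ext
    ext X
    simp [f]
  rw [eq_top_iff]
  intro x _
  have := congrArg (fun g => g x) h
  simp only [AlgHom.comp_apply, AlgHom.id_apply] at this
  rw [← this]
  exact (UniversalEnvelopingAlgebra.lift ℂ f x).2

theorem adjoin_E : Algebra.adjoin ℂ {x : U | ∃ i j, x = E i j} = ⊤ := by
  rw [eq_top_iff, ← adjoin_ι, Algebra.adjoin_le_iff]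
  rintro _ ⟨X, rfl⟩
  exact ι_mem_adjoin_E X

theorem U_induction {P : U → Prop} (hc : ∀ c : ℂ, P (algebraMap ℂ U c)) (hE : ∀ i j, P (E i j))
    (hadd : ∀ u v, P u → P v → P (u + v)) (hmul : ∀ u v, P u → P v → P (u * v)) (u : U) : P u := by
  have hu : u ∈ Algebra.adjoin ℂ {x : U | ∃ i j, x = E i j} := by rw [adjoin_E]; trivial
  induction hu using Algebra.adjoin_induction with
  | mem x hx => obtain ⟨i, j, rfl⟩ := hx; exact hE i j
  | algebraMap r => exact hc r
  | add x y _ _ hx hy => exact hadd _ _ hx hy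
  | mul x y _ _ hx hy => exact hmul _ _ hx hy

theorem E_comm (i j k l : Fin 3) :
    E i j * E k l - E k l * E i j = (if j = k then E i l else 0) - (if l = i then E k j else 0) := by
  have h := (UniversalEnvelopingAlgebra.ι ℂ : gl3 →ₗ⁅ℂ⁆ U).map_lie
    (Matrix.single i j 1) (Matrix.single k l 1)
  rw [LieRing.of_associative_ring_bracket, LieRing.of_associative_ring_bracket, map_sub] at h
  rw [E, E, ← h]
  congr 1
  · by_cases h : j = k
    · subst h; simp [E]
    · simp [h, Matrix.single_mul_single_of_ne]
  · by_cases h : l = i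
    · subst h; simp [E]
    · simp [h, Matrix.single_mul_single_of_ne]

/-- The action of the enveloping algebra on the space of all formal monomials. -/
def R : U →ₐ[ℂ] Module.End ℂ Mon :=
  UniversalEnvelopingAlgebra.lift ℂ { glAct with map_lie' := fun {X Y} => glAct_lie X Y }

theorem R_E (i j : Fin 3) : R (E i j) = mulX i * pd j := by
  rw [R, E, UniversalEnvelopingAlgebra.lift_ι_apply]
  exact glAct_single i j

theorem R_E_mono (i j : Fin 3) (k : Fin 3 → ℂ) :
    R (E i j) (mono k) = k j • mono (k + (Pi.single i 1 - Pi.single j 1)) := by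
  rw [R_E, Module.End.mul_apply, xpd_mono]
  congr 2; abel

theorem rep_E_coe (α : ℂ) (i j : Fin 3) (x : S α) : (rep α (E i j) x : Mon) = R (E i j) x := by
  rw [rep, E, R, UniversalEnvelopingAlgebra.lift_ι_apply, UniversalEnvelopingAlgebra.lift_ι_apply]
  rfl

theorem rep_coe (α : ℂ) (u : U) : ∀ x : S α, (rep α u x : Mon) = R u x := by
  induction u using U_induction with
  | hc c => intro x; simp [Algebra.algebraMap_eq_smul_one]
  | hE i j => exact rep_E_coe α i j
  | hadd u v hu hv => intro x; simp [hu, hv]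
  | hmul u v hu hv => intro x; simp [hu, hv]

theorem R_mem (α : ℂ) (u : U) {x : Mon} (hx : x ∈ S α) : R u x ∈ S α := by
  rw [← rep_coe α u ⟨x, hx⟩]; exact Subtype.mem _

theorem mono_mem {α : ℂ} {k : Fin 3 → ℂ} (hk : k ∈ expo α) : mono k ∈ S α :=
  Submodule.subset_span ⟨k, hk, rfl⟩

/-- This reduces questions in 𝔄^α to single monomials and to the operator `R`, which does not depend
on α. -/
theorem mem_J_iff (α : ℂ) (u : U) : u ∈ J α ↔ ∀ k ∈ expo α, R u (mono k) = 0 := by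
  rw [RingHom.mem_ker]
  constructor
  · intro h k hk
    have := rep_coe α u ⟨mono k, mono_mem hk⟩
    rw [← this, h]; rfl
  · intro h
    have h2 : S α ≤ LinearMap.ker (R u) := by
      refine Submodule.span_le.2 ?_
      rintro _ ⟨k, hk, rfl⟩
      exact h k hk
    ext x
    rw [rep_coe]
    exact h2 x.2

theorem proj_surjective (α : ℂ) : Function.Surjective (proj α) := Ideal.Quotient.mk_surjective

theorem proj_eq_zero_iff (α : ℂ) (u : U) : proj α u = 0 ↔ u ∈ J α :=
  Ideal.Quotient.eq_zero_iff_mem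

theorem proj_eq_iff (α : ℂ) (u v : U) :
    proj α u = proj α v ↔ ∀ k ∈ expo α, R u (mono k) = R v (mono k) := by
  rw [← sub_eq_zero, ← map_sub, proj_eq_zero_iff, mem_J_iff]
  simp [sub_eq_zero]

theorem adU_E (α : ℂ) (i j : Fin 3) (a : A α) :
    adU α (E i j) a = proj α (E i j) * a - a * proj α (E i j) := by
  rw [adU, E, UniversalEnvelopingAlgebra.lift_ι_apply]
  rfl

theorem adU_E_proj (α : ℂ) (i j : Fin 3) (u : U) :
    adU α (E i j) (proj α u) = proj α (E i j * u - u * E i j) := by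
  rw [adU_E]; simp

theorem act_proj (α : ℂ) (f : ℂ[X]) (u : U) :
    act α f (proj α u) = proj α (aeval (E 2 2) f * u) := by
  rw [act, map_mul, Polynomial.aeval_algHom_apply]

theorem act_mul (α : ℂ) (f g : ℂ[X]) (a : A α) : act α (f * g) a = act α f (act α g a) := by
  simp [act, mul_assoc]

theorem act_C_mul (α c : ℂ) (f : ℂ[X]) (a : A α) : act α (C c * f) a = c • act α f a := by
  simp [act, Algebra.algebraMap_eq_smul_one]

theorem act_one (α : ℂ) (a : A α) : act α 1 a = a := by simp [act]

theorem smul_mono_eq_zero {c : ℂ} {k : Fin 3 → ℂ} : c • mono k = 0 ↔ c = 0 := by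
  have : mono k ≠ 0 := monBasis.ne_zero k
  simp [this]

theorem smul_mono_left_inj {c d : ℂ} {k : Fin 3 → ℂ} : c • mono k = d • mono k ↔ c = d := by
  rw [← sub_eq_zero, ← sub_smul, smul_mono_eq_zero, sub_eq_zero]

/-! ### Weighted shift operators -/

/-- The operator `x^k ↦ φ(k) x^{k+μ}`. -/
def T (φ : (Fin 3 → ℂ) → ℂ) (μ : Fin 3 → ℂ) : Module.End ℂ Mon :=
  monBasis.constr ℂ fun k => φ k • mono (k + μ)

theorem T_mono (φ : (Fin 3 → ℂ) → ℂ) (μ k : Fin 3 → ℂ) : T φ μ (mono k) = φ k • mono (k + μ) :=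
  monBasis.constr_basis ℂ _ k

theorem T_mul (φ ψ : (Fin 3 → ℂ) → ℂ) (μ ν : Fin 3 → ℂ) :
    T φ μ * T ψ ν = T (fun k => ψ k * φ (k + ν)) (ν + μ) := by
  refine monBasis.ext fun k => ?_
  change T φ μ (T ψ ν (mono k)) = T _ _ (mono k)
  rw [T_mono, T_mono, map_smul, T_mono, smul_smul, add_assoc]

theorem T_sub (φ ψ : (Fin 3 → ℂ) → ℂ) (μ : Fin 3 → ℂ) : T φ μ - T ψ μ = T (φ - ψ) μ := by
  refine monBasis.ext fun k => ?_
  change T φ μ (mono k) - T ψ μ (mono k) = T _ _ (mono k)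
  simp [T_mono, sub_smul]

theorem T_add (φ ψ : (Fin 3 → ℂ) → ℂ) (μ : Fin 3 → ℂ) : T φ μ + T ψ μ = T (φ + ψ) μ := by
  refine monBasis.ext fun k => ?_
  change T φ μ (mono k) + T ψ μ (mono k) = T _ _ (mono k)
  simp [T_mono, add_smul]

theorem T_smul (c : ℂ) (φ : (Fin 3 → ℂ) → ℂ) (μ : Fin 3 → ℂ) : c • T φ μ = T (c • φ) μ := by
  refine monBasis.ext fun k => ?_
  change c • T φ μ (mono k) = T _ _ (mono k)
  simp [T_mono, smul_smul]

theorem one_eq_T : (1 : Module.End ℂ Mon) = T (fun _ => 1) 0 := by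
  refine monBasis.ext fun k => ?_
  change mono k = T _ _ (mono k)
  simp [T_mono]

theorem R_E_eq_T (i j : Fin 3) : R (E i j) = T (fun k => k j) (Pi.single i 1 - Pi.single j 1) := by
  refine monBasis.ext fun k => ?_
  change R (E i j) (mono k) = T _ _ (mono k)
  rw [T_mono, R_E_mono]

theorem R_aeval_E22 (f : ℂ[X]) : R (aeval (E 2 2) f) = T (fun k => f.eval (k 2)) 0 := by
  induction f using Polynomial.induction_on' with
  | add p q hp hq =>
    rw [map_add, map_add, hp, hq, T_add]; congr 1; ext k; simp
  | monomial n c =>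
    rw [← C_mul_X_pow_eq_monomial]
    simp only [map_mul, map_pow, aeval_C, aeval_X, R_E_eq_T, sub_self]
    have : ∀ n : ℕ, (T (fun k : Fin 3 → ℂ => k 2) 0) ^ n = T (fun k => k 2 ^ n) 0 := by
      intro n
      induction n with
      | zero => simp [one_eq_T]
      | succ n ih => rw [pow_succ, ih, T_mul]; simp [pow_succ, mul_comm]
    rw [this, AlgHom.commutes, Algebra.algebraMap_eq_smul_one, smul_mul_assoc, one_mul, T_smul]
    congr 1; ext k; simp

/-- The falling factorial `x (x - 1) ⋯ (x - n + 1)`. -/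
def fall (n : ℕ) (x : ℂ) : ℂ := ∏ j ∈ Finset.range n, (x - j)

theorem fall_zero (x : ℂ) : fall 0 x = 1 := by simp [fall]

theorem fall_succ (n : ℕ) (x : ℂ) : fall (n + 1) x = fall n x * (x - n) :=
  Finset.prod_range_succ _ _

theorem fall_succ' (n : ℕ) (x : ℂ) : fall (n + 1) x = x * fall n (x - 1) := by
  rw [fall, Finset.prod_range_succ', mul_comm, fall]
  congr 1
  · simp
  · refine Finset.prod_congr rfl fun j _ => ?_
    push_cast; ring

theorem fall_eq_zero_iff (n : ℕ) (x : ℂ) : fall n x = 0 ↔ ∃ j < n, x = j := by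
  simp [fall, Finset.prod_eq_zero_iff, sub_eq_zero]

theorem fall_nat_eq_zero_iff (n b : ℕ) : fall n (b : ℂ) = 0 ↔ b < n := by
  rw [fall_eq_zero_iff]
  constructor
  · rintro ⟨j, hj, h⟩; rwa [Nat.cast_inj.1 h]
  · intro h; exact ⟨b, h, rfl⟩

theorem T_pow_shift (n : ℕ) (i j : Fin 3) (hij : i ≠ j) :
    R (E i j ^ n) = T (fun k => fall n (k j)) (n • (Pi.single i 1 - Pi.single j 1)) := by
  induction n with
  | zero => simp [one_eq_T, fall_zero]
  | succ n ih =>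
    rw [pow_succ, map_mul, ih, R_E_eq_T, T_mul, succ_nsmul']
    congr 1
    ext k
    rw [fall_succ']
    simp [hij.symm]
    left; congr 1

/-! ### Polynomiality of the action -/

/-- Polynomial functions on `ℂ³`. -/
def PolyFun : Subalgebra ℂ ((Fin 3 → ℂ) → ℂ) :=
  Algebra.adjoin ℂ {φ | ∃ j, φ = fun k => k j}

theorem coord_mem (j : Fin 3) : (fun k : Fin 3 → ℂ => k j) ∈ PolyFun :=
  Algebra.subset_adjoin ⟨j, rfl⟩

theorem PolyFun_shift (μ : Fin 3 → ℂ) {φ : (Fin 3 → ℂ) → ℂ} (h : φ ∈ PolyFun) :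
    (fun k => φ (k + μ)) ∈ PolyFun := by
  induction h using Algebra.adjoin_induction with
  | mem x hx =>
    obtain ⟨j, rfl⟩ := hx
    exact add_mem (coord_mem j) (PolyFun.algebraMap_mem (μ j))
  | algebraMap r => exact PolyFun.algebraMap_mem r
  | add x y _ _ hx hy => exact add_mem hx hy
  | mul x y _ _ hx hy => exact mul_mem hx hy

/-- A polynomial function, restricted to a line, is a polynomial. -/
theorem PolyFun_line {φ : (Fin 3 → ℂ) → ℂ} (h : φ ∈ PolyFun) (v w : Fin 3 → ℂ) :
    ∃ p : ℂ[X], ∀ t, φ (v + t • w) = p.eval t := by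
  induction h using Algebra.adjoin_induction with
  | mem x hx =>
    obtain ⟨j, rfl⟩ := hx
    exact ⟨C (v j) + X * C (w j), fun t => by simp; ring⟩
  | algebraMap r => exact ⟨C r, fun t => by simp⟩
  | add x y _ _ hx hy =>
    obtain ⟨p, hp⟩ := hx
    obtain ⟨q, hq⟩ := hy
    exact ⟨p + q, fun t => by simp [hp, hq]⟩
  | mul x y _ _ hx hy =>
    obtain ⟨p, hp⟩ := hx
    obtain ⟨q, hq⟩ := hy
    exact ⟨p * q, fun t => by simp [hp, hq]⟩

/-- Every element of the enveloping algebra acts as a finite sum of weighted shifts with polynomial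
weights. -/
theorem R_mem_span (u : U) :
    R u ∈ Submodule.span ℂ {t | ∃ φ ∈ PolyFun, ∃ μ : Wt, t = T φ (fun i => (μ i : ℂ))} := by
  induction u using U_induction with
  | hc c =>
    rw [AlgHom.commutes, Algebra.algebraMap_eq_smul_one, one_eq_T]
    exact Submodule.smul_mem _ _ (Submodule.subset_span ⟨1, one_mem _, 0, by
      congr 1; ext i; simp⟩)
  | hE i j =>
    refine Submodule.subset_span ⟨_, coord_mem j, eps i - eps j, ?_⟩
    rw [R_E_eq_T]
    congr 1
    ext l
    simp [eps, Pi.single_apply, apply_ite (Int.cast : ℤ → ℂ)]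
  | hadd u v hu hv => rw [map_add]; exact add_mem hu hv
  | hmul u v hu hv =>
    rw [map_mul]
    generalize R u = x at hu ⊢
    generalize R v = y at hv ⊢
    induction hu using Submodule.span_induction with
    | zero => simp
    | add x y _ _ hx hy => rw [add_mul]; exact add_mem hx hy
    | smul c x _ hx => rw [smul_mul_assoc]; exact Submodule.smul_mem _ _ hx
    | mem x hx =>
      obtain ⟨φ, hφ, μ, rfl⟩ := hx
      induction hv using Submodule.span_induction with
      | zero => simp
      | add x y _ _ hx hy => rw [mul_add]; exact add_mem hx hy
      | smul c x _ hx => rw [mul_smul_comm]; exact Submodule.smul_mem _ _ hx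
      | mem x hx =>
        obtain ⟨ψ, hψ, ν, rfl⟩ := hx
        rw [T_mul]
        refine Submodule.subset_span ⟨_, mul_mem hψ (PolyFun_shift (fun i => (ν i : ℂ)) hφ), ν + μ, ?_⟩
        congr 1
        ext i; simp

/-- Only the shift by ν contributes to this coefficient. The gain is that one polynomial φ serves
all complex exponents, so that values found at natural exponents can be continued to the others. -/
theorem exists_coeff (u : U) (ν : Wt) : ∃ φ ∈ PolyFun, ∀ k,
    monBasis.coord (k + fun i => (ν i : ℂ)) (R u (mono k)) = φ k := by
  have hu := R_mem_span u
  generalize R u = x at hu ⊢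
  induction hu using Submodule.span_induction with
  | zero => exact ⟨0, zero_mem _, fun k => by simp⟩
  | add x y _ _ hx hy =>
    obtain ⟨φ, hφ, h1⟩ := hx
    obtain ⟨ψ, hψ, h2⟩ := hy
    exact ⟨φ + ψ, add_mem hφ hψ, fun k => by rw [LinearMap.add_apply, map_add, h1, h2]; rfl⟩
  | smul c x _ hx =>
    obtain ⟨φ, hφ, h1⟩ := hx
    exact ⟨c • φ, Subalgebra.smul_mem _ hφ c, fun k => by
      rw [LinearMap.smul_apply, map_smul, h1]; rfl⟩
  | mem x hx =>
    obtain ⟨φ, hφ, μ, rfl⟩ := hx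
    by_cases h : μ = ν
    · subst h
      refine ⟨φ, hφ, fun k => ?_⟩
      rw [T_mono, map_smul]
      simp [mono]
    · refine ⟨0, zero_mem _, fun k => ?_⟩
      rw [T_mono, map_smul]
      have : (k + fun i => (μ i : ℂ)) ≠ (k + fun i => (ν i : ℂ)) := by
        intro h'
        apply h
        ext i
        have := congrFun h' i
        simpa using this
      simp [mono, this]

/-! ### Highest vectors for `gl(2)` -/

/-- An integral weight as a complex vector. -/
def wt (ν : Wt) : Fin 3 → ℂ := fun i => (ν i : ℂ)

/-- The exponent `(α - b - c, b, c)`. -/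
def pt (α b c : ℂ) : Fin 3 → ℂ := ![α - b - c, b, c]

@[simp] theorem pt_zero (α b c : ℂ) : pt α b c 0 = α - b - c := rfl
@[simp] theorem pt_one (α b c : ℂ) : pt α b c 1 = b := rfl
@[simp] theorem pt_two (α b c : ℂ) : pt α b c 2 = c := rfl

/-- The pairs `(b, c)` such that `x₁^{α-b-c} x₂^b x₃^c` belongs to `S^α(V)`. -/
def Valid (α : ℂ) (b c : ℕ) : Prop := ∀ n : ℕ, α = n → b + c ≤ n

theorem Valid.mono {α : ℂ} {b c b' : ℕ} (h : Valid α b c) (hb : b' ≤ b) : Valid α b' c :=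
  fun n hn => by have := h n hn; omega

theorem mem_expo_iff (α : ℂ) (k : Fin 3 → ℂ) :
    k ∈ expo α ↔ ∃ b c : ℕ, Valid α b c ∧ k = pt α b c := by
  constructor
  · rintro ⟨h, ⟨b, hb⟩, ⟨c, hc⟩, ha⟩
    have h0 : k 0 = α - b - c := by rw [← h, hb, hc]; ring
    refine ⟨b, c, ?_, ?_⟩
    · intro n hn
      obtain ⟨a, ha⟩ := ha ⟨n, hn⟩
      rw [h0, hn] at ha
      have h3 : (n : ℂ) = ((a + b + c : ℕ) : ℂ) := by push_cast; linear_combination ha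
      have := Nat.cast_injective h3
      omega
    · ext i; fin_cases i
      · exact h0
      · exact hb
      · exact hc
  · rintro ⟨b, c, hv, rfl⟩
    refine ⟨by simp only [pt_zero, pt_one, pt_two]; ring, ⟨b, rfl⟩, ⟨c, rfl⟩, ?_⟩
    rintro ⟨n, hn⟩
    have := hv n hn
    refine ⟨n - b - c, ?_⟩
    rw [pt_zero, hn, Nat.cast_sub (by omega), Nat.cast_sub (by omega)]

theorem pt_mem {α : ℂ} {b c : ℕ} (h : Valid α b c) : pt α b c ∈ expo α :=
  (mem_expo_iff _ _).2 ⟨b, c, h, rfl⟩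

theorem coord_mono (k m : Fin 3 → ℂ) : monBasis.coord m (mono k) = if k = m then 1 else 0 := by
  rw [mono, Module.Basis.coord_apply, Module.Basis.repr_self, Finsupp.single_apply]

theorem coord_eq_zero_of_mem_span {s : Set (Fin 3 → ℂ)} {x : Mon}
    (hx : x ∈ Submodule.span ℂ (mono '' s)) {m : Fin 3 → ℂ} (hm : m ∉ s) :
    monBasis.coord m x = 0 := by
  have : Submodule.span ℂ (mono '' s) ≤ LinearMap.ker (monBasis.coord m) := by
    refine Submodule.span_le.2 ?_
    rintro _ ⟨k, hk, rfl⟩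
    change monBasis.coord m (mono k) = 0
    rw [coord_mono, if_neg]
    rintro rfl
    exact hm hk
  exact this hx

theorem coord_E_diag (i : Fin 3) (m : Fin 3 → ℂ) (y : Mon) :
    monBasis.coord m (R (E i i) y) = m i * monBasis.coord m y := by
  have : (monBasis.coord m) ∘ₗ (R (E i i)) = m i • monBasis.coord m := by
    refine monBasis.ext fun k => ?_
    change monBasis.coord m (R (E i i) (mono k)) = m i * monBasis.coord m (mono k)
    rw [R_E_mono, map_smul, sub_self, add_zero, coord_mono]
    split_ifs with h
    · simp [h]
    · simp
  exact congrArg (fun g => g y) this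

/-- An element of weight `ν` acts on monomials by `x^k ↦ φ(k) x^{k+ν}`. -/
theorem R_mono_of_weight {α : ℂ} {ν : Wt} {u : U}
    (h : ∀ i, adU α (E i i) (proj α u) = (ν i : ℂ) • proj α u) {k : Fin 3 → ℂ} (hk : k ∈ expo α) :
    R u (mono k) = monBasis.coord (k + wt ν) (R u (mono k)) • mono (k + wt ν) := by
  refine monBasis.ext_elem fun m => ?_
  rw [← Module.Basis.coord_apply, ← Module.Basis.coord_apply, map_smul, coord_mono]
  split_ifs with hm
  · subst hm; simp
  · rw [smul_zero]
    have h1 : ∃ i, k i + ν i ≠ m i := by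
      by_contra hcon
      push Not at hcon
      exact hm (funext hcon)
    obtain ⟨i, hi⟩ := h1
    have h2 := h i
    rw [adU_E_proj, ← map_smul, proj_eq_iff] at h2
    have h3 := congrArg (monBasis.coord m) (h2 k hk)
    simp only [map_sub, map_mul, LinearMap.sub_apply, Module.End.mul_apply, map_smul,
      LinearMap.smul_apply, R_E_mono, sub_self, add_zero, coord_E_diag, smul_eq_mul] at h3
    have h4 : (m i - (k i + ν i)) * monBasis.coord m (R u (mono k)) = 0 := by
      linear_combination h3
    exact (mul_eq_zero.1 h4).resolve_left (sub_ne_zero.2 (Ne.symm hi))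

/-! ### Coefficients of a highest vector on monomials -/

section coefficients

variable {α : ℂ} {ν : Wt} {u : U}

/-- The coefficient of `x^{k+ν}` in `u · x^k` for `k = (α - b - c, b, c)`. -/
def cf (α : ℂ) (ν : Wt) (u : U) (b c : ℂ) : ℂ :=
  monBasis.coord (pt α b c + wt ν) (R u (mono (pt α b c)))

theorem R_pt (hu : proj α u ∈ hwSpace α ν) {b c : ℕ} (h : Valid α b c) :
    R u (mono (pt α b c)) = cf α ν u b c • mono (pt α b c + wt ν) :=
  R_mono_of_weight hu.1 (pt_mem h)

/-- The submodule S^α is stable, so a nonzero coefficient forces the target exponent to be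
admissible. -/
theorem cf_support (hν : ν 0 + ν 1 + ν 2 = 0) {b c : ℕ} (h : Valid α b c)
    (hne : cf α ν u b c ≠ 0) :
    0 ≤ ν 1 + b ∧ 0 ≤ ν 2 + c ∧ ∀ n : ℕ, α = n → (b + c : ℤ) ≤ n + ν 0 := by
  have h1 : pt α b c + wt ν ∈ expo α := by
    by_contra hcon
    exact hne (coord_eq_zero_of_mem_span (R_mem α u (mono_mem (pt_mem h))) hcon)
  obtain ⟨-, ⟨b', hb⟩, ⟨c', hc⟩, ha⟩ := h1
  have hb' : (b : ℤ) + ν 1 = b' := by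
    have : ((b + ν 1 : ℤ) : ℂ) = ((b' : ℤ) : ℂ) := by simpa [wt] using hb
    exact_mod_cast this
  have hc' : (c : ℤ) + ν 2 = c' := by
    have : ((c + ν 2 : ℤ) : ℂ) = ((c' : ℤ) : ℂ) := by simpa [wt] using hc
    exact_mod_cast this
  refine ⟨by omega, by omega, fun n hn => ?_⟩
  obtain ⟨a, ha⟩ := ha ⟨n, hn⟩
  have : ((n - b - c + ν 0 : ℤ) : ℂ) = ((a : ℤ) : ℂ) := by
    rw [hn] at ha
    push_cast; simpa [wt] using ha
  have : (n - b - c + ν 0 : ℤ) = a := by exact_mod_cast this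
  omega

/-- For b = 0 the operator E₁₂ kills the monomial, so E₁₂u alone remains of the commutator. This is
the initial condition for the recurrence in b. -/
theorem cf_zero_mul (hu : proj α u ∈ hwSpace α ν) {c : ℕ} (h : Valid α 0 c) :
    cf α ν u (0 : ℕ) c * ν 1 = 0 := by
  have h2 := hu.2
  rw [adU_E_proj, ← map_zero (proj α), proj_eq_iff] at h2
  have h3 := h2 _ (pt_mem h)
  rw [map_sub, map_mul, map_mul, LinearMap.sub_apply, Module.End.mul_apply, Module.End.mul_apply,
    R_pt hu h, map_smul, R_E_mono, R_E_mono, smul_smul] at h3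
  simp only [Nat.cast_zero, pt_one, zero_smul, map_zero, sub_zero, LinearMap.zero_apply,
    smul_mono_eq_zero] at h3
  simpa [wt] using h3

theorem cf_succ (hu : proj α u ∈ hwSpace α ν) {b c : ℕ} (h : Valid α (b + 1) c) :
    cf α ν u (b + 1 : ℕ) c * (b + 1 + ν 1) = (b + 1) * cf α ν u b c := by
  have h2 := hu.2
  rw [adU_E_proj, ← map_zero (proj α), proj_eq_iff] at h2
  have h3 := h2 _ (pt_mem h)
  have h4 : pt α (b + 1 : ℕ) c + (Pi.single 0 1 - Pi.single 1 1) = pt α b c := by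
    ext i; fin_cases i <;> simp [pt]
    ring
  rw [map_sub, map_mul, map_mul, LinearMap.sub_apply, Module.End.mul_apply, Module.End.mul_apply,
    R_pt hu h, map_smul, R_E_mono, R_E_mono, h4, map_smul, R_pt hu (h.mono (Nat.le_succ b)),
    add_right_comm, h4, smul_smul, smul_smul, ← sub_smul, map_zero, LinearMap.zero_apply,
    smul_mono_eq_zero] at h3
  simp only [Pi.add_apply, pt_one, wt, Nat.cast_add, Nat.cast_one] at h3 ⊢
  linear_combination h3

theorem cf_eq_zero_of_pos (hu : proj α u ∈ hwSpace α ν) (h1 : 0 < ν 1) {c : ℕ} :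
    ∀ b : ℕ, Valid α b c → cf α ν u b c = 0 := by
  intro b
  induction b with
  | zero =>
    intro h
    refine (mul_eq_zero.1 (cf_zero_mul hu h)).resolve_right ?_
    exact_mod_cast h1.ne'
  | succ b ih =>
    intro h
    have h2 := cf_succ hu h
    rw [ih (h.mono (Nat.le_succ b)), mul_zero] at h2
    refine (mul_eq_zero.1 h2).resolve_right ?_
    have : (b + 1 + ν 1 : ℤ) ≠ 0 := by omega
    exact_mod_cast this

theorem fall_factorial (q : ℕ) : fall q q = q.factorial := by
  induction q with
  | zero => simp [fall_zero]
  | succ q ih =>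
    rw [fall_succ']; push_cast
    rw [add_sub_cancel_right, ih, Nat.factorial_succ]; push_cast; ring

theorem fall_step (q : ℕ) (x : ℂ) : fall q (x + 1) * (x + 1 - q) = (x + 1) * fall q x := by
  have h1 := fall_succ q (x + 1)
  have h2 := fall_succ' q (x + 1)
  rw [add_sub_cancel_right] at h2
  rw [← h1, h2]

/-- For b ≥ q the recurrence `cf_succ` is solved from its value at b = q. For b < q the target
exponent b - q is negative, and both sides vanish. -/
theorem cf_eq (hν : ν 0 + ν 1 + ν 2 = 0) (hu : proj α u ∈ hwSpace α ν) {q : ℕ} (hq : ν 1 = -q)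
    {b c : ℕ} (h : Valid α b c) :
    cf α ν u b c = cf α ν u q c / q.factorial * fall q b := by
  have key : ∀ j : ℕ, Valid α (q + j) c →
      cf α ν u (q + j : ℕ) c = cf α ν u q c / q.factorial * fall q (q + j : ℕ) := by
    intro j
    induction j with
    | zero =>
      intro _
      have : (q.factorial : ℂ) ≠ 0 := by exact_mod_cast q.factorial_ne_zero
      rw [add_zero, fall_factorial]; field_simp
    | succ j ih =>
      intro h
      have h1 := cf_succ (b := q + j) hu h
      have h2 := fall_step q (q + j : ℕ)
      rw [ih (h.mono (Nat.le_succ _)), hq] at h1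
      have h3 : ((q + j : ℕ) + 1 - q : ℂ) ≠ 0 := by
        push_cast
        have : ((j + 1 : ℕ) : ℂ) ≠ 0 := by exact_mod_cast Nat.succ_ne_zero j
        convert this using 1; push_cast; ring
      apply mul_right_cancel₀ h3
      push_cast at h1 h2 ⊢
      rw [← add_assoc]
      linear_combination h1 - (cf α ν u q c / q.factorial) * h2
  by_cases hb : q ≤ b
  · obtain ⟨j, rfl⟩ := Nat.exists_eq_add_of_le hb
    exact key j h
  · rw [(fall_nat_eq_zero_iff q b).2 (by omega), mul_zero]
    by_contra hne
    have := (cf_support hν h hne).1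
    omega

theorem cf_poly_left (α : ℂ) (ν : Wt) (u : U) (c : ℂ) :
    ∃ p : ℂ[X], ∀ b, cf α ν u b c = p.eval b := by
  obtain ⟨φ, hφ, h⟩ := exists_coeff u ν
  obtain ⟨p, hp⟩ := PolyFun_line hφ ![α - c, 0, c] ![-1, 1, 0]
  refine ⟨p, fun b => ?_⟩
  rw [← hp, cf]
  change monBasis.coord (pt α b c + fun i => (ν i : ℂ)) _ = _
  rw [h]
  congr 1
  ext i; fin_cases i <;> simp [pt]
  ring

theorem cf_poly_right (α : ℂ) (ν : Wt) (u : U) (b : ℂ) :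
    ∃ p : ℂ[X], ∀ c, cf α ν u b c = p.eval c := by
  obtain ⟨φ, hφ, h⟩ := exists_coeff u ν
  obtain ⟨p, hp⟩ := PolyFun_line hφ ![α - b, b, 0] ![-1, 0, 1]
  refine ⟨p, fun c => ?_⟩
  rw [← hp, cf]
  change monBasis.coord (pt α b c + fun i => (ν i : ℂ)) _ = _
  rw [h]
  congr 1
  ext i; fin_cases i <;> simp [pt]
  ring

/-- Since ∂₁ kills monomials with first exponent 0, natural first exponents remain natural, whatever
α is. `cf_eq_zero_of_neg` uses this at b = α - c, where the first exponent is 0, to exclude negative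
ν₁ also when α is not natural. -/
theorem R_mem_span_nat (u : U) : ∀ {x : Mon},
    x ∈ Submodule.span ℂ (mono '' {k | ∃ a : ℕ, k 0 = a}) →
    R u x ∈ Submodule.span ℂ (mono '' {k | ∃ a : ℕ, k 0 = a}) := by
  induction u using U_induction with
  | hc c =>
    intro x hx
    rw [AlgHom.commutes, Algebra.algebraMap_eq_smul_one]
    exact Submodule.smul_mem _ _ hx
  | hadd u v hu hv => intro x hx; rw [map_add]; exact add_mem (hu hx) (hv hx)
  | hmul u v hu hv => intro x hx; rw [map_mul]; exact hu (hv hx)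
  | hE i j =>
    intro x hx
    induction hx using Submodule.span_induction with
    | zero => simp
    | add x y _ _ hx hy => rw [map_add]; exact add_mem hx hy
    | smul c x _ hx => rw [map_smul]; exact Submodule.smul_mem _ _ hx
    | mem x hx =>
      obtain ⟨k, ⟨a, ha⟩, rfl⟩ := hx
      rw [R_E_mono]
      by_cases h0 : k j = 0
      · simp [h0]
      refine Submodule.smul_mem _ _ (Submodule.subset_span ⟨_, ?_, rfl⟩)
      have : ∃ a' : ℕ, k 0 - (Pi.single j 1 : Fin 3 → ℂ) 0 = a' := by
        by_cases hj : j = 0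
        · subst hj
          cases a with
          | zero => exact absurd (by simpa using ha) h0
          | succ a => exact ⟨a, by simp [ha]⟩
        · exact ⟨a, by simp [ha, Ne.symm hj]⟩
      obtain ⟨a', ha'⟩ := this
      by_cases hi : i = 0
      · exact ⟨a' + 1, by subst hi; push_cast; rw [← ha']; simp; ring⟩
      · exact ⟨a', by rw [← ha']; simp [Ne.symm hi]; ring⟩

theorem cf_eq_zero_of_neg (h0 : ν 0 < 0) (c : ℂ) : cf α ν u (α - c) c = 0 := by
  refine coord_eq_zero_of_mem_span (s := {k | ∃ a : ℕ, k 0 = a}) (R_mem_span_nat u ?_) ?_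
  · exact Submodule.subset_span ⟨_, ⟨0, by simp⟩, rfl⟩
  · rintro ⟨a, ha⟩
    have h1 : ((ν 0 : ℤ) : ℂ) = ((a : ℤ) : ℂ) := by simpa [wt] using ha
    have : ν 0 = a := by exact_mod_cast h1
    omega

end coefficients

/-! ### The generator u^+_ν and the weights that occur -/

theorem poly_ext_nat {p q : ℂ[X]} (n : ℕ) (h : ∀ m : ℕ, n ≤ m → p.eval (m : ℂ) = q.eval (m : ℂ)) :
    p = q := by
  refine Polynomial.eq_of_infinite_eval_eq p q ?_
  refine Set.Infinite.mono (s := (Nat.cast : ℕ → ℂ) '' Set.Ici n) ?_ ?_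
  · rintro _ ⟨m, hm, rfl⟩
    exact h m hm
  · exact (Set.Ici_infinite n).image Nat.cast_injective.injOn

/-- The falling factorial as a polynomial. -/
def fallPoly (n : ℕ) : ℂ[X] := ∏ j ∈ Finset.range n, (X - C (j : ℂ))

theorem eval_fallPoly (n : ℕ) (x : ℂ) : (fallPoly n).eval x = fall n x := by
  simp [fallPoly, fall, eval_prod]

theorem fallPoly_dvd {p : ℂ[X]} {n : ℕ} (h : ∀ j < n, p.eval (j : ℂ) = 0) : fallPoly n ∣ p := by
  refine Finset.prod_dvd_of_coprime ?_ ?_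
  · intro i _ j _ hij
    exact Polynomial.pairwise_coprime_X_sub_C Nat.cast_injective hij
  · intro j hj
    exact dvd_iff_isRoot.2 (h j (Finset.mem_range.1 hj))

/-- A representative of `u^+_ν`. -/
def uLift (ν : Wt) : U :=
  if ν 2 ≤ 0 then E 0 1 ^ (-ν 1).toNat * E 0 2 ^ (-ν 2).toNat
  else E 0 1 ^ (ν 0).toNat * E 2 1 ^ (ν 2).toNat

theorem uPlus_eq (α : ℂ) (ν : Wt) : uPlus α ν = proj α (uLift ν) := by
  rw [uPlus, uLift]; split_ifs <;> rfl

/-- The weight of the shift operator `f(E₃₃) u^+_ν`. -/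
def uFun (ν : Wt) (f : ℂ[X]) (k : Fin 3 → ℂ) : ℂ :=
  fall (-ν 1).toNat (k 1) * fall (-ν 2).toNat (k 2) * f.eval (k 2 + ν 2)

theorem fall_add (m n : ℕ) (x : ℂ) : fall (m + n) x = fall m x * fall n (x - m) := by
  rw [fall, Finset.prod_range_add, fall, fall]
  congr 1
  exact Finset.prod_congr rfl fun j _ => by push_cast; ring

/-- The two shapes of u^+_ν have one common weight function. For ν₃ > 0 the factors of E₁₂^{ν₁} and
E₃₂^{ν₃} are consecutive pieces of a single falling factorial of length ν₁ + ν₃ = -ν₂ in the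
exponent of x₂. -/
theorem R_uLift {ν : Wt} (hν : ν 0 + ν 1 + ν 2 = 0) (h0 : 0 ≤ ν 0) (h1 : ν 1 ≤ 0) :
    R (uLift ν) = T (uFun ν 1) (wt ν) := by
  rw [uLift]
  split_ifs with h2
  · rw [map_mul, T_pow_shift _ _ _ (by decide), T_pow_shift _ _ _ (by decide), T_mul]
    have e1 : (((-ν 1).toNat : ℤ) : ℂ) = ((-ν 1 : ℤ) : ℂ) := by rw [Int.toNat_of_nonneg]; omega
    have e2 : (((-ν 2).toNat : ℤ) : ℂ) = ((-ν 2 : ℤ) : ℂ) := by rw [Int.toNat_of_nonneg]; omega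
    have e0 : (ν 0 : ℂ) = -ν 1 - ν 2 := by
      have : ν 0 = -ν 1 - ν 2 := by omega
      exact_mod_cast congrArg (Int.cast : ℤ → ℂ) this
    push_cast at e1 e2
    congr 1
    · ext k; simp [uFun]; ring
    · ext i; fin_cases i <;> simp [wt, e0, e1, e2]
      ring
  · rw [map_mul, T_pow_shift _ _ _ (by decide), T_pow_shift _ _ _ (by decide), T_mul]
    have e0 : (((ν 0).toNat : ℤ) : ℂ) = ((ν 0 : ℤ) : ℂ) := by rw [Int.toNat_of_nonneg]; omega
    have e2 : (((ν 2).toNat : ℤ) : ℂ) = ((ν 2 : ℤ) : ℂ) := by rw [Int.toNat_of_nonneg]; omega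
    have e1 : (ν 1 : ℂ) = -ν 0 - ν 2 := by
      have : ν 1 = -ν 0 - ν 2 := by omega
      exact_mod_cast congrArg (Int.cast : ℤ → ℂ) this
    push_cast at e0 e2
    have h3 : (-ν 1).toNat = (ν 2).toNat + (ν 0).toNat := by omega
    have h4 : (-ν 2).toNat = 0 := by omega
    congr 1
    · ext k
      rw [uFun, h3, h4, fall_add]
      simp [fall_zero, sub_eq_add_neg]
    · ext i; fin_cases i <;> simp [wt, e0, e1, e2]
      ring

theorem act_uPlus (α : ℂ) (ν : Wt) (f : ℂ[X]) :
    act α f (uPlus α ν) = proj α (aeval (E 2 2) f * uLift ν) := by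
  rw [uPlus_eq, act_proj]

theorem R_act {ν : Wt} (hν : ν 0 + ν 1 + ν 2 = 0) (h0 : 0 ≤ ν 0) (h1 : ν 1 ≤ 0) (f : ℂ[X]) :
    R (aeval (E 2 2) f * uLift ν) = T (uFun ν f) (wt ν) := by
  rw [map_mul, R_uLift hν h0 h1, R_aeval_E22, T_mul, add_zero]
  congr 1
  ext k
  simp [uFun, wt]

/-- E₃₃ acts after the shift by ν, hence the argument c + ν₃. The falling factorials vanish unless b
≥ -ν₂ and c ≥ -ν₃, and the choice b = -ν₂ leaves the widest range for c. -/
theorem act_eq_act_iff {α : ℂ} {ν : Wt} (hν : ν 0 + ν 1 + ν 2 = 0) (h0 : 0 ≤ ν 0) (h1 : ν 1 ≤ 0)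
    (f g : ℂ[X]) : act α f (uPlus α ν) = act α g (uPlus α ν) ↔
      ∀ c : ℕ, -ν 2 ≤ c → (∀ n : ℕ, α = n → -ν 1 + c ≤ n) →
        f.eval (c + ν 2 : ℂ) = g.eval (c + ν 2 : ℂ) := by
  rw [act_uPlus, act_uPlus, proj_eq_iff, R_act hν h0 h1, R_act hν h0 h1]
  simp only [T_mono, smul_mono_left_inj]
  constructor
  · intro h c hc hv
    have hv' : Valid α (-ν 1).toNat c := fun n hn => by have := hv n hn; omega
    have h2 := h _ (pt_mem hv')
    simp only [uFun, pt_one, pt_two] at h2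
    refine mul_left_cancel₀ (mul_ne_zero ?_ ?_) h2
    · rw [Ne, fall_nat_eq_zero_iff]; omega
    · rw [Ne, fall_nat_eq_zero_iff]; omega
  · intro h k hk
    obtain ⟨b, c, hv, rfl⟩ := (mem_expo_iff _ _).1 hk
    simp only [uFun, pt_one, pt_two]
    by_cases hb : b < (-ν 1).toNat
    · simp [(fall_nat_eq_zero_iff _ _).2 hb]
    by_cases hc : c < (-ν 2).toNat
    · simp [(fall_nat_eq_zero_iff _ _).2 hc]
    rw [h c (by omega) (fun n hn => by have := hv n hn; omega)]

theorem R_commutator {w : U} {φ : (Fin 3 → ℂ) → ℂ} {μ : Fin 3 → ℂ} (h : R w = T φ μ)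
    (i j : Fin 3) : R (E i j * w - w * E i j) =
      T (fun k => φ k * (k j + μ j) - k j * φ (k + (Pi.single i 1 - Pi.single j 1)))
        (μ + (Pi.single i 1 - Pi.single j 1)) := by
  rw [map_sub, map_mul, map_mul, h, R_E_eq_T, T_mul, T_mul, add_comm _ μ, T_sub]
  rfl

theorem act_mem_hwSpace {α : ℂ} {ν : Wt} (hν : ν 0 + ν 1 + ν 2 = 0) (h0 : 0 ≤ ν 0) (h1 : ν 1 ≤ 0)
    (f : ℂ[X]) : act α f (uPlus α ν) ∈ hwSpace α ν := by
  have hR := R_act hν h0 h1 f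
  rw [act_uPlus]
  refine ⟨fun i => ?_, ?_⟩
  · rw [adU_E_proj, ← map_smul, proj_eq_iff]
    intro k _
    rw [R_commutator hR, map_smul, hR, T_smul, sub_self, add_zero]
    congr 2
    ext k
    simp [wt]; ring
  · rw [adU_E_proj, ← map_zero (proj α), proj_eq_iff]
    intro k _
    rw [R_commutator hR, T_mono, map_zero, LinearMap.zero_apply, smul_mono_eq_zero]
    have h2 := fall_step (-ν 1).toNat (k 1 - 1)
    have e1 : (((-ν 1).toNat : ℤ) : ℂ) = ((-ν 1 : ℤ) : ℂ) := by rw [Int.toNat_of_nonneg]; omega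
    push_cast at e1
    rw [sub_add_cancel, e1] at h2
    simp only [uFun, wt, Pi.add_apply, Pi.sub_apply, Pi.single_eq_same, ne_eq, Fin.isValue,
      one_ne_zero, not_false_eq_true, Pi.single_eq_of_ne, zero_sub, Fin.reduceEq, sub_zero,
      add_zero, ← sub_eq_add_neg]
    linear_combination (fall (-ν 2).toNat (k 2) * f.eval (k 2 + ν 2)) * h2

/-- If `α ∉ ℕ`, every highest vector for `gl(2)` is a multiple of `u^+_ν`. -/
theorem exists_poly_generic {α : ℂ} (hα : ∀ n : ℕ, α ≠ n) {ν : Wt} (hν : ν 0 + ν 1 + ν 2 = 0)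
    {u : U} (hu : proj α u ∈ hwSpace α ν) (hne : proj α u ≠ 0) :
    0 ≤ ν 0 ∧ ν 1 ≤ 0 ∧ ∃ f : ℂ[X], proj α u = act α f (uPlus α ν) := by
  have hval : ∀ b c : ℕ, Valid α b c := fun b c n hn => absurd hn (hα n)
  have hne' : ∃ b c : ℕ, cf α ν u b c ≠ 0 := by
    by_contra hcon
    push Not at hcon
    refine hne ((proj_eq_zero_iff α u).2 ((mem_J_iff α u).2 fun k hk => ?_))
    obtain ⟨b, c, hv, rfl⟩ := (mem_expo_iff _ _).1 hk
    rw [R_pt hu hv, hcon, zero_smul]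
  have h1 : ν 1 ≤ 0 := by
    by_contra hcon
    obtain ⟨b, c, hbc⟩ := hne'
    exact hbc (cf_eq_zero_of_pos hu (not_le.1 hcon) b (hval b c))
  obtain ⟨q, hq⟩ : ∃ q : ℕ, ν 1 = -q := ⟨(-ν 1).toNat, by omega⟩
  have hcf : ∀ b c : ℕ, cf α ν u b c = cf α ν u q c / q.factorial * fall q b :=
    fun b c => cf_eq hν hu hq (hval b c)
  have h0 : 0 ≤ ν 0 := by
    by_contra hcon
    obtain ⟨b, c, hbc⟩ := hne'
    apply hbc
    rw [hcf]
    -- The coefficient is polynomial in b, so its formula at natural b also holds at b = α - c.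
    -- There it must vanish because ν₁ < 0, whereas the falling factorial is nonzero as α is not
    -- natural.
    obtain ⟨p, hp⟩ := cf_poly_left α ν u c
    have h2 : p = C (cf α ν u q c / q.factorial) * fallPoly q := by
      refine poly_ext_nat 0 fun m _ => ?_
      rw [← hp, hcf, eval_mul, eval_C, eval_fallPoly]
    have h3 := hp (α - c)
    rw [cf_eq_zero_of_neg (not_le.1 hcon), h2, eval_mul, eval_C, eval_fallPoly] at h3
    rcases mul_eq_zero.1 h3.symm with h4 | h4
    · rw [h4, zero_mul]
    · obtain ⟨j, -, hj⟩ := (fall_eq_zero_iff _ _).1 h4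
      exact absurd (by push_cast; linear_combination hj) (hα (j + c))
  refine ⟨h0, h1, ?_⟩
  obtain ⟨p, hp⟩ := cf_poly_right α ν u q
  -- At b = q the coefficient vanishes for c < -ν₃, since x₃ would get a negative exponent. This
  -- splits off the factor contributed by u^+_ν.
  obtain ⟨p', hp'⟩ : fallPoly (-ν 2).toNat ∣ p := by
    refine fallPoly_dvd fun j hj => ?_
    rw [← hp]
    by_contra hcon
    have := (cf_support hν (hval q j) hcon).2.1
    omega
  -- The shift by ν₃ compensates for E₃₃ being evaluated at c + ν₃; the factorial is the
  -- normalization in `cf_eq`.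
  refine ⟨C (q.factorial : ℂ)⁻¹ * p'.comp (X - C (ν 2 : ℂ)), ?_⟩
  rw [act_uPlus, proj_eq_iff, R_act hν h0 h1]
  intro k hk
  obtain ⟨b, c, hv, rfl⟩ := (mem_expo_iff _ _).1 hk
  rw [R_pt hu hv, T_mono]
  congr 1
  have h5 : (-ν 1).toNat = q := by omega
  rw [hcf, hp, hp', eval_mul, eval_fallPoly, uFun, h5]
  simp
  ring

/-- Only finitely many exponents occur for α = n, so Lagrange interpolation replaces the division of
polynomials used for generic α. -/
theorem exists_poly_nat {n : ℕ} {ν : Wt} (hν : ν 0 + ν 1 + ν 2 = 0)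
    {u : U} (hu : proj n u ∈ hwSpace n ν) (hne : proj n u ≠ 0) :
    0 ≤ ν 0 ∧ ν 1 ≤ 0 ∧ (ν 0 ≤ n ∧ -ν 1 ≤ n) ∧ ∃ f : ℂ[X], proj n u = act n f (uPlus n ν) := by
  have hval : ∀ {b c : ℕ}, Valid n b c ↔ b + c ≤ n :=
    ⟨fun h => h n rfl, fun h m hm => by rw [← Nat.cast_injective hm]; exact h⟩
  obtain ⟨b, c, hv, hbc⟩ : ∃ b c : ℕ, Valid n b c ∧ cf n ν u b c ≠ 0 := by
    by_contra hcon
    push Not at hcon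
    refine hne ((proj_eq_zero_iff _ u).2 ((mem_J_iff _ u).2 fun k hk => ?_))
    obtain ⟨b, c, hv, rfl⟩ := (mem_expo_iff _ _).1 hk
    rw [R_pt hu hv, hcon b c hv, zero_smul]
  have h1 : ν 1 ≤ 0 := by
    by_contra hcon
    exact hbc (cf_eq_zero_of_pos hu (not_le.1 hcon) b hv)
  obtain ⟨q, hq⟩ : ∃ q : ℕ, ν 1 = -q := ⟨(-ν 1).toNat, by omega⟩
  have hcf : ∀ b c : ℕ, Valid n b c → cf n ν u b c = cf n ν u q c / q.factorial * fall q b :=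
    fun b c h => cf_eq hν hu hq h
  have hs := cf_support hν hv hbc
  have hs3 := hs.2.2 n rfl
  have hvn := hval.1 hv
  have h0 : 0 ≤ ν 0 := by
    by_contra hcon
    -- Keep c and raise b until the exponent of x₁ is 0. The falling factorial stays nonzero, but
    -- the target would have first exponent ν₁ < 0.
    have hv' : Valid n (n - c) c := hval.2 (by omega)
    have h2 : cf n ν u (n - c : ℕ) c ≠ 0 := by
      rw [hcf _ _ hv] at hbc
      rw [hcf _ _ hv']
      refine mul_ne_zero (left_ne_zero_of_mul hbc) ?_
      rw [Ne, fall_nat_eq_zero_iff]; omega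
    have := (cf_support hν hv' h2).2.2 n rfl
    omega
  refine ⟨h0, h1, ⟨by omega, by omega⟩, ?_⟩
  set r := (-ν 2).toNat with hr
  have hinj : Set.InjOn (fun c : ℕ => (c + ν 2 : ℂ)) (Finset.range (n + 1)) := by
    intro x _ y _ hxy
    simpa using hxy
  -- For c < r the prescribed value is a quotient by 0; it is harmless, because the factor `fall r
  -- c` of u^+_ν vanishes there.
  refine ⟨Lagrange.interpolate (Finset.range (n + 1)) (fun c : ℕ => (c + ν 2 : ℂ))
    (fun c => cf n ν u q c / q.factorial / fall r c), ?_⟩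
  rw [act_uPlus, proj_eq_iff, R_act hν h0 h1]
  intro k hk
  obtain ⟨b, c, hv, rfl⟩ := (mem_expo_iff _ _).1 hk
  rw [R_pt hu hv, T_mono]
  congr 1
  have h5 : (-ν 1).toNat = q := by omega
  have hvn := hval.1 hv
  rw [uFun, pt_one, pt_two, Lagrange.eval_interpolate_at_node (v := fun c : ℕ => (c + ν 2 : ℂ)) _
    hinj (Finset.mem_range.2 (by omega : c < n + 1)), h5, ← hr]
  by_cases hc : c < r
  · rw [(fall_nat_eq_zero_iff _ _).2 hc, mul_zero, zero_mul]
    by_contra hcon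
    have := (cf_support hν hv hcon).2.1
    omega
  · have : fall r (c : ℂ) ≠ 0 := by rw [Ne, fall_nat_eq_zero_iff]; exact hc
    rw [hcf _ _ hv]
    field_simp

theorem act_zero (α : ℂ) (a : A α) : act α 0 a = 0 := by simp [act]

theorem uPlus_ne_zero {α : ℂ} {ν : Wt} (hν : ν 0 + ν 1 + ν 2 = 0) (h0 : 0 ≤ ν 0) (h1 : ν 1 ≤ 0)
    (hn : ∀ n : ℕ, α = n → ν 0 ≤ n ∧ -ν 1 ≤ n) : uPlus α ν ≠ 0 := by
  intro h
  rw [← act_one α (uPlus α ν), ← act_zero α (uPlus α ν), act_eq_act_iff hν h0 h1] at h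
  have := h (-ν 2).toNat (by omega) (fun n hn' => by have := hn n hn'; omega)
  simp at this

theorem mem_Qplus_iff {α : ℂ} {ν : Wt} : ν ∈ Qplus α ↔ ν 0 + ν 1 + ν 2 = 0 ∧ 0 ≤ ν 0 ∧ ν 1 ≤ 0 ∧
      ∀ n : ℕ, α = n → ν 0 ≤ n ∧ -ν 1 ≤ n := by
  constructor
  · rintro ⟨hν, hne⟩
    obtain ⟨a, ha, ha0⟩ := (Submodule.ne_bot_iff _).1 hne
    obtain ⟨u, rfl⟩ := proj_surjective α a
    by_cases hα : ∃ n : ℕ, α = n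
    · obtain ⟨n, rfl⟩ := hα
      obtain ⟨h0, h1, h2, -⟩ := exists_poly_nat hν ha ha0
      exact ⟨hν, h0, h1, fun m hm => by rw [← Nat.cast_injective hm]; exact h2⟩
    · push Not at hα
      obtain ⟨h0, h1, -⟩ := exists_poly_generic hα hν ha ha0
      exact ⟨hν, h0, h1, fun m hm => absurd hm (hα m)⟩
  · rintro ⟨hν, h0, h1, hn⟩
    refine ⟨hν, (Submodule.ne_bot_iff _).2 ⟨uPlus α ν, ?_, uPlus_ne_zero hν h0 h1 hn⟩⟩
    rw [← act_one α (uPlus α ν)]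
    exact act_mem_hwSpace hν h0 h1 1

theorem mem_hwSpace_iff {α : ℂ} {ν : Wt} (h : ν ∈ Qplus α) (a : A α) :
    a ∈ hwSpace α ν ↔ ∃ f : ℂ[X], a = act α f (uPlus α ν) := by
  obtain ⟨hν, h0, h1, -⟩ := mem_Qplus_iff.1 h
  constructor
  · intro ha
    by_cases ha0 : a = 0
    · exact ⟨0, by rw [ha0, act_zero]⟩
    obtain ⟨u, rfl⟩ := proj_surjective α a
    by_cases hα : ∃ n : ℕ, α = n
    · obtain ⟨n, rfl⟩ := hα
      exact (exists_poly_nat hν ha ha0).2.2.2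
    · push Not at hα
      exact (exists_poly_generic hα hν ha ha0).2.2
  · rintro ⟨f, rfl⟩
    exact act_mem_hwSpace hν h0 h1 f

theorem act_injective_generic {α : ℂ} (hα : ∀ n : ℕ, α ≠ n) {ν : Wt} (h : ν ∈ Qplus α)
    {f g : ℂ[X]} (hfg : act α f (uPlus α ν) = act α g (uPlus α ν)) : f = g := by
  obtain ⟨hν, h0, h1, -⟩ := mem_Qplus_iff.1 h
  rw [act_eq_act_iff hν h0 h1] at hfg
  refine poly_ext_nat (ν 2).toNat fun m hm => ?_
  have := hfg (m - ν 2).toNat (by omega) (fun n hn => absurd hn (hα n))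
  have e : (((m - ν 2).toNat : ℤ) : ℂ) = ((m - ν 2 : ℤ) : ℂ) := by
    rw [Int.toNat_of_nonneg]; omega
  push_cast at e
  simpa [e] using this

/-- For `α = n`, the relation `≡_ν` is agreement at the integers from `max(0, ν₃)` to `n - ν₁`. -/
theorem act_eq_act_nat_iff {n : ℕ} {ν : Wt} (h : ν ∈ Qplus n) (f g : ℂ[X]) :
    act n f (uPlus n ν) = act n g (uPlus n ν) ↔
      ∀ m : ℤ, 0 ≤ m → ν 2 ≤ m → m ≤ n - ν 0 → f.eval (m : ℂ) = g.eval (m : ℂ) := by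
  obtain ⟨hν, h0, h1, -⟩ := mem_Qplus_iff.1 h
  rw [act_eq_act_iff hν h0 h1]
  constructor
  · intro h m hm0 hm2 hmn
    have := h (m - ν 2).toNat (by omega) (fun n' hn' => by
      have := Nat.cast_injective hn'; omega)
    have e : (((m - ν 2).toNat : ℤ) : ℂ) = ((m - ν 2 : ℤ) : ℂ) := by
      rw [Int.toNat_of_nonneg]; omega
    push_cast at e
    simpa [e] using this
  · intro h c hc hv
    have := h (c + ν 2) (by omega) (by omega) (by have := hv n rfl; omega)
    exact_mod_cast this

/-- Each generator is a polynomial multiple of the other, and freeness makes the product of the two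
polynomials equal to 1, so both are constants. -/
theorem generator_unique {α : ℂ} (hα : ∀ n : ℕ, α ≠ n) {ν : Wt} (h : ν ∈ Qplus α) {w : A α}
    (hw : ∀ a : A α, a ∈ hwSpace α ν ↔ ∃ f : ℂ[X], a = act α f w) :
    ∃ c : ℂ, c ≠ 0 ∧ w = c • uPlus α ν := by
  obtain ⟨g, hg⟩ := (mem_hwSpace_iff h w).1 ((hw w).2 ⟨1, (act_one α w).symm⟩)
  obtain ⟨f, hf⟩ := (hw (uPlus α ν)).1
    ((mem_hwSpace_iff h _).2 ⟨1, (act_one α _).symm⟩)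
  rw [hg, ← act_mul] at hf
  have h1 : f * g = 1 := (act_injective_generic hα h ((act_one α _).trans hf)).symm
  obtain ⟨c, hc, rfl⟩ := Polynomial.isUnit_iff.1 (IsUnit.of_mul_eq_one_right f h1)
  refine ⟨c, hc.ne_zero, ?_⟩
  rw [hg, ← mul_one (C c), act_C_mul, act_one]

/-! ### The difference operator, its ladder operators, and its polynomial eigenfunctions -/

/-- The difference operator with parameters `p`, `q`, `r`. -/
def hahnOp (α p q r : ℂ) (f : ℂ[X]) : ℂ[X] :=
  (X + C (r + 1)) * (X + C (p - α)) * fwd f - X * (X - C (q + α + 2)) * bwd f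

/-- The operator which raises the degree by one and lowers the parameters `p` and `r`. -/
def lad (α p q r : ℂ) (g : ℂ[X]) : ℂ[X] :=
  X * (C (α + q + 2) - X) * g.comp (X - 1) - (X + C r) * (C (α - p + 1) - X) * g

/-- The polynomials obtained from `1` by iterating the ladder operators. -/
def ladF (α : ℂ) : ℕ → ℂ → ℂ → ℂ → ℂ[X]
  | 0, _, _, _ => 1
  | k + 1, p, q, r => lad α (p + 1) q (r + 1) (ladF α k (p + 1) q (r + 1))

theorem eval_fwd (f : ℂ[X]) (t : ℂ) : (fwd f).eval t = f.eval (t + 1) - f.eval t := by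
  simp [fwd]

theorem eval_bwd (f : ℂ[X]) (t : ℂ) : (bwd f).eval t = f.eval t - f.eval (t - 1) := by
  simp [bwd]

theorem eval_hahnOp (α p q r : ℂ) (f : ℂ[X]) (t : ℂ) : (hahnOp α p q r f).eval t =
    (t + (r + 1)) * (t + (p - α)) * (f.eval (t + 1) - f.eval t)
      - t * (t - (q + α + 2)) * (f.eval t - f.eval (t - 1)) := by
  simp [hahnOp, eval_fwd, eval_bwd]

theorem eval_lad (α p q r : ℂ) (f : ℂ[X]) (t : ℂ) : (lad α p q r f).eval t =
    t * (α + q + 2 - t) * f.eval (t - 1) - (t + r) * (α - p + 1 - t) * f.eval t := by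
  simp [lad]

theorem lad_C_mul (α p q r c : ℂ) (f : ℂ[X]) : lad α p q r (C c * f) = C c * lad α p q r f := by
  rw [lad, lad, mul_comp, C_comp]; ring

theorem hahnOp_C_mul (α p q r c : ℂ) (f : ℂ[X]) :
    hahnOp α p q r (C c * f) = C c * hahnOp α p q r f := by
  rw [hahnOp, hahnOp, fwd, bwd, fwd, bwd, mul_comp, mul_comp, C_comp, C_comp]; ring

theorem hahnOp_sub (α p q r : ℂ) (f g : ℂ[X]) :
    hahnOp α p q r (f - g) = hahnOp α p q r f - hahnOp α p q r g := by
  simp only [hahnOp, fwd, bwd, sub_comp]; ring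

/-- This is the shape invariance of the factorization method, and it needs p = q + r. The constant
is the eigenvalue gap (k+1)(k+1+2p+2) - k(k+2(p+1)+2) = 2p + 3, the same for all k. -/
theorem hahnOp_lad (α p q r : ℂ) (hp : p = q + r) (g : ℂ[X]) :
    hahnOp α p q r (lad α (p + 1) q (r + 1) g) =
      lad α (p + 1) q (r + 1) (hahnOp α (p + 1) q (r + 1) g)
        + C (2 * p + 3) * lad α (p + 1) q (r + 1) g := by
  subst hp
  refine Polynomial.funext fun t => ?_
  have e1 : t + 1 - 1 = t := by ring
  have e2 : t - 1 + 1 = t := by ring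
  simp only [eval_add, eval_mul, eval_C, eval_hahnOp, eval_lad, e1, e2]
  ring

theorem hahnOp_ladF (α : ℂ) (k : ℕ) : ∀ p q r : ℂ, p = q + r →
    hahnOp α p q r (ladF α k p q r) = C (k * (k + 2 * p + 2)) * ladF α k p q r := by
  induction k with
  | zero => intro p q r _; simp [ladF, hahnOp, fwd, bwd]
  | succ k ih =>
    intro p q r hp
    rw [ladF, hahnOp_lad α p q r hp, ih _ _ _ (by rw [hp]; ring), lad_C_mul, ← add_mul, ← C_add]
    congr 2
    push_cast; ring

/-- At t = 0 the term of `lad` with g(t - 1) drops out, so the value at 0 is a product of factors (r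
+ 1 + j)(p - α + j). It becomes the nonzero constant in front of the ₃F₂. -/
theorem eval_ladF_zero_ne (α : ℂ) (k : ℕ) : ∀ p q r : ℂ, (∀ j < k, r + 1 + j ≠ 0) →
    (∀ j < k, p - α + j ≠ 0) → (ladF α k p q r).eval 0 ≠ 0 := by
  induction k with
  | zero => intro p q r _ _; simp [ladF]
  | succ k ih =>
    intro p q r h1 h2
    rw [ladF, eval_lad]
    have h3 := ih (p + 1) q (r + 1)
      (fun j hj => by
        have := h1 (j + 1) (by omega); push_cast at this
        intro h; apply this; linear_combination h)
      (fun j hj => by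
        have := h2 (j + 1) (by omega); push_cast at this
        intro h; apply this; linear_combination h)
    have h4 := h1 0 (by omega)
    have h5 := h2 0 (by omega)
    have : (r + 1) * (p - α) * (ladF α k (p + 1) q (r + 1)).eval 0 ≠ 0 := by
      refine mul_ne_zero (mul_ne_zero ?_ ?_) h3
      · simpa using h4
      · simpa using h5
    intro h
    apply this
    linear_combination h

theorem degree_comp_sub_lt {f : ℂ[X]} (hf : f ≠ 0) (c : ℂ) :
    (f.comp (X + C c) - f).degree < f.degree := by
  have hd : (f.comp (X + C c)).natDegree = f.natDegree := by
    rw [natDegree_comp, natDegree_X_add_C, mul_one]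
  have h0 : f.comp (X + C c) ≠ 0 := by
    intro h
    apply hf
    have := congrArg (fun g => g.comp (X - C c)) h
    simpa [comp_assoc] using this
  have hl : (f.comp (X + C c)).leadingCoeff = f.leadingCoeff := by
    rw [leadingCoeff_comp (by simp), leadingCoeff_X_add_C, one_pow, mul_one]
  have := degree_sub_lt_left (by rw [degree_eq_natDegree h0, degree_eq_natDegree hf, hd]) h0 hl
  rwa [degree_eq_natDegree h0, hd, ← degree_eq_natDegree hf] at this

theorem fwd_degree {f : ℂ[X]} {n : ℕ} (hf : f.degree < (n + 1 : ℕ)) : (fwd f).degree < n := by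
  by_cases h0 : f = 0
  · simp [h0, fwd, bot_lt_iff_ne_bot]
  · have h1 : (fwd f).degree < f.degree := by simpa [fwd] using degree_comp_sub_lt h0 1
    rw [degree_eq_natDegree h0] at h1 hf
    refine lt_of_lt_of_le h1 ?_
    have : f.natDegree < n + 1 := by exact_mod_cast hf
    exact_mod_cast Nat.lt_succ_iff.1 this

theorem bwd_degree {f : ℂ[X]} {n : ℕ} (hf : f.degree < (n + 1 : ℕ)) : (bwd f).degree < n := by
  by_cases h0 : f = 0
  · simp [h0, bwd, bot_lt_iff_ne_bot]
  · have h1 : (bwd f).degree < f.degree := by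
      have := degree_comp_sub_lt h0 (-1)
      rw [← degree_neg, neg_sub] at this
      simpa [bwd, sub_eq_add_neg] using this
    rw [degree_eq_natDegree h0] at h1 hf
    refine lt_of_lt_of_le h1 ?_
    have : f.natDegree < n + 1 := by exact_mod_cast hf
    exact_mod_cast Nat.lt_succ_iff.1 this

theorem lad_degree (α p q r : ℂ) {f : ℂ[X]} {n : ℕ} (hf : f.degree < (n + 1 : ℕ)) :
    (lad α p q r f).degree < (n + 2 : ℕ) := by
  -- The two terms of degree two above f combine into X² ∇f, so the degree rises by at most one.
  have e : lad α p q r f = X ^ 2 * bwd f + C (α + q + 2) * X * f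
      - C (α + q + 2) * X * bwd f - C (α - p + 1 - r) * X * f - C (r * (α - p + 1)) * f := by
    rw [lad, bwd]; simp only [C_add, C_sub, C_mul]; ring
  have hb : (bwd f).natDegree ≤ n - 1 ∧ (n = 0 → bwd f = 0) := by
    have := bwd_degree hf
    constructor
    · by_cases h0 : bwd f = 0
      · simp [h0]
      · rw [degree_eq_natDegree h0] at this
        have : (bwd f).natDegree < n := by exact_mod_cast this
        omega
    · rintro rfl
      simpa using this
  have hf' : f.natDegree ≤ n := by
    by_cases h0 : f = 0
    · simp [h0]
    · rw [degree_eq_natDegree h0] at hf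
      exact Nat.lt_succ_iff.1 (by exact_mod_cast hf)
  have key : ∀ g : ℂ[X], g.natDegree ≤ n + 1 → g.degree < (n + 2 : ℕ) := fun g hg =>
    lt_of_le_of_lt degree_le_natDegree (by exact_mod_cast Nat.lt_succ_of_le hg)
  have hX2 : (X ^ 2 * bwd f).natDegree ≤ n + 1 := by
    rcases Nat.eq_zero_or_pos n with h | h
    · rw [hb.2 h]; simp
    · refine natDegree_mul_le.trans ?_
      have := natDegree_X_pow_le (R := ℂ) 2
      omega
  have hCX : ∀ (c : ℂ) (g : ℂ[X]), g.natDegree ≤ n → (C c * X * g).natDegree ≤ n + 1 := by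
    intro c g hg
    refine natDegree_mul_le.trans ?_
    have := natDegree_C_mul_le c (X : ℂ[X])
    rw [natDegree_X] at this
    omega
  have hsub : ∀ g h : ℂ[X], g.natDegree ≤ n + 1 → h.natDegree ≤ n + 1 →
      (g - h).natDegree ≤ n + 1 := fun g h hg hh =>
    (natDegree_sub_le g h).trans (max_le hg hh)
  have hadd : (X ^ 2 * bwd f + C (α + q + 2) * X * f).natDegree ≤ n + 1 :=
    (natDegree_add_le _ _).trans (max_le hX2 (hCX _ _ hf'))
  rw [e]
  refine key _ (hsub _ _ (hsub _ _ (hsub _ _ hadd (hCX _ _ (by omega))) (hCX _ _ hf')) ?_)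
  exact (natDegree_C_mul_le _ _).trans (by omega)

theorem ladF_degree (α : ℂ) (k : ℕ) : ∀ p q r : ℂ, (ladF α k p q r).degree < (k + 1 : ℕ) := by
  induction k with
  | zero => intro p q r; simp [ladF]
  | succ k ih => intro p q r; exact lad_degree _ _ _ _ (ih _ _ _)

/-- An eigenfunction of the difference operator vanishes where the recurrence reaches, if it
vanishes at `0`. -/
theorem eigen_eq_zero {α p q r lam : ℂ} {g : ℂ[X]} (hg : hahnOp α p q r g = C lam * g)
    (h0 : g.eval 0 = 0) (N : ℕ) (hr : ∀ t < N, (r + 1 + t : ℂ) ≠ 0)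
    (hp : ∀ t < N, (p - α + t : ℂ) ≠ 0) : ∀ t ≤ N, g.eval (t : ℂ) = 0 := by
  intro t
  induction t using Nat.strong_induction_on with
  | _ t ih =>
    intro ht
    rcases t with _ | t
    · simpa using h0
    · have h1 := congrArg (eval (t : ℂ)) hg
      rw [eval_hahnOp, eval_mul, eval_C, ih t (by omega) (by omega)] at h1
      -- At t = 0 the factor t removes the value at -1, so the recurrence starts from one initial
      -- value; for larger t the previous value is zero by induction.
      have h2 : (t : ℂ) * (t - (q + α + 2)) * (0 - g.eval (t - 1 : ℂ)) = 0 := by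
        rcases t with _ | t
        · simp
        · have := ih t (by omega) (by omega)
          push_cast
          rw [add_sub_cancel_right, this]; ring
      rw [h2, mul_zero, sub_zero, sub_zero] at h1
      have h3 := hr t (by omega)
      have h4 := hp t (by omega)
      have h5 : (t + (r + 1)) * (t + (p - α)) ≠ (0 : ℂ) := by
        refine mul_ne_zero ?_ ?_
        · rwa [add_comm]
        · rwa [add_comm]
      push_cast
      exact (mul_eq_zero.1 h1).resolve_left h5

/-! ### The hypergeometric polynomial as an eigenfunction -/

theorem poch_succ (a : ℂ) (i : ℕ) : poch a (i + 1) = poch a i * (a + i) :=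
  Finset.prod_range_succ _ _

theorem poch_neg (t : ℂ) (i : ℕ) : poch (-t) i = (-1) ^ i * fall i t := by
  induction i with
  | zero => simp [poch, fall]
  | succ i ih => rw [poch_succ, ih, fall_succ, pow_succ]; ring

theorem poch_ne_zero {a : ℂ} {i : ℕ} (h : ∀ j < i, a + j ≠ 0) : poch a i ≠ 0 :=
  Finset.prod_ne_zero_iff.2 fun j hj => h j (Finset.mem_range.1 hj)

theorem poch_neg_nat {k i : ℕ} (h : k < i) : poch (-k : ℂ) i = 0 :=
  Finset.prod_eq_zero (Finset.mem_range.2 h) (by simp)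

/-- The coefficients of the hypergeometric series with respect to the falling factorials. -/
def hahnCoeff (k : ℕ) (s A B : ℂ) (i : ℕ) : ℂ :=
  (-1) ^ i * poch (-k) i * poch (k + s - 1) i / (poch A i * poch B i * i.factorial)

/-- The hypergeometric series `₃F₂(-k, k + s - 1, -t; A, B | 1)` as a polynomial in `t`. -/
def hahnPoly (k : ℕ) (s A B : ℂ) : ℂ[X] :=
  ∑ i ∈ Finset.range (k + 1), C (hahnCoeff k s A B i) * fallPoly i

theorem eval_hahnPoly (k : ℕ) (s A B t : ℂ) :
    (hahnPoly k s A B).eval t = hyp3F2 (-k) (k + s - 1) (-t) A B 1 := by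
  rw [hyp3F2, tsum_eq_sum (s := Finset.range (k + 1)), hahnPoly, eval_finsetSum]
  · refine Finset.sum_congr rfl fun i _ => ?_
    rw [eval_mul, eval_C, eval_fallPoly, hahnCoeff, poch_neg t, one_pow]
    ring
  · intro i hi
    rw [poch_neg_nat (by simpa [Nat.lt_succ_iff] using hi)]
    simp

theorem eval_hahnPoly_zero (k : ℕ) (s A B : ℂ) : (hahnPoly k s A B).eval 0 = 1 := by
  rw [hahnPoly, eval_finsetSum, Finset.sum_eq_single 0]
  · simp [hahnCoeff, poch, fallPoly]
  · intro i _ hi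
    have : fall i (0 : ℂ) = 0 := by
      have := (fall_nat_eq_zero_iff i 0).2 (Nat.pos_of_ne_zero hi)
      simpa using this
    rw [eval_mul, eval_fallPoly, this, mul_zero]
  · simp

/-- The ratio of Pochhammer factors contributes (k - i)(k + s - 1 + i), which equals the difference
k(k+s-1) - i(i+s-1) of eigenvalues. -/
theorem hahnCoeff_succ {k : ℕ} {s A B : ℂ} {i : ℕ} (hA : ∀ j ≤ i, A + j ≠ 0)
    (hB : ∀ j ≤ i, B + j ≠ 0) : hahnCoeff k s A B (i + 1) * ((i + 1) * (A + i) * (B + i)) =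
      hahnCoeff k s A B i * (k * (k + s - 1) - i * (i + s - 1)) := by
  have h1 : poch A i ≠ 0 := poch_ne_zero fun j hj => hA j hj.le
  have h2 : poch B i ≠ 0 := poch_ne_zero fun j hj => hB j hj.le
  have h3 := hA i le_rfl
  have h4 := hB i le_rfl
  have h5 : (i.factorial : ℂ) ≠ 0 := by exact_mod_cast i.factorial_ne_zero
  have h6 : (i + 1 : ℂ) ≠ 0 := by exact_mod_cast i.succ_ne_zero
  rw [hahnCoeff, hahnCoeff, poch_succ, poch_succ, poch_succ, poch_succ, Nat.factorial_succ]
  push_cast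
  field_simp
  ring

theorem hahnOp_fallPoly_zero (α p q r : ℂ) : hahnOp α p q r (fallPoly 0) = 0 := by
  simp [fallPoly, hahnOp, fwd, bwd]

/-- On falling factorials the difference operator is bidiagonal, so an eigenfunction in this basis
is given by a two-term recurrence: the one of `hahnCoeff_succ` with s = 2p + 3. -/
theorem hahnOp_fallPoly_succ (α p q r : ℂ) (hp : p = q + r) (i : ℕ) :
    hahnOp α p q r (fallPoly (i + 1)) = C ((i + 1) * (i + 1 + 2 * p + 2)) * fallPoly (i + 1)
      + C ((i + 1) * (r + 1 + i) * (p - α + i)) * fallPoly i := by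
  subst hp
  refine Polynomial.funext fun t => ?_
  have h1 : fall (i + 1) (t + 1) = (t + 1) * fall i t := by
    rw [fall_succ', add_sub_cancel_right]
  have h2 : t * fall (i + 1) (t - 1) = fall i t * (t - i) * (t - (i + 1)) := by
    rw [← fall_succ', fall_succ, fall_succ]; push_cast; ring
  have h3 := fall_succ i t
  simp only [eval_hahnOp, eval_add, eval_mul, eval_C, eval_fallPoly]
  linear_combination ((t + (r + 1)) * (t + (q + r - α))) * (h1 - h3)
    + (t - (q + α + 2)) * h2 - (t * (t - (q + α + 2)) + (i + 1) * (i + 1 + 2 * (q + r) + 2)) * h3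

theorem hahnOp_add (α p q r : ℂ) (f g : ℂ[X]) :
    hahnOp α p q r (f + g) = hahnOp α p q r f + hahnOp α p q r g := by
  simp only [hahnOp, fwd, bwd, add_comp]; ring

theorem hahnOp_sum {ι : Type*} (α p q r : ℂ) (s : Finset ι) (f : ι → ℂ[X]) :
    hahnOp α p q r (∑ i ∈ s, f i) = ∑ i ∈ s, hahnOp α p q r (f i) := by
  classical
  induction s using Finset.induction_on with
  | empty => simp [hahnOp, fwd, bwd]
  | insert a s ha ih => rw [Finset.sum_insert ha, Finset.sum_insert ha, hahnOp_add, ih]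

theorem hahnOp_hahnPoly (α p q r : ℂ) (hp : p = q + r) (k : ℕ) (hA : ∀ j < k, r + 1 + j ≠ 0)
    (hB : ∀ j < k, p - α + j ≠ 0) :
    hahnOp α p q r (hahnPoly k (2 * p + 3) (r + 1) (p - α)) =
      C (k * (k + 2 * p + 2)) * hahnPoly k (2 * p + 3) (r + 1) (p - α) := by
  set c := hahnCoeff k (2 * p + 3) (r + 1) (p - α) with hc
  have h1 : ∀ i : ℕ, C (c i) * hahnOp α p q r (fallPoly i) =
      C (c i * (i * (i + 2 * p + 2))) * fallPoly i +
        (if i = 0 then 0 else C (c i * (i * (r + 1 + (i - 1 : ℕ)) * (p - α + (i - 1 : ℕ)))) *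
          fallPoly (i - 1)) := by
    rintro (_ | i)
    · simp [hahnOp_fallPoly_zero]
    · rw [hahnOp_fallPoly_succ α p q r hp, if_neg (Nat.succ_ne_zero i), Nat.add_sub_cancel]
      push_cast
      simp only [C_mul]
      ring
  rw [hahnPoly, hahnOp_sum, ← hc]
  simp only [hahnOp_C_mul, h1]
  -- Reindexing the off-diagonal terms matches coefficients i and i + 1 for i < k. The remaining top
  -- term i = k has the right eigenvalue on the diagonal.
  rw [Finset.sum_add_distrib, Finset.sum_range_succ' (fun i => if i = 0 then _ else _), if_pos rfl,
    add_zero, Finset.mul_sum, Finset.sum_range_succ, add_right_comm, ← Finset.sum_add_distrib,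
    Finset.sum_range_succ]
  congr 1
  · refine Finset.sum_congr rfl fun i hi => ?_
    rw [Finset.mem_range] at hi
    have h2 := hahnCoeff_succ (k := k) (s := 2 * p + 3) (A := r + 1) (B := p - α) (i := i)
      (fun j hj => hA j (by omega)) (fun j hj => hB j (by omega))
    rw [← hc] at h2
    rw [if_neg (Nat.succ_ne_zero i), Nat.add_sub_cancel]
    refine Polynomial.funext fun t => ?_
    simp only [eval_add, eval_mul, eval_C]
    push_cast
    linear_combination (fallPoly i).eval t * h2
  · refine Polynomial.funext fun t => ?_
    simp only [eval_mul, eval_C]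
    ring

/-! ### The action of `z₃₁` and `z₂₃` on highest vectors -/

theorem R_commutator_diag {w : U} {φ : (Fin 3 → ℂ) → ℂ} {μ : Fin 3 → ℂ} (h : R w = T φ μ)
    (i : Fin 3) : R (E i i * w - w * E i i) = T (fun k => μ i * φ k) μ := by
  rw [R_commutator h, sub_self, add_zero]
  congr 1
  ext k
  rw [add_zero]; ring

/-! ### Commutators with shifts whose weight separates the exponents of x₂ and x₃ -/

section

variable {w : U} {q : ℕ} {H : ℂ → ℂ} {μ : Fin 3 → ℂ}

theorem R_commutator_21 (h : R w = T (fun k => fall q (k 1) * H (k 2)) μ) (hq : μ 1 = -q) :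
    R (E 2 1 * w - w * E 2 1) = T (fun k => fall (q + 1) (k 1) * (H (k 2) - H (k 2 + 1)))
      (μ + (Pi.single 2 1 - Pi.single 1 1)) := by
  rw [R_commutator h]
  congr 1
  ext k
  have e1 : (k + (Pi.single 2 1 - Pi.single 1 1) : Fin 3 → ℂ) 1 = k 1 - 1 := by simp; ring
  have e2 : (k + (Pi.single 2 1 - Pi.single 1 1) : Fin 3 → ℂ) 2 = k 2 + 1 := by simp
  rw [e1, e2, hq]
  have h1 := fall_succ q (k 1)
  have h2 := fall_succ' q (k 1)
  linear_combination H (k 2 + 1) * h2 - H (k 2) * h1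

theorem R_commutator_20 (h : R w = T (fun k => fall q (k 1) * H (k 2)) μ) :
    R (E 2 0 * w - w * E 2 0) =
      T (fun k => fall q (k 1) * (H (k 2) * (k 0 + μ 0) - k 0 * H (k 2 + 1)))
      (μ + (Pi.single 2 1 - Pi.single 0 1)) := by
  rw [R_commutator h]
  congr 1
  ext k
  have e1 : (k + (Pi.single 2 1 - Pi.single 0 1) : Fin 3 → ℂ) 1 = k 1 := by simp
  have e2 : (k + (Pi.single 2 1 - Pi.single 0 1) : Fin 3 → ℂ) 2 = k 2 + 1 := by simp
  rw [e1, e2]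
  ring

theorem R_commutator_10 (h : R w = T (fun k => fall (q + 1) (k 1) * H (k 2)) μ) :
    R (E 1 0 * w - w * E 1 0) =
      T (fun k => fall q (k 1) * H (k 2) * ((k 1 - q) * (k 0 + μ 0) - k 0 * (k 1 + 1)))
      (μ + (Pi.single 1 1 - Pi.single 0 1)) := by
  rw [R_commutator h]
  congr 1
  ext k
  have e1 : (k + (Pi.single 1 1 - Pi.single 0 1) : Fin 3 → ℂ) 1 = k 1 + 1 := by simp
  have e2 : (k + (Pi.single 1 1 - Pi.single 0 1) : Fin 3 → ℂ) 2 = k 2 := by simp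
  rw [e1, e2, fall_succ, fall_succ', add_sub_cancel_right]
  ring

theorem R_commutator_02 (h : R w = T (fun k => fall q (k 1) * H (k 2)) μ) :
    R (E 0 2 * w - w * E 0 2) =
      T (fun k => fall q (k 1) * (H (k 2) * (k 2 + μ 2) - k 2 * H (k 2 - 1)))
      (μ + (Pi.single 0 1 - Pi.single 2 1)) := by
  rw [R_commutator h]
  congr 1
  ext k
  have e1 : (k + (Pi.single 0 1 - Pi.single 2 1) : Fin 3 → ℂ) 1 = k 1 := by simp
  have e2 : (k + (Pi.single 0 1 - Pi.single 2 1) : Fin 3 → ℂ) 2 = k 2 - 1 := by simp; ring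
  rw [e1, e2]
  ring

theorem R_commutator_12 (h : R w = T (fun k => fall (q + 1) (k 1) * H (k 2)) μ) :
    R (E 1 2 * w - w * E 1 2) =
      T (fun k => fall q (k 1) *
        ((k 1 - q) * H (k 2) * (k 2 + μ 2) - k 2 * (k 1 + 1) * H (k 2 - 1)))
      (μ + (Pi.single 1 1 - Pi.single 2 1)) := by
  rw [R_commutator h]
  congr 1
  ext k
  have e1 : (k + (Pi.single 1 1 - Pi.single 2 1) : Fin 3 → ℂ) 1 = k 1 + 1 := by simp
  have e2 : (k + (Pi.single 1 1 - Pi.single 2 1) : Fin 3 → ℂ) 2 = k 2 - 1 := by simp; ring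
  rw [e1, e2, fall_succ, fall_succ', add_sub_cancel_right]
  ring

end

theorem adU_z31_proj (α : ℂ) (w : U) : adU α z31 (proj α w) =
    proj α ((E 0 0 * (E 2 0 * w - w * E 2 0) - (E 2 0 * w - w * E 2 0) * E 0 0)
      - (E 1 1 * (E 2 0 * w - w * E 2 0) - (E 2 0 * w - w * E 2 0) * E 1 1)
      + (2 : ℂ) • (E 2 0 * w - w * E 2 0)
      + (E 1 0 * (E 2 1 * w - w * E 2 1) - (E 2 1 * w - w * E 2 1) * E 1 0)) := by
  have h2 : (2 : U) = algebraMap ℂ U 2 := (map_ofNat (algebraMap ℂ U) 2).symm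
  rw [z31, h2, map_add, map_mul, map_mul, map_add, map_sub, AlgHom.commutes, map_add, map_add,
    map_sub (proj α) (E 0 0 * _ - _), map_smul]
  simp only [LinearMap.add_apply, Module.End.mul_apply, LinearMap.sub_apply, adU_E_proj,
    Module.algebraMap_end_apply]

theorem adU_z23_proj (α : ℂ) (w : U) : adU α z23 (proj α w) =
    proj α ((E 0 0 * (E 1 2 * w - w * E 1 2) - (E 1 2 * w - w * E 1 2) * E 0 0)
      - (E 1 1 * (E 1 2 * w - w * E 1 2) - (E 1 2 * w - w * E 1 2) * E 1 1)
      + (2 : ℂ) • (E 1 2 * w - w * E 1 2)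
      - (E 1 0 * (E 0 2 * w - w * E 0 2) - (E 0 2 * w - w * E 0 2) * E 1 0)) := by
  have h2 : (2 : U) = algebraMap ℂ U 2 := (map_ofNat (algebraMap ℂ U) 2).symm
  rw [z23, h2, map_sub, map_mul, map_mul, map_add, map_sub, AlgHom.commutes,
    map_sub (proj α) (_ + _), map_add,
    map_sub (proj α) (E 0 0 * _ - _), map_smul]
  simp only [LinearMap.add_apply, Module.End.mul_apply, LinearMap.sub_apply, adU_E_proj,
    Module.algebraMap_end_apply]

theorem wt_add (μ ν : Wt) : wt (μ + ν) = wt μ + wt ν := by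
  ext i; simp [wt]

theorem wt_eps_sub (i j : Fin 3) :
    wt (eps i - eps j) = Pi.single i 1 - Pi.single j 1 := by
  ext l; simp [wt, eps, Pi.single_apply, apply_ite (Int.cast : ℤ → ℂ)]

theorem uFun_eq {ν : Wt} {q r : ℕ} (hq : (-ν 1).toNat = q) (hr : (-ν 2).toNat = r) (f : ℂ[X]) :
    uFun ν f = fun k : Fin 3 → ℂ => fall q (k 1) * (fall r (k 2) * f.eval (k 2 + ν 2)) := by
  ext k; rw [uFun, hq, hr, mul_assoc]

theorem shift_02 (ν : Wt) : (ν + (eps 0 - eps 2)) 0 = ν 0 + 1 ∧ (ν + (eps 0 - eps 2)) 1 = ν 1 ∧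
    (ν + (eps 0 - eps 2)) 2 = ν 2 - 1 := by
  refine ⟨by simp [eps], by simp [eps], by simp [eps]; ring⟩

theorem shift_21 (ν : Wt) : (ν + (eps 2 - eps 1)) 0 = ν 0 ∧ (ν + (eps 2 - eps 1)) 1 = ν 1 - 1 ∧
    (ν + (eps 2 - eps 1)) 2 = ν 2 + 1 := by
  refine ⟨by simp [eps], by simp [eps]; ring, by simp [eps]⟩

/-- One has [E₁₂, z₃₁] = -2 E₃₁E₁₂, so ad z₃₁ keeps highest vectors highest. In the computation the
dependence on the exponent b, beyond the falling factorial, cancels between the two summands of z₃₁.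
-/
theorem adU_z31_act (α : ℂ) {ν : Wt} (hν : ν 0 + ν 1 + ν 2 = 0) (h1 : ν 1 ≤ 0)
    (h2 : ν 2 ≤ 0) (f : ℂ[X]) :
    adU α z31 (act α f (uPlus α (ν + (eps 0 - eps 2)))) =
      act α (C (ν 0 + 1 : ℂ) * lad α (ν 0 + 1) (-ν 1) (-ν 2 + 1) f) (uPlus α ν) := by
  obtain ⟨q, hq⟩ : ∃ q : ℕ, ν 1 = -q := ⟨(-ν 1).toNat, by omega⟩
  obtain ⟨r, hr⟩ : ∃ r : ℕ, ν 2 = -r := ⟨(-ν 2).toNat, by omega⟩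
  obtain ⟨s0, s1, s2⟩ := shift_02 ν
  set μ := ν + (eps 0 - eps 2) with hμ
  have hR := R_act (ν := μ) (by omega) (by omega) (by omega) f
  rw [uFun_eq (q := q) (r := r + 1) (by omega) (by omega)] at hR
  rw [act_uPlus, act_uPlus, adU_z31_proj, proj_eq_iff]
  intro k hk
  obtain ⟨b, c, -, rfl⟩ := (mem_expo_iff _ _).1 hk
  set w := aeval (E 2 2) f * uLift μ
  have hμ1 : wt μ 1 = -q := by rw [wt, s1, hq]; push_cast; rfl
  have hμ0 : wt μ 0 = q + r + 1 := by
    rw [wt, s0, show ν 0 = q + r by omega]; push_cast; rfl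
  have R1 := R_commutator_20 (H := fun x => fall (r + 1) x * f.eval (x + μ 2)) hR
  have R2 := R_commutator_21 (H := fun x => fall (r + 1) x * f.eval (x + μ 2)) hR hμ1
  have R3 := R_commutator_10 (H := fun x => fall (r + 1) x * f.eval (x + μ 2) -
    fall (r + 1) (x + 1) * f.eval (x + 1 + μ 2)) R2
  -- E₃₂ followed by E₂₁ shifts the weight exactly as E₃₁ does, so the summands can be added as
  -- weighted shifts.
  have hsh : wt μ + (Pi.single 2 1 - Pi.single 1 1) + (Pi.single 1 1 - Pi.single 0 1) =
      wt μ + (Pi.single 2 1 - Pi.single 0 1) := by abel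
  have hsh' : wt ν = wt μ + (Pi.single 2 1 - Pi.single 0 1) := by
    rw [hμ, wt_add, wt_eps_sub]; abel
  rw [hsh] at R3
  rw [R_act hν (by omega) (by omega), map_add, map_add, map_sub, map_smul, R_commutator_diag R1,
    R_commutator_diag R1, R1, R3, T_sub, T_smul, T_add, T_add, T_mono, T_mono, hsh']
  congr 1
  rw [uFun_eq (q := q) (r := r) (by omega) (by omega)]
  have e1 : ((c : ℂ) + μ 2) = c - r - 1 := by rw [s2, hr]; push_cast; ring
  have e2 : ((c : ℂ) + 1 + μ 2) = c - r := by rw [s2, hr]; push_cast; ring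
  have e3 : (c : ℂ) + -(r : ℂ) = c - r := by ring
  have e5 : (ν 2 : ℂ) = -r := by rw [hr]; push_cast; rfl
  have e6 : (ν 1 : ℂ) = -q := by rw [hq]; push_cast; rfl
  have e4 : (ν 0 : ℂ) = q + r := by rw [show ν 0 = q + r by omega]; push_cast; rfl
  have f1 : fall (r + 1) (c : ℂ) = fall r c * (c - r) := fall_succ r c
  have f2 : fall (r + 1) (c + 1 : ℂ) = (c + 1) * fall r c := by
    rw [fall_succ', add_sub_cancel_right]
  simp only [Pi.add_apply, Pi.sub_apply, Pi.smul_apply, smul_eq_mul, pt_zero, pt_one, pt_two,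
    hμ0, hμ1, e1, e2, e3, e4, e5, e6, f1, f2, eval_mul, eval_C, eval_lad]
  simp
  ring

/-- Here [E₁₂, z₂₃] = -2 E₂₃E₁₂. The compositions with X - ν₃ use the variable t - ν₃, in which this
is the operator of `adU_z31_act` with the roles of ν₁ and -ν₂ exchanged and -ν₃ replaced by ν₃. -/
theorem adU_z23_act (α : ℂ) {ν : Wt} (hν : ν 0 + ν 1 + ν 2 = 0) (h0 : 0 ≤ ν 0)
    (h2 : 0 ≤ ν 2) (f : ℂ[X]) :
    adU α z23 (act α (f.comp (X - C (ν 2 + 1 : ℂ))) (uPlus α (ν + (eps 2 - eps 1)))) =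
      act α ((C (ν 1 - 1 : ℂ) * lad α (-ν 1 + 1) (ν 0) (ν 2 + 1) f).comp (X - C (ν 2 : ℂ)))
        (uPlus α ν) := by
  obtain ⟨p, hp⟩ : ∃ p : ℕ, ν 0 = p := ⟨(ν 0).toNat, by omega⟩
  obtain ⟨s, hs⟩ : ∃ s : ℕ, ν 2 = s := ⟨(ν 2).toNat, by omega⟩
  obtain ⟨s0, s1, s2⟩ := shift_21 ν
  set μ := ν + (eps 2 - eps 1) with hμ
  have hR := R_act (ν := μ) (by omega) (by omega) (by omega) (f.comp (X - C (ν 2 + 1 : ℂ)))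
  rw [uFun_eq (q := p + s + 1) (r := 0) (by omega) (by omega)] at hR
  simp only [fall_zero, one_mul] at hR
  rw [act_uPlus, act_uPlus, adU_z23_proj, proj_eq_iff]
  intro k hk
  obtain ⟨b, c, -, rfl⟩ := (mem_expo_iff _ _).1 hk
  set g := f.comp (X - C (ν 2 + 1 : ℂ)) with hg
  set w := aeval (E 2 2) g * uLift μ
  have hμ1 : wt μ 1 = -(p + s + 1) := by
    rw [wt, s1, show ν 1 = -(p + s) by omega]; push_cast; ring
  have hμ0 : wt μ 0 = p := by rw [wt, s0, hp]; push_cast; rfl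
  have hμ2 : wt μ 2 = s + 1 := by rw [wt, s2, hs]; push_cast; rfl
  have R1 := R_commutator_12 (H := fun x => g.eval (x + μ 2)) hR
  have R2 := R_commutator_02 (H := fun x => g.eval (x + μ 2)) hR
  have R3 := R_commutator_10 (H := fun x => g.eval (x + μ 2) * (x + wt μ 2) -
    x * g.eval (x - 1 + μ 2)) R2
  have hsh : wt μ + (Pi.single 0 1 - Pi.single 2 1) + (Pi.single 1 1 - Pi.single 0 1) =
      wt μ + (Pi.single 1 1 - Pi.single 2 1) := by abel
  have hsh' : wt ν = wt μ + (Pi.single 1 1 - Pi.single 2 1) := by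
    rw [hμ, wt_add, wt_eps_sub]; abel
  rw [hsh] at R3
  rw [R_act hν (by omega) (by omega), map_sub, map_add, map_sub, map_smul, R_commutator_diag R1,
    R_commutator_diag R1, R1, R3, T_sub, T_smul, T_add, T_sub, T_mono, T_mono, hsh']
  congr 1
  rw [uFun_eq (q := p + s) (r := 0) (by omega) (by omega)]
  have e1 : g.eval ((c : ℂ) + μ 2) = f.eval (c : ℂ) := by
    rw [hg, s2]; simp
  have e2 : g.eval ((c : ℂ) - 1 + μ 2) = f.eval (c - 1 : ℂ) := by
    rw [hg, s2, eval_comp]; congr 1; simp; ring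
  have e4 : (ν 1 : ℂ) = -(p + s) := by rw [show ν 1 = -(p + s) by omega]; push_cast; rfl
  simp only [Pi.add_apply, Pi.sub_apply, Pi.smul_apply, smul_eq_mul, pt_zero, pt_one, pt_two,
    hμ0, hμ1, hμ2, e1, e2, e4, eval_mul, eval_C, eval_lad, hp, hs, fall_zero, eval_comp, eval_sub,
    eval_X]
  simp
  ring

/-- E₁₃ will be the adjoint of z₃₁ on highest vectors. That it lowers the degree of the polynomial
is what drives orthogonality. -/
theorem adU_E02_act (α : ℂ) {ν : Wt} (hν : ν 0 + ν 1 + ν 2 = 0) (h1 : ν 1 ≤ 0)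
    (h2 : ν 2 ≤ 0) (f : ℂ[X]) : adU α (E 0 2) (act α f (uPlus α ν)) =
      act α (fwd f) (uPlus α (ν + (eps 0 - eps 2))) := by
  obtain ⟨q, hq⟩ : ∃ q : ℕ, ν 1 = -q := ⟨(-ν 1).toNat, by omega⟩
  obtain ⟨r, hr⟩ : ∃ r : ℕ, ν 2 = -r := ⟨(-ν 2).toNat, by omega⟩
  obtain ⟨s0, s1, s2⟩ := shift_02 ν
  have hR := R_act (ν := ν) (by omega) (by omega) (by omega) f
  rw [uFun_eq (q := q) (r := r) (by omega) (by omega)] at hR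
  have R1 := R_commutator_02 (H := fun x => fall r x * f.eval (x + ν 2)) hR
  rw [act_uPlus, act_uPlus, adU_E_proj]
  refine (proj_eq_iff _ _ _).2 fun k _ => ?_
  rw [R1, R_act (by omega) (by omega) (by omega), T_mono, T_mono, wt_add, wt_eps_sub,
    uFun_eq (q := q) (r := r + 1) (by omega) (by omega)]
  congr 1
  have f1 : fall (r + 1) (k 2) = fall r (k 2) * (k 2 - r) := fall_succ r _
  have f2 : fall (r + 1) (k 2) = k 2 * fall r (k 2 - 1) := fall_succ' r _
  have e1 : k 2 + ((ν 2 - 1 : ℤ) : ℂ) + 1 = k 2 + ν 2 := by push_cast; ring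
  have e2 : k 2 + ((ν 2 - 1 : ℤ) : ℂ) = k 2 - 1 + ν 2 := by push_cast; ring
  have e3 : wt ν 2 = -r := by rw [wt, hr]; push_cast; rfl
  beta_reduce
  rw [s2, eval_fwd, e1, e2, e3]
  linear_combination (-(fall q (k 1)) * f.eval (k 2 + ν 2)) * f1
    + fall q (k 1) * f.eval (k 2 - 1 + ν 2) * f2

theorem adU_E21_act (α : ℂ) {ν : Wt} (hν : ν 0 + ν 1 + ν 2 = 0) (h0 : 0 ≤ ν 0)
    (h2 : 0 ≤ ν 2) (f : ℂ[X]) : adU α (E 2 1) (act α f (uPlus α ν)) =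
      act α (-bwd f) (uPlus α (ν + (eps 2 - eps 1))) := by
  obtain ⟨q, hq⟩ : ∃ q : ℕ, ν 1 = -q := ⟨(-ν 1).toNat, by omega⟩
  obtain ⟨s0, s1, s2⟩ := shift_21 ν
  have hR := R_act (ν := ν) (by omega) (by omega) (by omega) f
  rw [uFun_eq (q := q) (r := 0) (by omega) (by omega)] at hR
  have R1 := R_commutator_21 (H := fun x => fall 0 x * f.eval (x + ν 2)) hR
    (by rw [wt, hq]; push_cast; rfl)
  rw [act_uPlus, act_uPlus, adU_E_proj]
  refine (proj_eq_iff _ _ _).2 fun k _ => ?_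
  rw [R1, R_act (by omega) (by omega) (by omega), T_mono, T_mono, wt_add, wt_eps_sub,
    uFun_eq (q := q + 1) (r := 0) (by omega) (by omega)]
  congr 1
  have e1 : k 2 + ((ν 2 + 1 : ℤ) : ℂ) = k 2 + 1 + ν 2 := by push_cast; ring
  have e2 : k 2 + 1 + ν 2 - 1 = k 2 + ν 2 := by ring
  beta_reduce
  rw [s2, eval_neg, eval_bwd, e1, e2, fall_zero, fall_zero]
  ring

/-- The vectors `(ad z₃₁)^k u^+_{ν + k(ε₁ - ε₃)}`. -/
theorem z31_pow (α : ℂ) (k : ℕ) : ∀ {ν : Wt}, ν 0 + ν 1 + ν 2 = 0 → ν 1 ≤ 0 → ν 2 ≤ 0 →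
    ∃ c : ℂ, c ≠ 0 ∧ IsF31 α ν k (C c * ladF α k (ν 0) (-ν 1) (-ν 2)) := by
  induction k with
  | zero =>
    intro ν _ _ _
    exact ⟨1, one_ne_zero, by simp [IsF31, ladF, act_one]⟩
  | succ k ih =>
    intro ν hν h1 h2
    obtain ⟨s0, s1, s2⟩ := shift_02 ν
    obtain ⟨c, hc, h⟩ := ih (ν := ν + (eps 0 - eps 2)) (by omega) (by omega) (by omega)
    refine ⟨(ν 0 + 1) * c, mul_ne_zero ?_ hc, ?_⟩
    · have : (ν 0 + 1 : ℤ) ≠ 0 := by omega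
      exact_mod_cast this
    · unfold IsF31 at h ⊢
      -- The outermost z₃₁ is split off and the induction hypothesis is used at ν + ε₁ - ε₃, which
      -- is the parameter shift in the recursion of `ladF`.
      rw [pow_succ', Module.End.mul_apply, succ_nsmul', ← add_assoc, ← h, adU_z31_act α hν h1 h2,
        ladF, lad_C_mul, C_mul, s0, s1, s2]
      push_cast
      rw [mul_assoc, show -((ν 2 : ℂ) - 1) = -ν 2 + 1 by ring]

theorem z23_pow (α : ℂ) (k : ℕ) : ∀ {ν : Wt}, ν 0 + ν 1 + ν 2 = 0 → 0 ≤ ν 0 → 0 ≤ ν 2 →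
    ∃ c : ℂ, c ≠ 0 ∧
      IsF23 α ν k ((C c * ladF α k (-ν 1) (ν 0) (ν 2)).comp (X - C (ν 2 : ℂ))) := by
  induction k with
  | zero =>
    intro ν _ _ _
    exact ⟨1, one_ne_zero, by simp [IsF23, ladF, act_one]⟩
  | succ k ih =>
    intro ν hν h1 h2
    obtain ⟨s0, s1, s2⟩ := shift_21 ν
    obtain ⟨c, hc, h⟩ := ih (ν := ν + (eps 2 - eps 1)) (by omega) (by omega) (by omega)
    refine ⟨(ν 1 - 1) * c, mul_ne_zero ?_ hc, ?_⟩
    · have : (ν 1 - 1 : ℤ) ≠ 0 := by omega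
      exact_mod_cast this
    · unfold IsF23 at h ⊢
      rw [s0, s1, s2] at h
      push_cast at h
      rw [pow_succ', Module.End.mul_apply, succ_nsmul', ← add_assoc, ← h, adU_z23_act α hν h1 h2,
        ladF, lad_C_mul, C_mul]
      rw [mul_assoc, show -((ν 1 : ℂ) - 1) = -ν 1 + 1 by ring]

/-! ### Decomposition of the adjoint action on the enveloping algebra -/

theorem mem_Z_of_commute {z : U} (h : ∀ i j, E i j * z - z * E i j = 0) : z ∈ Z := by
  rw [Subalgebra.mem_center_iff]
  intro u
  induction u using U_induction with
  | hc c => exact Algebra.commutes c z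
  | hE i j => exact sub_eq_zero.1 (h i j)
  | hadd u v hu hv => rw [add_mul, mul_add, hu, hv]
  | hmul u v hu hv => rw [mul_assoc, hv, ← mul_assoc, hu, mul_assoc]

/-- A finite family whose span is stable under the adjoint action, `E i j` acting by real matrices
such that the matrix of `E j i` is the transpose of that of `E i j`. -/
def UnitaryFamily {ι : Type} [Fintype ι] (v : ι → U) (M : Fin 3 → Fin 3 → ι → ι → ℝ) : Prop :=
  (∀ i j a, E i j * v a - v a * E i j = ∑ b, (M i j b a : ℂ) • v b) ∧
    ∀ i j a b, M i j a b = M j i b a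

/-- The matrix units form such a family, and direct sums and tensor products serve for sums and
products of elements. Linear independence of the family is not asked for; a map from ℂ^ι onto its
span is enough. -/
theorem exists_unitaryFamily (u : U) : ∃ (ι : Type) (_ : Fintype ι) (v : ι → U)
    (M : Fin 3 → Fin 3 → ι → ι → ℝ), UnitaryFamily v M ∧ u ∈ Submodule.span ℂ (Set.range v) := by
  classical
  induction u using U_induction with
  | hc c =>
    refine ⟨Unit, inferInstance, fun _ => 1, 0, ⟨by simp, by simp⟩, ?_⟩
    rw [Algebra.algebraMap_eq_smul_one]
    exact Submodule.smul_mem _ _ (Submodule.subset_span ⟨(), rfl⟩)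
  | hE i j =>
    refine ⟨Fin 3 × Fin 3, inferInstance, fun a => E a.1 a.2,
      fun i j b a => (if j = a.1 ∧ i = b.1 ∧ a.2 = b.2 then 1 else 0) -
        (if a.2 = i ∧ a.1 = b.1 ∧ j = b.2 then 1 else 0), ⟨?_, ?_⟩,
      Submodule.subset_span ⟨(i, j), rfl⟩⟩
    · rintro i j ⟨k, l⟩
      rw [E_comm, Fintype.sum_prod_type]
      simp only [Complex.ofReal_sub, apply_ite Complex.ofReal, Complex.ofReal_one,
        Complex.ofReal_zero, sub_smul, ite_smul, one_smul, zero_smul, Finset.sum_sub_distrib,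
        ite_and]
      congr 1
      · split_ifs <;> simp
      · split_ifs <;> simp
    · rintro i j ⟨k, l⟩ ⟨a, b⟩
      simp only
      congr 1
      · refine if_congr ?_ rfl rfl
        constructor <;> rintro ⟨h1, h2, h3⟩ <;> exact ⟨h2, h1, h3.symm⟩
      · refine if_congr ?_ rfl rfl
        constructor <;> rintro ⟨h1, h2, h3⟩ <;> exact ⟨h3.symm, h2.symm, h1.symm⟩
  | hadd u u' hu hu' =>
    obtain ⟨ι, _, v, M, ⟨h1, h2⟩, hu⟩ := hu
    obtain ⟨ι', _, v', M', ⟨h1', h2'⟩, hu'⟩ := hu'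
    refine ⟨ι ⊕ ι', inferInstance, Sum.elim v v', fun i j => Sum.elim
      (fun b => Sum.elim (fun a => M i j b a) fun _ => 0)
      (fun b => Sum.elim (fun _ => 0) fun a => M' i j b a), ⟨?_, ?_⟩, ?_⟩
    · rintro i j (a | a)
      · simp [h1]
      · simp [h1']
    · rintro i j (a | a) (b | b)
      · exact h2 i j a b
      · rfl
      · rfl
      · exact h2' i j a b
    · rw [Set.Sum.elim_range, Submodule.span_union]
      exact Submodule.add_mem_sup hu hu'
  | hmul u u' hu hu' =>
    obtain ⟨ι, _, v, M, ⟨h1, h2⟩, hu⟩ := hu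
    obtain ⟨ι', _, v', M', ⟨h1', h2'⟩, hu'⟩ := hu'
    refine ⟨ι × ι', inferInstance, fun a => v a.1 * v' a.2,
      fun i j b a => M i j b.1 a.1 * (if b.2 = a.2 then 1 else 0) +
        (if b.1 = a.1 then 1 else 0) * M' i j b.2 a.2, ⟨?_, ?_⟩, ?_⟩
    · rintro i j ⟨a, a'⟩
      have e : E i j * (v a * v' a') - v a * v' a' * E i j =
          (E i j * v a - v a * E i j) * v' a' + v a * (E i j * v' a' - v' a' * E i j) := by
        noncomm_ring
      rw [e, h1, h1', Fintype.sum_prod_type, Finset.sum_mul, Finset.mul_sum]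
      simp [add_smul, Finset.sum_add_distrib, apply_ite Complex.ofReal, ite_smul]
    · rintro i j ⟨a, a'⟩ ⟨b, b'⟩
      simp only [h2 i j a b, h2' i j a' b', eq_comm]
    · have := Submodule.mul_mem_mul hu hu'
      rw [Submodule.span_mul_span] at this
      refine Submodule.span_mono ?_ this
      rintro _ ⟨_, ⟨a, rfl⟩, _, ⟨b, rfl⟩, rfl⟩
      exact ⟨(a, b), rfl⟩

theorem inner_toEuclideanLin {ι : Type*} [Fintype ι] [DecidableEq ι] {A B : Matrix ι ι ℂ}
    (h : A.conjTranspose = B) (x y : EuclideanSpace ℂ ι) :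
    inner ℂ (Matrix.toEuclideanLin A x) y = inner ℂ x (Matrix.toEuclideanLin B y) := by
  rw [← h, Matrix.toEuclideanLin_conjTranspose_eq_adjoint, LinearMap.adjoint_inner_right]

/-- Complete reducibility of the adjoint action: an element of an invariant subspace `K` is the sum
of a central element in `K` and of commutators. -/
theorem exists_central_part (K : Submodule ℂ U)
    (hK : ∀ i j, ∀ x ∈ K, E i j * x - x * E i j ∈ K) {u : U} (hu : u ∈ K) :
    ∃ z ∈ K, z ∈ Z ∧ u - z ∈ comm := by
  classical
  obtain ⟨ι, _, v, M, ⟨h1, h2⟩, hv⟩ := exists_unitaryFamily u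
  let A : Fin 3 → Fin 3 → Matrix ι ι ℂ := fun i j => Matrix.of fun b a => (M i j b a : ℂ)
  let e : Fin 3 → Fin 3 → EuclideanSpace ℂ ι →ₗ[ℂ] EuclideanSpace ℂ ι :=
    fun i j => Matrix.toEuclideanLin (A i j)
  let Φ : EuclideanSpace ℂ ι →ₗ[ℂ] U :=
    (Fintype.linearCombination ℂ v).comp (WithLp.linearEquiv 2 ℂ (ι → ℂ)).toLinearMap
  have hΦ : ∀ x, Φ x = ∑ a, x a • v a := fun x => rfl
  have he : ∀ i j x, Φ (e i j x) = E i j * Φ x - Φ x * E i j := by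
    intro i j x
    rw [hΦ, hΦ, Finset.mul_sum, Finset.sum_mul, ← Finset.sum_sub_distrib]
    have : ∀ a, E i j * (x a • v a) - x a • v a * E i j = ∑ b, (A i j b a * x a) • v b := by
      intro a
      rw [mul_smul_comm, smul_mul_assoc, ← smul_sub, h1, Finset.smul_sum]
      refine Finset.sum_congr rfl fun b _ => ?_
      rw [smul_smul, mul_comm]; rfl
    simp only [this]
    rw [Finset.sum_comm]
    refine Finset.sum_congr rfl fun b _ => ?_
    rw [← Finset.sum_smul]
    rfl
  have hadj : ∀ i j x y, inner ℂ (e i j x) y = inner ℂ x (e j i y) := by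
    intro i j x y
    refine inner_toEuclideanLin ?_ x y
    ext a b
    simp [A, h2 j i a b]
  let N := K.comap Φ
  let W : Submodule ℂ (EuclideanSpace ℂ ι) := ⨆ i, ⨆ j, N.map (e i j)
  have heN : ∀ i j, ∀ x ∈ N, e i j x ∈ N := by
    intro i j x hx
    change Φ (e i j x) ∈ K
    rw [he]
    exact hK i j _ hx
  have hWN : W ≤ N := by
    refine iSup_le fun i => iSup_le fun j => ?_
    rintro _ ⟨x, hx, rfl⟩
    exact heN i j x hx
  have hWc : W ≤ comm.comap Φ := by
    refine iSup_le fun i => iSup_le fun j => ?_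
    rintro _ ⟨x, hx, rfl⟩
    change Φ (e i j x) ∈ comm
    rw [he]
    exact Submodule.subset_span ⟨_, _, rfl⟩
  obtain ⟨x, hx⟩ : ∃ x, Φ x = u := by
    rw [← Fintype.range_linearCombination] at hv
    obtain ⟨c, hc⟩ := hv
    exact ⟨WithLp.toLp 2 c, hc⟩
  -- W is the span of all images e_ij N. Its orthogonal part y gives the central element, and the
  -- part w in W gives commutators.
  obtain ⟨w, hw, y, hy, hxy⟩ := Submodule.exists_add_mem_mem_orthogonal (K := W) x
  have hyN : y ∈ N := by
    have hxN : x ∈ N := by change Φ x ∈ K; rwa [hx]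
    have : y = x - w := by rw [hxy]; abel
    rw [this]
    exact sub_mem hxN (hWN hw)
  refine ⟨Φ y, hyN, mem_Z_of_commute fun i j => ?_, ?_⟩
  · rw [← he]
    -- Unitary trick: ‖e_ij y‖² = ⟨y, e_ji e_ij y⟩ = 0, because e_ji e_ij y lies in W.
    have h0 : inner ℂ (e i j y) (e i j y) = 0 := by
      rw [hadj]
      rw [Submodule.mem_orthogonal'] at hy
      refine hy _ ?_
      exact Submodule.mem_iSup_of_mem j (Submodule.mem_iSup_of_mem i
        (Submodule.mem_map_of_mem (heN i j y hyN)))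
    rw [inner_self_eq_zero.1 h0, map_zero]
  · have : u - Φ y = Φ w := by rw [← hx, hxy, map_add]; abel
    rw [this]
    exact hWc hw

theorem exists_central (u : U) : ∃ z ∈ Z, u - z ∈ comm := by
  obtain ⟨z, -, h⟩ := exists_central_part ⊤ (fun _ _ _ _ => trivial) (u := u) trivial
  exact ⟨z, h⟩

/-- Finding the central part inside the ideal J^α itself is what makes the form vanish on J^α. -/
theorem exists_central_J {α : ℂ} {u : U} (hu : u ∈ J α) : ∃ z ∈ J α, z ∈ Z ∧ u - z ∈ comm := by
  refine exists_central_part ((J α).restrictScalars ℂ) (fun i j x hx => ?_) hu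
  exact sub_mem (Ideal.mul_mem_left _ _ hx) (Ideal.mul_mem_right _ _ hx)

/-! ### Central elements which are sums of commutators -/

theorem pt_zero_zero (α : ℂ) : pt α 0 0 = ![α, 0, 0] := by simp [pt]

theorem hc_eq_cf (α : ℂ) (u : U) : hc α u = cf α 0 u 0 0 := by
  rw [hc, rep_coe, cf, pt_zero_zero]
  have : wt 0 = 0 := by ext i; simp [wt]
  rw [this, add_zero]; rfl

theorem hc_poly (u : U) : ∃ p : ℂ[X], ∀ α, hc α u = p.eval α := by
  obtain ⟨φ, hφ, h⟩ := exists_coeff u 0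
  obtain ⟨p, hp⟩ := PolyFun_line hφ 0 ![1, 0, 0]
  refine ⟨p, fun α => ?_⟩
  rw [hc_eq_cf, ← hp, cf]
  change monBasis.coord (pt α 0 0 + fun i => ((0 : Wt) i : ℂ)) _ = _
  rw [h, pt_zero_zero]
  congr 1
  simp

/-- A central element is a highest vector of weight 0. Commuting with E₁₂ and E₁₃, which carry every
monomial of S^α to x₁^α with nonzero factors, makes its coefficient constant. -/
theorem R_central {α : ℂ} {z : U} (hz : z ∈ Z) {k : Fin 3 → ℂ} (hk : k ∈ expo α) :
    R z (mono k) = hc α z • mono k := by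
  have hcomm : ∀ u, u * z - z * u = 0 := fun u =>
    sub_eq_zero.2 (Subalgebra.mem_center_iff.1 hz u)
  have hw : proj α z ∈ hwSpace α 0 := by
    refine ⟨fun i => ?_, ?_⟩
    · rw [adU_E_proj, hcomm]; simp
    · rw [adU_E_proj, hcomm, map_zero]
  have hwt : wt 0 = 0 := by ext i; simp [wt]
  have hR : ∀ {b c : ℕ}, Valid α b c →
      R z (mono (pt α b c)) = cf α 0 z b c • mono (pt α b c) := by
    intro b c h
    simpa [hwt] using R_pt hw h
  have hb : ∀ b c : ℕ, Valid α b c → cf α 0 z b c = cf α 0 z (0 : ℕ) c := by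
    intro b c
    induction b with
    | zero => intro _; rfl
    | succ b ih =>
      intro h
      rw [← ih (h.mono (Nat.le_succ b))]
      have h1 := cf_succ hw h
      have h2 : (b + 1 : ℂ) ≠ 0 := by exact_mod_cast b.succ_ne_zero
      rw [Pi.zero_apply, Int.cast_zero, add_zero, mul_comm] at h1
      exact mul_left_cancel₀ h2 h1
  have hc' : ∀ c : ℕ, Valid α 0 c → cf α 0 z (0 : ℕ) c = cf α 0 z (0 : ℕ) (0 : ℕ) := by
    intro c
    induction c with
    | zero => intro _; rfl
    | succ c ih =>
      intro h
      have hv : Valid α 0 c := fun n hn => by have := h n hn; omega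
      rw [← ih hv]
      have h4 : pt α (0 : ℕ) (c + 1 : ℕ) + (Pi.single 0 1 - Pi.single 2 1) = pt α (0 : ℕ) c := by
        ext i; fin_cases i <;> simp [pt]
        ring
      have h1 := congrArg (fun u => R u (mono (pt α (0 : ℕ) (c + 1 : ℕ)))) (hcomm (E 0 2))
      simp only [map_sub, map_mul, LinearMap.sub_apply, Module.End.mul_apply, map_zero,
        LinearMap.zero_apply] at h1
      rw [hR h, map_smul, R_E_mono, h4, map_smul, hR hv, smul_smul, smul_smul, ← sub_smul,
        smul_mono_eq_zero, pt_two] at h1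
      have h2 : ((c + 1 : ℕ) : ℂ) ≠ 0 := by exact_mod_cast c.succ_ne_zero
      apply mul_left_cancel₀ h2
      linear_combination h1
  obtain ⟨b, c, hv, rfl⟩ := (mem_expo_iff _ _).1 hk
  rw [hR hv, hb b c hv, hc' c (hv.mono (Nat.zero_le b)), hc_eq_cf]
  simp

theorem expo_nat_finite (n : ℕ) : (expo (n : ℂ)).Finite := by
  refine ((Set.finite_Iic n).prod (Set.finite_Iic n)).image
    (fun x : ℕ × ℕ => pt n x.1 x.2) |>.subset ?_
  intro k hk
  obtain ⟨b, c, hv, rfl⟩ := (mem_expo_iff _ _).1 hk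
  have := hv n rfl
  exact ⟨(b, c), ⟨by simp; omega, by simp; omega⟩, rfl⟩

/-- On the finite-dimensional S^n commutators have trace zero, while z acts as a scalar, so this
scalar times the positive dimension is zero. -/
theorem hc_nat_eq_zero {z : U} (hz : z ∈ Z) (hz' : z ∈ comm) (n : ℕ) : hc n z = 0 := by
  have : Module.Finite ℂ (S n) :=
    FiniteDimensional.span_of_finite ℂ ((expo_nat_finite n).image _)
  have hne : hwVec n ≠ 0 := fun h => monBasis.ne_zero _ (congrArg Subtype.val h)
  have : Nontrivial (S n) := ⟨⟨_, _, hne⟩⟩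
  have h1 : rep n z = hc n z • (1 : Module.End ℂ (S n)) := by
    have h2 : S n ≤ LinearMap.ker (R z - hc n z • 1) := by
      refine Submodule.span_le.2 ?_
      rintro _ ⟨k, hk, rfl⟩
      change (R z - hc n z • 1) (mono k) = 0
      rw [LinearMap.sub_apply, R_central hz hk]
      simp
    ext x
    rw [rep_coe]
    have := h2 x.2
    rw [LinearMap.mem_ker, LinearMap.sub_apply, sub_eq_zero] at this
    rw [this]; rfl
  have h3 : comm ≤ LinearMap.ker ((LinearMap.trace ℂ (S n)).comp (rep n).toLinearMap) := by
    refine Submodule.span_le.2 ?_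
    rintro _ ⟨a, b, rfl⟩
    change LinearMap.trace ℂ (S n) (rep n (a * b - b * a)) = 0
    rw [map_sub, map_sub, map_mul (rep n), map_mul (rep n), LinearMap.trace_mul_comm, sub_self]
  have h4 : LinearMap.trace ℂ (S n) (rep n z) = 0 := h3 hz'
  rw [h1, map_smul, LinearMap.trace_one, smul_eq_mul] at h4
  refine (mul_eq_zero.1 h4).resolve_right ?_
  exact_mod_cast (Module.finrank_pos (R := ℂ) (M := S n)).ne'

/-- The scalar is polynomial in α and vanishes at all natural numbers. This weaker substitute for Z
∩ [U,U] = 0 suffices for the form. -/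
theorem hc_eq_zero {z : U} (hz : z ∈ Z) (hz' : z ∈ comm) (α : ℂ) : hc α z = 0 := by
  obtain ⟨p, hp⟩ := hc_poly z
  have : p = 0 := poly_ext_nat 0 fun m _ => by rw [← hp, hc_nat_eq_zero hz hz', eval_zero]
  rw [hp, this, eval_zero]

/-! ### The trace functional -/

theorem hc_sub (α : ℂ) (u v : U) : hc α (u - v) = hc α u - hc α v := by
  rw [hc, map_sub, LinearMap.sub_apply, Submodule.coe_sub, map_sub]; rfl

theorem hc_add (α : ℂ) (u v : U) : hc α (u + v) = hc α u + hc α v := by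
  rw [hc, map_add, LinearMap.add_apply, Submodule.coe_add, map_add]; rfl

theorem hc_smul (α c : ℂ) (u : U) : hc α (c • u) = c * hc α u := by
  rw [hc, map_smul, LinearMap.smul_apply, Submodule.coe_smul, map_smul]; rfl

theorem hc_J {α : ℂ} {u : U} (hu : u ∈ J α) : hc α u = 0 := by
  rw [hc, RingHom.mem_ker.1 hu]; simp

/-- The trace `u ↦ φ(u^♯)(α, 0, 0)` on the enveloping algebra. -/
def tr (α : ℂ) (u : U) : ℂ := hc α (sharp u)

theorem sharp_spec (u : U) : sharp u ∈ Z ∧ u - sharp u ∈ comm := by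
  have h := exists_central u
  rw [sharp, dif_pos h]
  exact h.choose_spec

/-- Any central component, even modulo J^α, computes the trace: two candidates differ by a central
sum of commutators and a central element of J^α, and `hc` kills both. -/
theorem tr_eq {α : ℂ} {u w z : U} (hz : z ∈ Z) (hw : w ∈ J α) (h : u - w - z ∈ comm) :
    tr α u = hc α z := by
  obtain ⟨h1, h2⟩ := sharp_spec u
  obtain ⟨z', hz'J, hz'Z, hwz⟩ := exists_central_J hw
  have h3 : sharp u - z - z' ∈ comm := by
    have : sharp u - z - z' = (u - w - z) - (u - sharp u) + (w - z') := by abel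
    rw [this]
    exact add_mem (sub_mem h h2) hwz
  have h4 := hc_eq_zero (sub_mem (sub_mem h1 hz) hz'Z) h3 α
  rw [hc_sub, hc_sub, hc_J hz'J] at h4
  rw [tr]
  linear_combination h4

theorem tr_add (α : ℂ) (u v : U) : tr α (u + v) = tr α u + tr α v := by
  obtain ⟨h1, h2⟩ := sharp_spec u
  obtain ⟨h3, h4⟩ := sharp_spec v
  rw [tr_eq (add_mem h1 h3) (zero_mem (J α)) (by
    have := add_mem h2 h4
    convert this using 1; abel), hc_add]; rfl

theorem tr_smul (α c : ℂ) (u : U) : tr α (c • u) = c * tr α u := by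
  obtain ⟨h1, h2⟩ := sharp_spec u
  rw [tr_eq (Subalgebra.smul_mem _ h1 c) (zero_mem (J α)) (by
    have := Submodule.smul_mem _ c h2
    rwa [smul_sub, ← sub_zero (c • u)] at this), hc_smul]; rfl

theorem tr_congr {α : ℂ} {u v : U} (h : u - v ∈ J α) : tr α u = tr α v := by
  obtain ⟨h1, h2⟩ := sharp_spec v
  rw [tr_eq h1 h (by convert h2 using 1; abel)]; rfl

theorem tr_mul_comm (α : ℂ) (u v : U) : tr α (u * v) = tr α (v * u) := by
  obtain ⟨h1, h2⟩ := sharp_spec (v * u)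
  have h3 : u * v - v * u ∈ comm := Submodule.subset_span ⟨_, _, rfl⟩
  rw [tr_eq h1 (zero_mem (J α)) (by convert add_mem h3 h2 using 1; abel)]; rfl

/-! ### The Chevalley antiautomorphism preserves the kernels -/

theorem omega_E (i j : Fin 3) : omega (E i j) = E j i := by
  rw [omega, omegaOp, E, UniversalEnvelopingAlgebra.lift_ι_apply]
  simp [E]

theorem omega_add (u v : U) : omega (u + v) = omega u + omega v := by simp [omega]

theorem omega_sub (u v : U) : omega (u - v) = omega u - omega v := by simp [omega]

theorem omega_smul (c : ℂ) (u : U) : omega (c • u) = c • omega u := by simp [omega]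

theorem omega_mul (u v : U) : omega (u * v) = omega v * omega u := by simp [omega]

theorem omega_algebraMap (c : ℂ) : omega (algebraMap ℂ U c) = algebraMap ℂ U c := by
  rw [omega, AlgHom.commutes]; rfl

/-- The squared length of the monomial with exponent `(α - b - c, b, c)`. -/
def sqLen (α : ℂ) (b c : ℕ) : ℂ := b.factorial * c.factorial / fall (b + c) α

/-- The contravariant form on `S^α(V)`, for which monomials are orthogonal. -/
def contra (α : ℂ) : Mon →ₗ[ℂ] Mon →ₗ[ℂ] ℂ :=
  monBasis.constr ℂ fun k => sqLen α ⌊(k 1).re⌋₊ ⌊(k 2).re⌋₊ • monBasis.coord k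

theorem contra_pt (α : ℂ) (b c : ℕ) (y : Mon) :
    contra α (mono (pt α b c)) y = sqLen α b c * monBasis.coord (pt α b c) y := by
  rw [contra, mono, Module.Basis.constr_basis]
  simp

theorem fall_ne_zero_of_valid {α : ℂ} {b c : ℕ} (h : Valid α b c) : fall (b + c) α ≠ 0 := by
  rw [Ne, fall_eq_zero_iff]
  rintro ⟨j, hj, hα⟩
  have := h j hα
  omega

theorem sqLen_ne_zero {α : ℂ} {b c : ℕ} (h : Valid α b c) : sqLen α b c ≠ 0 := by
  have h1 : (b.factorial : ℂ) ≠ 0 := by exact_mod_cast b.factorial_ne_zero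
  have h2 : (c.factorial : ℂ) ≠ 0 := by exact_mod_cast c.factorial_ne_zero
  exact div_ne_zero (mul_ne_zero h1 h2) (fall_ne_zero_of_valid h)

theorem sqLen_succ_left {α : ℂ} {b c : ℕ} (h : Valid α (b + 1) c) :
    (b + 1) * sqLen α b c = (α - b - c) * sqLen α (b + 1) c := by
  have h1 := fall_ne_zero_of_valid h
  have h2 := fall_ne_zero_of_valid (h.mono (Nat.le_succ b))
  have h3 := fall_succ (b + c) α
  rw [show b + c + 1 = b + 1 + c by ring] at h3
  rw [sqLen, sqLen, Nat.factorial_succ, div_eq_mul_inv, div_eq_mul_inv]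
  field_simp
  rw [h3]; push_cast; ring

theorem sqLen_comm (α : ℂ) (b c : ℕ) : sqLen α b c = sqLen α c b := by
  rw [sqLen, sqLen, mul_comm, add_comm]

theorem Valid.symm {α : ℂ} {b c : ℕ} (h : Valid α b c) : Valid α c b :=
  fun n hn => by have := h n hn; omega

theorem sqLen_succ_right {α : ℂ} {b c : ℕ} (h : Valid α b (c + 1)) :
    (c + 1) * sqLen α b c = (α - b - c) * sqLen α b (c + 1) := by
  have := sqLen_succ_left h.symm
  rw [sqLen_comm α b c, sqLen_comm α b (c + 1)]
  linear_combination this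

theorem sqLen_mixed (α : ℂ) (b c : ℕ) :
    (b + 1) * sqLen α b (c + 1) = (c + 1) * sqLen α (b + 1) c := by
  rw [sqLen, sqLen, Nat.factorial_succ, Nat.factorial_succ, show b + (c + 1) = b + 1 + c by ring]
  push_cast; ring

theorem sqLen_contra {α : ℂ} (i j : Fin 3) {b c b' c' : ℕ} (h : Valid α b c) (h' : Valid α b' c')
    (hk : pt α b' c' = pt α b c + (Pi.single i 1 - Pi.single j 1)) :
    pt α b c j * sqLen α b' c' = pt α b' c' i * sqLen α b c := by
  have hb := congrFun hk 1
  have hc := congrFun hk 2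
  have key : ∀ x y : ℕ, (x : ℂ) = y + 1 → x = y + 1 := fun x y h => by exact_mod_cast h
  fin_cases i <;> fin_cases j <;> simp at hb hc ⊢
  · subst hb hc; rfl
  · obtain rfl := key b b' (by rw [hb]; ring)
    subst hc
    push_cast
    rw [sqLen_succ_left h]
  · obtain rfl := key c c' (by rw [hc]; ring)
    subst hb
    push_cast
    rw [sqLen_succ_right h]
  · obtain rfl := key b' b (by rw [hb])
    subst hc
    push_cast
    rw [sqLen_succ_left h']
  · subst hb hc; rfl
  · obtain rfl := key b' b (by rw [hb])
    obtain rfl := key c c' (by rw [hc]; ring)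
    push_cast
    rw [sqLen_mixed]
  · obtain rfl := key c' c (by rw [hc])
    subst hb
    push_cast
    rw [sqLen_succ_right h']
  · obtain rfl := key c' c (by rw [hc])
    obtain rfl := key b b' (by rw [hb]; ring)
    push_cast
    rw [sqLen_mixed]
  · subst hb hc; rfl

/-- Both sides vanish unless k' = k + ε_i - ε_j, and then the claim is the ratio of squared lengths
in `sqLen_contra`. -/
theorem contra_E {α : ℂ} (i j : Fin 3) {k k' : Fin 3 → ℂ} (hk : k ∈ expo α) (hk' : k' ∈ expo α) :
    contra α (R (E i j) (mono k)) (mono k') = contra α (mono k) (R (E j i) (mono k')) := by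
  have hmem : R (E i j) (mono k) ∈ S α := R_mem α _ (mono_mem hk)
  obtain ⟨b, c, h, rfl⟩ := (mem_expo_iff _ _).1 hk
  obtain ⟨b', c', h', rfl⟩ := (mem_expo_iff _ _).1 hk'
  rw [contra_pt, R_E_mono, R_E_mono, map_smul, map_smul, LinearMap.smul_apply, coord_mono]
  by_cases he : pt α b' c' = pt α b c + (Pi.single i 1 - Pi.single j 1)
  · have he' : pt α b' c' + (Pi.single j 1 - Pi.single i 1) = pt α b c := by rw [he]; abel
    rw [if_pos he', ← he, contra_pt, coord_mono, if_pos rfl]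
    have := sqLen_contra i j h h' he
    simp only [smul_eq_mul, mul_one]
    linear_combination this
  · have he' : pt α b' c' + (Pi.single j 1 - Pi.single i 1) ≠ pt α b c := by
      intro h; apply he; rw [← h]; abel
    rw [if_neg he', smul_zero, mul_zero]
    by_cases h0 : pt α b c j = 0
    · rw [h0, zero_smul]
    have hm : pt α b c + (Pi.single i 1 - Pi.single j 1) ∈ expo α := by
      by_contra hcon
      have := coord_eq_zero_of_mem_span hmem hcon
      rw [R_E_mono, map_smul, coord_mono, if_pos rfl] at this
      apply h0
      simpa using this
    obtain ⟨b'', c'', -, h''⟩ := (mem_expo_iff _ _).1 hm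
    rw [h'', contra_pt, coord_mono, ← h'', if_neg he, mul_zero, smul_zero]

theorem contra_omega (α : ℂ) (u : U) : ∀ x ∈ S α, ∀ y ∈ S α,
    contra α (R u x) y = contra α x (R (omega u) y) := by
  induction u using U_induction with
  | hc c =>
    intro x _ y _
    rw [omega_algebraMap, AlgHom.commutes]
    simp
  | hadd u v hu hv =>
    intro x hx y hy
    rw [omega_add]
    simp [hu x hx y hy, hv x hx y hy]
  | hmul u v hu hv =>
    intro x hx y hy
    rw [omega_mul, map_mul, map_mul, Module.End.mul_apply, Module.End.mul_apply,
      hu _ (R_mem α v hx) y hy, hv x hx _ (R_mem α _ hy)]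
  | hE i j =>
    intro x hx y hy
    rw [omega_E]
    induction hx using Submodule.span_induction with
    | zero => simp
    | add x x' _ _ h h' => simp [h, h']
    | smul c x _ h => simp [h]
    | mem x hx =>
      obtain ⟨k, hk, rfl⟩ := hx
      induction hy using Submodule.span_induction with
      | zero => simp
      | add x x' _ _ h h' => simp [h, h']
      | smul c x _ h => simp [h]
      | mem y hy =>
        obtain ⟨k', hk', rfl⟩ := hy
        exact contra_E i j hk hk'

/-- The contravariant form on S^α is diagonal with nonzero squared lengths, hence nondegenerate, and
ω(u) acts as the adjoint of u. -/
theorem omega_mem_J {α : ℂ} {u : U} (hu : u ∈ J α) : omega u ∈ J α := by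
  rw [mem_J_iff] at hu ⊢
  intro k hk
  have hmem : R (omega u) (mono k) ∈ S α := R_mem α _ (mono_mem hk)
  refine monBasis.ext_elem fun m => ?_
  rw [← Module.Basis.coord_apply, ← Module.Basis.coord_apply, map_zero]
  by_cases hm : m ∈ expo α
  · have h1 := contra_omega α u _ (mono_mem hm) _ (mono_mem hk)
    rw [hu m hm, map_zero, LinearMap.zero_apply] at h1
    obtain ⟨b, c, hv, rfl⟩ := (mem_expo_iff _ _).1 hm
    rw [contra_pt] at h1
    exact (mul_eq_zero.1 h1.symm).resolve_left (sqLen_ne_zero hv)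
  · exact coord_eq_zero_of_mem_span hmem hm

/-! ### The invariant form -/

/-- Independence of representatives: J^α is a two-sided ideal stable under ω, and the trace vanishes
on it. -/
theorem form_proj (α : ℂ) (u v : U) : form α (proj α u) (proj α v) = tr α (u * omega v) := by
  set u' := Function.surjInv (Ideal.Quotient.mk_surjective (I := J α)) (proj α u) with hu'
  set v' := Function.surjInv (Ideal.Quotient.mk_surjective (I := J α)) (proj α v) with hv'
  have h1 : u' - u ∈ J α := by
    rw [← proj_eq_zero_iff, map_sub, sub_eq_zero]
    exact Function.surjInv_eq (Ideal.Quotient.mk_surjective (I := J α)) (proj α u)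
  have h2 : v' - v ∈ J α := by
    rw [← proj_eq_zero_iff, map_sub, sub_eq_zero]
    exact Function.surjInv_eq (Ideal.Quotient.mk_surjective (I := J α)) (proj α v)
  change tr α (u' * omega v') = _
  refine tr_congr ?_
  have : u' * omega v' - u * omega v = (u' - u) * omega v' + u * omega (v' - v) := by
    rw [omega_sub]; noncomm_ring
  rw [this]
  exact add_mem (Ideal.mul_mem_right _ _ h1) (Ideal.mul_mem_left _ _ (omega_mem_J h2))

theorem form_eq_hc {α : ℂ} {u v z : U} (hz : z ∈ Z) (h : u * omega v - z ∈ comm) :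
    form α (proj α u) (proj α v) = hc α z := by
  rw [form_proj]
  exact tr_eq hz (zero_mem (J α)) (by rwa [sub_zero])

/-- The form as a bilinear map. -/
def formL (α : ℂ) : A α →ₗ[ℂ] A α →ₗ[ℂ] ℂ :=
  LinearMap.mk₂ ℂ (form α)
    (fun a a' b => by
      obtain ⟨u, rfl⟩ := proj_surjective α a
      obtain ⟨u', rfl⟩ := proj_surjective α a'
      obtain ⟨v, rfl⟩ := proj_surjective α b
      rw [← map_add, form_proj, form_proj, form_proj, add_mul, tr_add])
    (fun c a b => by
      obtain ⟨u, rfl⟩ := proj_surjective α a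
      obtain ⟨v, rfl⟩ := proj_surjective α b
      rw [← map_smul, form_proj, form_proj, smul_mul_assoc, tr_smul, smul_eq_mul])
    (fun a b b' => by
      obtain ⟨u, rfl⟩ := proj_surjective α a
      obtain ⟨v, rfl⟩ := proj_surjective α b
      obtain ⟨v', rfl⟩ := proj_surjective α b'
      rw [← map_add, form_proj, form_proj, form_proj, omega_add, mul_add, tr_add])
    (fun c a b => by
      obtain ⟨u, rfl⟩ := proj_surjective α a
      obtain ⟨v, rfl⟩ := proj_surjective α b
      rw [← map_smul, form_proj, form_proj, omega_smul, mul_smul_comm, tr_smul, smul_eq_mul])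

theorem formL_apply (α : ℂ) (a b : A α) : formL α a b = form α a b := rfl

/-- Contravariance of a bilinear form with respect to the adjoint action. -/
def Contravariant {α : ℂ} (B : A α →ₗ[ℂ] A α →ₗ[ℂ] ℂ) : Prop :=
  ∀ i j a b, B (adU α (E i j) a) b = B a (adU α (E j i) b)

/-- This is the trace property tr(ab) = tr(ba) together with ω(E_ij) = E_ji. -/
theorem formL_contravariant (α : ℂ) : Contravariant (formL α) := by
  intro i j a b
  obtain ⟨u, rfl⟩ := proj_surjective α a
  obtain ⟨v, rfl⟩ := proj_surjective α b
  rw [adU_E_proj, adU_E_proj, formL_apply, formL_apply, form_proj, form_proj, omega_sub, omega_mul,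
    omega_mul, omega_E, sub_mul, mul_sub, sub_eq_add_neg, sub_eq_add_neg, tr_add, tr_add,
    ← neg_one_smul ℂ (u * _ * _), ← neg_one_smul ℂ (u * (_ * _)), tr_smul, tr_smul, mul_assoc,
    tr_mul_comm α (E i j), mul_assoc, mul_assoc]

theorem Contravariant.flip {α : ℂ} {B : A α →ₗ[ℂ] A α →ₗ[ℂ] ℂ} (hB : Contravariant B) :
    Contravariant B.flip := fun i j a b => (hB j i b a).symm

theorem form_orthogonal {α : ℂ} {μ ν : Wt} (h : μ ≠ ν) {a b : A α} (ha : a ∈ hwSpace α μ)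
    (hb : b ∈ hwSpace α ν) : form α a b = 0 := by
  obtain ⟨i, hi⟩ := Function.ne_iff.1 h
  have h1 := formL_contravariant α i i a b
  rw [ha.1, hb.1, map_smul, map_smul, LinearMap.smul_apply, formL_apply, smul_eq_mul,
    smul_eq_mul] at h1
  have h2 : (μ i : ℂ) - ν i ≠ 0 := by
    rw [sub_ne_zero]; exact_mod_cast hi
  have h3 : ((μ i : ℂ) - ν i) * form α a b = 0 := by linear_combination h1
  exact (mul_eq_zero.1 h3).resolve_left h2

/-! ### Adjoints of z₃₁ and z₂₃ on highest vectors -/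

section

variable {α : ℂ} {B : A α →ₗ[ℂ] A α →ₗ[ℂ] ℂ}

theorem adU_weight_factor (α : ℂ) {ν : Wt} {b : A α} (hb : b ∈ hwSpace α ν) :
    adU α (E 0 0) b - adU α (E 1 1) b + (2 : ℂ) • b = (ν 0 - ν 1 + 2 : ℂ) • b := by
  rw [hb.1, hb.1, add_smul, sub_smul]

/-- Moved to the other side, the summand E₂₁E₃₂ meets b first with E₁₂, which kills it; in the other
summand the Cartan factor acts on b as the scalar ν₁ - ν₂ + 2. -/
theorem Contravariant.z31 (hB : Contravariant B) {ν : Wt} (a : A α) {b : A α}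
    (hb : b ∈ hwSpace α ν) :
    B (adU α z31 a) b = (ν 0 - ν 1 + 2 : ℂ) * B a (adU α (E 0 2) b) := by
  have h2 : (2 : U) = algebraMap ℂ U 2 := (map_ofNat (algebraMap ℂ U) 2).symm
  have h3 : B (adU α GL3.z31 a) b = B (adU α (E 2 0) a)
      (adU α (E 0 0) b - adU α (E 1 1) b + (2 : ℂ) • b) + B (adU α (E 2 1) a) (adU α (E 0 1) b) := by
    rw [GL3.z31, h2]
    simp only [map_add, map_mul, map_sub, AlgHom.commutes, LinearMap.add_apply,
      Module.End.mul_apply, LinearMap.sub_apply, Module.algebraMap_end_apply, map_smul,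
      LinearMap.smul_apply]
    rw [hB 0 0, hB 1 1, hB 1 0]
  rw [h3, adU_weight_factor α hb, hb.2, map_zero, add_zero, map_smul, hB 2 0, smul_eq_mul]

theorem Contravariant.z23 (hB : Contravariant B) {ν : Wt} (a : A α) {b : A α}
    (hb : b ∈ hwSpace α ν) :
    B (adU α z23 a) b = (ν 0 - ν 1 + 2 : ℂ) * B a (adU α (E 2 1) b) := by
  have h2 : (2 : U) = algebraMap ℂ U 2 := (map_ofNat (algebraMap ℂ U) 2).symm
  have h3 : B (adU α GL3.z23 a) b = B (adU α (E 1 2) a)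
      (adU α (E 0 0) b - adU α (E 1 1) b + (2 : ℂ) • b) - B (adU α (E 0 2) a) (adU α (E 0 1) b) := by
    rw [GL3.z23, h2]
    simp only [map_add, map_mul, map_sub, AlgHom.commutes, LinearMap.add_apply,
      Module.End.mul_apply, LinearMap.sub_apply, Module.algebraMap_end_apply, map_smul,
      LinearMap.smul_apply]
    rw [hB 0 0, hB 1 1, hB 1 0]
  rw [h3, adU_weight_factor α hb, hb.2, map_zero, sub_zero, map_smul, hB 1 2, smul_eq_mul]

/-- Each factor z₃₁ passes to the other side as a multiple of E₁₃, that is of Δ, and k differences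
annihilate a polynomial of degree below k. -/
theorem Contravariant.z31_pow_eq_zero (hB : Contravariant B) (a : A α) (k : ℕ) : ∀ {ν : Wt},
    ν 0 + ν 1 + ν 2 = 0 → ν 1 ≤ 0 → ν 2 ≤ 0 → ∀ {g : ℂ[X]}, g.degree < k →
    B ((adU α GL3.z31 ^ k) a) (act α g (uPlus α ν)) = 0 := by
  induction k with
  | zero =>
    intro ν _ _ _ g hg
    have : g = 0 := by simpa using hg
    rw [this, act_zero, map_zero]
  | succ k ih =>
    intro ν hν h1 h2 g hg
    obtain ⟨s0, s1, s2⟩ := shift_02 ν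
    rw [pow_succ', Module.End.mul_apply, hB.z31 _ (act_mem_hwSpace hν (by omega) h1 g),
      adU_E02_act α hν h1 h2, ih (by omega) (by omega) (by omega) (fwd_degree hg), mul_zero]

theorem Contravariant.z23_pow_eq_zero (hB : Contravariant B) (a : A α) (k : ℕ) : ∀ {ν : Wt},
    ν 0 + ν 1 + ν 2 = 0 → 0 ≤ ν 0 → 0 ≤ ν 2 → ∀ {g : ℂ[X]}, g.degree < k →
    B ((adU α GL3.z23 ^ k) a) (act α g (uPlus α ν)) = 0 := by
  induction k with
  | zero =>
    intro ν _ _ _ g hg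
    have : g = 0 := by simpa using hg
    rw [this, act_zero, map_zero]
  | succ k ih =>
    intro ν hν h1 h2 g hg
    obtain ⟨s0, s1, s2⟩ := shift_21 ν
    rw [pow_succ', Module.End.mul_apply, hB.z23 _ (act_mem_hwSpace hν h1 (by omega) g),
      adU_E21_act α hν h1 h2, ih (by omega) (by omega) (by omega) (by
        rw [degree_neg]; exact bwd_degree hg), mul_zero]

end

/-! ### Difference equations and hypergeometric polynomials -/

/-- Agreement of two polynomials at the natural numbers `t` with `P + t ≤ α` if `α ∈ ℕ`, and at all
natural numbers otherwise. -/
def Agree (α : ℂ) (P : ℤ) (f g : ℂ[X]) : Prop :=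
  ∀ t : ℕ, (∀ n : ℕ, α = n → P + t ≤ n) → f.eval (t : ℂ) = g.eval (t : ℂ)

/-- The operator does not look beyond the range of agreement: the coefficient t + P - α vanishes at
its right end when α = n, and the coefficient t vanishes at 0. -/
theorem Agree.hahnOp {α : ℂ} {P : ℤ} {f g : ℂ[X]} (h : Agree α P f g) (q r : ℂ) :
    Agree α P (hahnOp α P q r f) (hahnOp α P q r g) := by
  intro t ht
  rw [eval_hahnOp, eval_hahnOp, h t ht]
  have h1 : (t + (P - α) : ℂ) * (f.eval (t + 1 : ℂ) - g.eval (t : ℂ)) =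
      (t + (P - α)) * (g.eval (t + 1 : ℂ) - g.eval (t : ℂ)) := by
    by_cases hv : ∀ n : ℕ, α = n → P + (t + 1 : ℕ) ≤ n
    · have := h (t + 1) hv
      push_cast at this
      rw [this]
    · push Not at hv
      obtain ⟨n, hn, hlt⟩ := hv
      have h2 := ht n hn
      have h3 : (P + t : ℤ) = n := by push_cast at hlt; omega
      have h4 : (P + t : ℂ) = n := by exact_mod_cast congrArg (Int.cast : ℤ → ℂ) h3
      rw [show (t + (P - α) : ℂ) = 0 by rw [hn, ← h4]; ring, zero_mul, zero_mul]
  have h2 : (t : ℂ) * (g.eval (t : ℂ) - f.eval (t - 1 : ℂ)) =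
      t * (g.eval (t : ℂ) - g.eval (t - 1 : ℂ)) := by
    rcases t with _ | t
    · simp
    · have := h t (fun n hn => by have := ht n hn; push_cast at this; omega)
      push_cast
      rw [add_sub_cancel_right, this]
  linear_combination (t + (r + 1)) * h1 - (t - (q + α + 2)) * h2

theorem Agree.eigen {α : ℂ} {P : ℤ} {f F : ℂ[X]} (h : Agree α P f F) {q r lam : ℂ}
    (hF : GL3.hahnOp α P q r F = C lam * F) :
    Agree α P (GL3.hahnOp α P q r f) (C lam * f) := by
  intro t ht
  rw [h.hahnOp q r t ht, hF, eval_mul, eval_mul, h t ht]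

/-- Both polynomials are eigenfunctions for the same eigenvalue. With d the value of the first at 0,
the difference vanishes at 0, and so on the whole range by `eigen_eq_zero`. The bound P + k ≤ n
keeps the denominators of the series nonzero. -/
theorem agree_hahnPoly {α : ℂ} {P : ℤ} {c : ℂ} (hc : c ≠ 0) (q : ℂ) (r k : ℕ)
    (hp : (P : ℂ) = q + r) (hk : ∀ n : ℕ, α = n → P + k ≤ n) (hP : 0 ≤ P) :
    ∃ d : ℂ, d ≠ 0 ∧ Agree α P (C c * ladF α k P q r)
      (C d * hahnPoly k (2 * P + 3) (r + 1) (P - α)) := by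
  have hr : ∀ j : ℕ, (r + 1 + j : ℂ) ≠ 0 := fun j => by
    have : ((r + 1 + j : ℕ) : ℂ) ≠ 0 := by exact_mod_cast (by omega : r + 1 + j ≠ 0)
    exact_mod_cast this
  have hα : ∀ t : ℕ, (∀ n : ℕ, α = n → P + t ≤ n) → ∀ j < t, (P - α + j : ℂ) ≠ 0 := by
    intro t ht j hj h
    have h1 : α = ((P + j).toNat : ℕ) := by
      have e : (((P + j).toNat : ℤ) : ℂ) = ((P + j : ℤ) : ℂ) := by
        rw [Int.toNat_of_nonneg]; omega
      push_cast at e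
      rw [e]; linear_combination -h
    have := ht _ h1
    omega
  set F := C c * ladF α k P q r with hF
  set G := hahnPoly k (2 * P + 3) (r + 1) (P - α) with hG
  refine ⟨F.eval 0, ?_, fun t ht => ?_⟩
  · rw [hF, eval_mul, eval_C]
    exact mul_ne_zero hc (eval_ladF_zero_ne α k _ _ _ (fun j _ => hr j) (hα k hk))
  · have h1 : GL3.hahnOp α P q r F = C (k * (k + 2 * P + 2) : ℂ) * F := by
      rw [hF, hahnOp_C_mul, hahnOp_ladF α k _ _ _ hp]; ring
    have h2 : GL3.hahnOp α P q r G = C (k * (k + 2 * P + 2) : ℂ) * G :=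
      hahnOp_hahnPoly α P q r hp k (fun j _ => hr j) (hα k hk)
    have h3 : GL3.hahnOp α P q r (F - C (F.eval 0) * G) =
        C (k * (k + 2 * P + 2) : ℂ) * (F - C (F.eval 0) * G) := by
      rw [hahnOp_sub, hahnOp_C_mul _ _ _ _ _ G, h1, h2]; ring
    have h4 := eigen_eq_zero h3 (by
      have hG0 : G.eval 0 = 1 := eval_hahnPoly_zero _ _ _ _
      simp [hG0]) t
      (fun j _ => hr j) (hα t ht) t le_rfl
    rw [eval_sub, sub_eq_zero] at h4
    exact h4

theorem D31_eq (α : ℂ) (ν : Wt) (f : ℂ[X]) :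
    D31 α ν f = hahnOp α (ν 0) (-ν 1) (-ν 2) f := by
  rw [D31, hahnOp]
  simp only [C_add, C_sub, C_neg, C_1]
  ring

/-- The substitution t ↦ t + ν₃ brings the case ν₃ ≥ 0 to the same operator, with parameters (-ν₂,
ν₁, ν₃) in place of (ν₁, -ν₂, -ν₃). -/
theorem D23_comp (α : ℂ) {ν : Wt} (hν : ν 0 + ν 1 + ν 2 = 0) (f : ℂ[X]) :
    (D23 α ν f).comp (X + C (ν 2 : ℂ)) =
      hahnOp α (-ν 1) (ν 0) (ν 2) (f.comp (X + C (ν 2 : ℂ))) := by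
  refine Polynomial.funext fun t => ?_
  rw [eval_hahnOp, D23]
  simp only [eval_comp, eval_add, eval_sub, eval_mul, eval_X, eval_C, eval_one, eval_fwd, eval_bwd]
  have e1 : t + 1 + (ν 2 : ℂ) = t + ν 2 + 1 := by ring
  have e2 : t - 1 + (ν 2 : ℂ) = t + ν 2 - 1 := by ring
  have e3 : (ν 0 : ℂ) = -ν 1 - ν 2 := by
    rw [show ν 0 = -ν 1 - ν 2 by omega]; push_cast; ring
  rw [e1, e2, e3]
  ring

/-! ### Transfer from polynomials to 𝔄^α -/

section

variable {α : ℂ} {ν : Wt}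

/-- With c = t - ν₃ the exponent of x₃, the condition -ν₂ + c ≤ n becomes ν₁ + t ≤ n. -/
theorem act_eq_iff_agree31 (hν : ν 0 + ν 1 + ν 2 = 0) (h1 : ν 1 ≤ 0) (h2 : ν 2 ≤ 0) (f g : ℂ[X]) :
    act α f (uPlus α ν) = act α g (uPlus α ν) ↔ Agree α (ν 0) f g := by
  rw [act_eq_act_iff hν (by omega) h1]
  obtain ⟨r, hr⟩ : ∃ r : ℕ, ν 2 = -r := ⟨(-ν 2).toNat, by omega⟩
  constructor
  · intro h t ht
    have := h (t + r) (by push_cast; omega) (fun n hn => by have := ht n hn; push_cast; omega)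
    rw [hr] at this
    simpa using this
  · intro h c hc hv
    obtain ⟨t, rfl⟩ := Nat.exists_eq_add_of_le (show r ≤ c by omega)
    have := h t (fun n hn => by have := hv n hn; push_cast at this; omega)
    rw [hr]
    simpa using this

theorem act_eq_iff_agree23 (hν : ν 0 + ν 1 + ν 2 = 0) (h0 : 0 ≤ ν 0) (h2 : 0 ≤ ν 2) (f g : ℂ[X]) :
    act α f (uPlus α ν) = act α g (uPlus α ν) ↔
      Agree α (-ν 1) (f.comp (X + C (ν 2 : ℂ))) (g.comp (X + C (ν 2 : ℂ))) := by
  rw [act_eq_act_iff hν h0 (by omega)]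
  constructor
  · intro h t ht
    have := h t (by omega) ht
    simpa using this
  · intro h c _ hv
    simpa using h c hv

theorem uPlus_eq_zero (hν : ν 0 + ν 1 + ν 2 = 0) (h0 : 0 ≤ ν 0) (h1 : ν 1 ≤ 0)
    (h : ν ∉ Qplus α) : uPlus α ν = 0 := by
  have h2 : hwSpace α ν = ⊥ := by
    by_contra hcon
    exact h ⟨hν, hcon⟩
  have h3 := act_mem_hwSpace (α := α) hν h0 h1 1
  rwa [act_one, h2] at h3

theorem shift31 (ν : Wt) (k : ℕ) : (ν + k • (eps 0 - eps 2)) 0 = ν 0 + k ∧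
    (ν + k • (eps 0 - eps 2)) 1 = ν 1 ∧ (ν + k • (eps 0 - eps 2)) 2 = ν 2 - k := by
  refine ⟨by simp [eps], by simp [eps], by simp [eps]; ring⟩

theorem shift23 (ν : Wt) (k : ℕ) : (ν + k • (eps 2 - eps 1)) 0 = ν 0 ∧
    (ν + k • (eps 2 - eps 1)) 1 = ν 1 - k ∧ (ν + k • (eps 2 - eps 1)) 2 = ν 2 + k := by
  refine ⟨by simp [eps], by simp [eps]; ring, by simp [eps]⟩

theorem isF31_agree (hν : ν 0 + ν 1 + ν 2 = 0) (h1 : ν 1 ≤ 0) (h2 : ν 2 ≤ 0) (k : ℕ) :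
    ∃ c : ℂ, c ≠ 0 ∧ ∀ f, IsF31 α ν k f ↔
      Agree α (ν 0) f (C c * ladF α k (ν 0) (-ν 1) (-ν 2)) := by
  obtain ⟨c, hc, h⟩ := z31_pow α k hν h1 h2
  refine ⟨c, hc, fun f => ?_⟩
  rw [← act_eq_iff_agree31 hν h1 h2, h]; rfl

theorem isF23_agree (hν : ν 0 + ν 1 + ν 2 = 0) (h0 : 0 ≤ ν 0) (h2 : 0 ≤ ν 2) (k : ℕ) :
    ∃ c : ℂ, c ≠ 0 ∧ ∀ f, IsF23 α ν k f ↔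
      Agree α (-ν 1) (f.comp (X + C (ν 2 : ℂ))) (C c * ladF α k (-ν 1) (ν 0) (ν 2)) := by
  obtain ⟨c, hc, h⟩ := z23_pow α k hν h0 h2
  refine ⟨c, hc, fun f => ?_⟩
  unfold IsF23 at h ⊢
  rw [← h, act_eq_iff_agree23 hν h0 h2, comp_assoc]
  simp

theorem exists_isF31 (hν : ν 0 + ν 1 + ν 2 = 0) (h1 : ν 1 ≤ 0) (h2 : ν 2 ≤ 0) (k : ℕ) :
    ∃ f, IsF31 α ν k f := by
  obtain ⟨c, -, h⟩ := z31_pow α k hν h1 h2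
  exact ⟨_, h⟩

theorem exists_isF23 (hν : ν 0 + ν 1 + ν 2 = 0) (h0 : 0 ≤ ν 0) (h2 : 0 ≤ ν 2) (k : ℕ) :
    ∃ f, IsF23 α ν k f := by
  obtain ⟨c, -, h⟩ := z23_pow α k hν h0 h2
  exact ⟨_, h⟩

theorem IsF31.difference_eq (hν : ν 0 + ν 1 + ν 2 = 0) (h1 : ν 1 ≤ 0) (h2 : ν 2 ≤ 0) {k : ℕ}
    {f : ℂ[X]} (hf : IsF31 α ν k f) : act α (D31 α ν f) (uPlus α ν) =
      act α (C (k * (k + 2 * (ν 0 : ℂ) + 2)) * f) (uPlus α ν) := by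
  obtain ⟨c, -, hc⟩ := isF31_agree (α := α) hν h1 h2 k
  rw [act_eq_iff_agree31 hν h1 h2, D31_eq]
  refine ((hc f).1 hf).eigen ?_
  rw [hahnOp_C_mul, hahnOp_ladF]
  · ring
  · rw [show ν 0 = -ν 1 + -ν 2 by omega]; push_cast; ring

theorem IsF23.difference_eq (hν : ν 0 + ν 1 + ν 2 = 0) (h0 : 0 ≤ ν 0) (h2 : 0 ≤ ν 2) {k : ℕ}
    {f : ℂ[X]} (hf : IsF23 α ν k f) : act α (D23 α ν f) (uPlus α ν) =
      act α (C (k * (k - 2 * (ν 1 : ℂ) + 2)) * f) (uPlus α ν) := by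
  obtain ⟨c, -, hc⟩ := isF23_agree (α := α) hν h0 h2 k
  rw [act_eq_iff_agree23 hν h0 h2, D23_comp α hν, mul_comp, C_comp]
  have h3 : ((-ν 1 : ℤ) : ℂ) = -ν 1 := by push_cast; rfl
  rw [← h3]
  refine ((hc f).1 hf).eigen ?_
  rw [hahnOp_C_mul, h3, hahnOp_ladF]
  · rw [show (k : ℂ) + 2 * -(ν 1 : ℂ) + 2 = k - 2 * ν 1 + 2 by ring]; ring
  · rw [show ν 1 = -(ν 0 + ν 2) by omega]; push_cast; ring

theorem IsF31.hypergeometric (hν : ν 0 + ν 1 + ν 2 = 0) (h1 : ν 1 ≤ 0) (h2 : ν 2 ≤ 0) {k : ℕ}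
    {f : ℂ[X]} (hf : IsF31 α ν k f) (hk : ∀ n : ℕ, α = n → ν 0 + k ≤ n) :
    ∃ c : ℂ, c ≠ 0 ∧ ∃ g : ℂ[X], (∀ t : ℂ, g.eval t = c * hahn31 α ν k t) ∧
      act α f (uPlus α ν) = act α g (uPlus α ν) := by
  obtain ⟨c, hc, h⟩ := isF31_agree (α := α) hν h1 h2 k
  obtain ⟨r, hr⟩ : ∃ r : ℕ, ν 2 = -r := ⟨(-ν 2).toNat, by omega⟩
  have hr' : (-ν 2 : ℂ) = r := by rw [hr]; push_cast; ring
  have hp : (ν 0 : ℂ) = -ν 1 + r := by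
    rw [← hr', show ν 0 = -ν 1 + -ν 2 by omega]; push_cast; ring
  obtain ⟨d, hd, hagree⟩ := agree_hahnPoly hc (-ν 1) r k hp hk (by omega)
  refine ⟨d, hd, C d * hahnPoly k (2 * ν 0 + 3) (r + 1) (ν 0 - α), fun t => ?_, ?_⟩
  · rw [eval_mul, eval_C, eval_hahnPoly, hahn31, ← hr']
    congr 2 <;> ring
  · rw [act_eq_iff_agree31 hν h1 h2]
    intro t ht
    rw [(h f).1 hf t ht, hr', hagree t ht]

theorem IsF23.hypergeometric (hν : ν 0 + ν 1 + ν 2 = 0) (h0 : 0 ≤ ν 0) (h2 : 0 ≤ ν 2) {k : ℕ}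
    {f : ℂ[X]} (hf : IsF23 α ν k f) (hk : ∀ n : ℕ, α = n → -ν 1 + k ≤ n) :
    ∃ c : ℂ, c ≠ 0 ∧ ∃ g : ℂ[X], (∀ t : ℂ, g.eval t = c * hahn23 α ν k t) ∧
      act α f (uPlus α ν) = act α g (uPlus α ν) := by
  obtain ⟨c, hc, h⟩ := isF23_agree (α := α) hν h0 h2 k
  obtain ⟨s, hs⟩ : ∃ s : ℕ, ν 2 = s := ⟨(ν 2).toNat, by omega⟩
  have hs' : (ν 2 : ℂ) = s := by rw [hs]; push_cast; ring
  have hq : ((-ν 1 : ℤ) : ℂ) = ν 0 + s := by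
    rw [← hs', show -ν 1 = ν 0 + ν 2 by omega]; push_cast; ring
  obtain ⟨d, hd, hagree⟩ := agree_hahnPoly hc (ν 0) s k hq hk (by omega)
  refine ⟨d, hd, (C d * hahnPoly k (2 * (-ν 1 : ℤ) + 3) (s + 1) ((-ν 1 : ℤ) - α)).comp
    (X - C (ν 2 : ℂ)), fun t => ?_, ?_⟩
  · rw [eval_comp, eval_mul, eval_C, eval_hahnPoly, hahn23, ← hs', eval_sub, eval_X, eval_C]
    push_cast
    congr 2 <;> ring
  · rw [act_eq_iff_agree23 hν h0 h2, comp_assoc]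
    intro t ht
    rw [(h f).1 hf t ht, hs']
    have := hagree t ht
    push_cast at this ⊢
    simpa using this

theorem IsF31.orthogonal (hν : ν 0 + ν 1 + ν 2 = 0) (h1 : ν 1 ≤ 0) (h2 : ν 2 ≤ 0) {k l : ℕ}
    (hkl : k ≠ l) {f g : ℂ[X]} (hf : IsF31 α ν k f) (hg : IsF31 α ν l g) :
    formPlus α ν f g = 0 := by
  -- The claim is made for every contravariant `B` so that the flipped form handles k < l. The
  -- smaller index is represented by the multiple of `ladF`, of degree at most l, since `g` itself
  -- is only determined modulo ≡_ν.
  have key : ∀ {k l : ℕ}, l < k → ∀ {f g : ℂ[X]}, IsF31 α ν k f → IsF31 α ν l g →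
      ∀ B : A α →ₗ[ℂ] A α →ₗ[ℂ] ℂ, Contravariant B →
        B (act α f (uPlus α ν)) (act α g (uPlus α ν)) = 0 := by
    intro k l hlt f g hf hg B hB
    obtain ⟨c, -, h⟩ := z31_pow α l hν h1 h2
    unfold IsF31 at hf hg h
    rw [hg, ← h, hf, act_C_mul, map_smul, hB.z31_pow_eq_zero _ k hν h1 h2, smul_zero]
    exact (ladF_degree _ _ _ _ _).trans_le (by exact_mod_cast hlt)
  rcases lt_or_gt_of_ne hkl with h | h
  · exact key h hg hf _ (formL_contravariant α).flip
  · exact key h hf hg _ (formL_contravariant α)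

theorem IsF23.orthogonal (hν : ν 0 + ν 1 + ν 2 = 0) (h0 : 0 ≤ ν 0) (h2 : 0 ≤ ν 2) {k l : ℕ}
    (hkl : k ≠ l) {f g : ℂ[X]} (hf : IsF23 α ν k f) (hg : IsF23 α ν l g) :
    formPlus α ν f g = 0 := by
  have key : ∀ {k l : ℕ}, l < k → ∀ {f g : ℂ[X]}, IsF23 α ν k f → IsF23 α ν l g →
      ∀ B : A α →ₗ[ℂ] A α →ₗ[ℂ] ℂ, Contravariant B →
        B (act α f (uPlus α ν)) (act α g (uPlus α ν)) = 0 := by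
    intro k l hlt f g hf hg B hB
    obtain ⟨c, -, h⟩ := z23_pow α l hν h0 h2
    unfold IsF23 at hf hg h
    rw [hg, ← h, hf, mul_comp, C_comp, act_C_mul, map_smul, hB.z23_pow_eq_zero _ k hν h0 h2,
      smul_zero]
    have h3 : ((ladF α l (-ν 1) (ν 0) (ν 2)).comp (X - C (ν 2 : ℂ))).degree =
        (ladF α l (-ν 1) (ν 0) (ν 2)).degree := by
      by_cases h0 : ladF α l (-ν 1) (ν 0) (ν 2) = 0
      · rw [h0, zero_comp]
      · rw [degree_eq_natDegree h0, degree_eq_natDegree fun h => h0 ?_, natDegree_comp,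
          natDegree_X_sub_C, mul_one]
        have := congrArg (fun g => g.comp (X + C (ν 2 : ℂ))) h
        simpa [comp_assoc] using this
    rw [h3]
    exact (ladF_degree _ _ _ _ _).trans_le (by exact_mod_cast hlt)
  rcases lt_or_gt_of_ne hkl with h | h
  · exact key h hg hf _ (formL_contravariant α).flip
  · exact key h hf hg _ (formL_contravariant α)

/-- The vector to which (ad z₃₁)^k is applied is already zero when its weight lies outside Q^+. -/
theorem IsF31.act_eq_zero (hν : ν 0 + ν 1 + ν 2 = 0) (h1 : ν 1 ≤ 0) (h2 : ν 2 ≤ 0) {k : ℕ}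
    {f : ℂ[X]} (hf : IsF31 α ν k f) (hk : ν + k • (eps 0 - eps 2) ∉ Qplus α) :
    act α f (uPlus α ν) = 0 := by
  obtain ⟨s0, s1, s2⟩ := shift31 ν k
  unfold IsF31 at hf
  rw [hf, uPlus_eq_zero (by omega) (by omega) (by omega) hk, map_zero]

theorem IsF23.act_eq_zero (hν : ν 0 + ν 1 + ν 2 = 0) (h0 : 0 ≤ ν 0) (h2 : 0 ≤ ν 2) {k : ℕ}
    {f : ℂ[X]} (hf : IsF23 α ν k f) (hk : ν + k • (eps 2 - eps 1) ∉ Qplus α) :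
    act α f (uPlus α ν) = 0 := by
  obtain ⟨s0, s1, s2⟩ := shift23 ν k
  unfold IsF23 at hf
  rw [hf, uPlus_eq_zero (by omega) (by omega) (by omega) hk, map_zero]

end

end GL3
end

/-! ### The theorem -/

theorem theorem2p4 (α : ℂ) :
    -- the form is the one given by `φ((u ω(v))^♯)(α, 0, 0)`, for every choice of representatives
    ((∀ u : U, ∃ z ∈ Z, u - z ∈ comm) ∧
      (∀ u v z : U, z ∈ Z → u * omega v - z ∈ comm →
        form α (proj α u) (proj α v) = hc α z)) ∧
    -- the weights which occur
    (∀ ν : Wt, ν ∈ Qplus α ↔ ν 0 + ν 1 + ν 2 = 0 ∧ 0 ≤ ν 0 ∧ ν 1 ≤ 0 ∧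
      ∀ n : ℕ, α = n → ν 0 ≤ n ∧ -ν 1 ≤ n) ∧
    -- the weight spaces are generated by `u^+_ν`
    (∀ ν ∈ Qplus α,
      (∀ a : A α, a ∈ hwSpace α ν ↔ ∃ f : ℂ[X], a = act α f (uPlus α ν)) ∧
      ((∀ n : ℕ, α ≠ n) →
        (∀ f : ℂ[X], act α f (uPlus α ν) = 0 → f = 0) ∧
        (∀ w : A α, (∀ a : A α, a ∈ hwSpace α ν ↔ ∃ f : ℂ[X], a = act α f w) →
          ∃ c : ℂ, c ≠ 0 ∧ w = c • uPlus α ν)) ∧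
      (∀ n : ℕ, α = n → ∀ f : ℂ[X], act α f (uPlus α ν) = 0 ↔
        ∀ m : ℤ, 0 ≤ m → ν 2 ≤ m → m ≤ n - ν 0 → f.eval (m : ℂ) = 0)) ∧
    -- different weight spaces are orthogonal
    (∀ μ ν : Wt, μ ≠ ν → ∀ a ∈ hwSpace α μ, ∀ b ∈ hwSpace α ν, form α a b = 0) ∧
    -- the polynomials `f_{k,ν}` exist, and are unique if `α` is not a natural number
    (∀ ν ∈ Qplus α, ∀ k : ℕ,
      (ν 2 ≤ 0 → (∃ f, IsF31 α ν k f) ∧ ((∀ n : ℕ, α ≠ n) → ∃! f, IsF31 α ν k f)) ∧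
      (0 ≤ ν 2 → (∃ f, IsF23 α ν k f) ∧ ((∀ n : ℕ, α ≠ n) → ∃! f, IsF23 α ν k f))) ∧
    -- they are orthogonal
    (∀ ν ∈ Qplus α, ∀ k l : ℕ, k ≠ l → ∀ f g : ℂ[X],
      (ν 2 ≤ 0 → IsF31 α ν k f → IsF31 α ν l g → formPlus α ν f g = 0) ∧
      (0 ≤ ν 2 → IsF23 α ν k f → IsF23 α ν l g → formPlus α ν f g = 0)) ∧
    -- the difference equations
    (∀ ν ∈ Qplus α, ∀ (k : ℕ) (f : ℂ[X]),
      (ν 2 ≤ 0 → IsF31 α ν k f →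
        act α (D31 α ν f) (uPlus α ν) =
          act α (C (k * (k + 2 * (ν 0 : ℂ) + 2)) * f) (uPlus α ν) ∧
        ((∀ n : ℕ, α ≠ n) → D31 α ν f = C (k * (k + 2 * (ν 0 : ℂ) + 2)) * f)) ∧
      (0 ≤ ν 2 → IsF23 α ν k f →
        act α (D23 α ν f) (uPlus α ν) =
          act α (C (k * (k - 2 * (ν 1 : ℂ) + 2)) * f) (uPlus α ν) ∧
        ((∀ n : ℕ, α ≠ n) → D23 α ν f = C (k * (k - 2 * (ν 1 : ℂ) + 2)) * f))) ∧
    -- the explicit form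
    (∀ ν ∈ Qplus α, ∀ (k : ℕ) (f : ℂ[X]),
      (ν 2 ≤ 0 → IsF31 α ν k f →
        ((∀ n : ℕ, α ≠ n) → ∃ c : ℂ, c ≠ 0 ∧ ∀ t : ℂ, f.eval t = c * hahn31 α ν k t) ∧
        (ν + k • (eps 0 - eps 2) ∈ Qplus α → ∃ c : ℂ, c ≠ 0 ∧ ∃ g : ℂ[X],
          (∀ t : ℂ, g.eval t = c * hahn31 α ν k t) ∧
          act α f (uPlus α ν) = act α g (uPlus α ν)) ∧
        (ν + k • (eps 0 - eps 2) ∉ Qplus α → act α f (uPlus α ν) = 0)) ∧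
      (0 ≤ ν 2 → IsF23 α ν k f →
        ((∀ n : ℕ, α ≠ n) → ∃ c : ℂ, c ≠ 0 ∧ ∀ t : ℂ, f.eval t = c * hahn23 α ν k t) ∧
        (ν + k • (eps 2 - eps 1) ∈ Qplus α → ∃ c : ℂ, c ≠ 0 ∧ ∃ g : ℂ[X],
          (∀ t : ℂ, g.eval t = c * hahn23 α ν k t) ∧
          act α f (uPlus α ν) = act α g (uPlus α ν)) ∧
        (ν + k • (eps 2 - eps 1) ∉ Qplus α → act α f (uPlus α ν) = 0))) := by

  have hsub : ∀ {ν : Wt}, ν ∈ Qplus α → ν 0 + ν 1 + ν 2 = 0 ∧ 0 ≤ ν 0 ∧ ν 1 ≤ 0 := fun h =>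
    ⟨(mem_Qplus_iff.1 h).1, (mem_Qplus_iff.1 h).2.1, (mem_Qplus_iff.1 h).2.2.1⟩
  refine ⟨⟨exists_central, fun u v z hz h => form_eq_hc hz h⟩, fun ν => mem_Qplus_iff,
    fun ν h => ⟨mem_hwSpace_iff h, fun hα => ⟨fun f hf => ?_, fun w hw => ?_⟩, ?_⟩,
    fun μ ν hne a ha b hb => form_orthogonal hne ha hb, fun ν h k => ?_, fun ν h k l hkl f g => ?_,
    fun ν h k f => ?_, fun ν h k f => ?_⟩
  · exact act_injective_generic hα h (hf.trans (act_zero α _).symm)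
  · exact generator_unique hα h hw
  · rintro n rfl f
    rw [← act_zero (n : ℂ) (uPlus n ν), act_eq_act_nat_iff h]
    simp only [eval_zero]
  · obtain ⟨hν, h0, h1⟩ := hsub h
    refine ⟨fun h2 => ⟨exists_isF31 hν h1 h2 k, fun hα => ?_⟩,
      fun h2 => ⟨exists_isF23 hν h0 h2 k, fun hα => ?_⟩⟩
    · obtain ⟨f, hf⟩ := exists_isF31 (α := α) hν h1 h2 k
      exact ⟨f, hf, fun g hg => act_injective_generic hα h (Eq.trans hg hf.symm)⟩
    · obtain ⟨f, hf⟩ := exists_isF23 (α := α) hν h0 h2 k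
      exact ⟨f, hf, fun g hg => act_injective_generic hα h (Eq.trans hg hf.symm)⟩
  · obtain ⟨hν, h0, h1⟩ := hsub h
    exact ⟨fun h2 hf hg => hf.orthogonal hν h1 h2 hkl hg,
      fun h2 hf hg => hf.orthogonal hν h0 h2 hkl hg⟩
  · obtain ⟨hν, h0, h1⟩ := hsub h
    exact ⟨fun h2 hf => ⟨hf.difference_eq hν h1 h2,
        fun hα => act_injective_generic hα h (hf.difference_eq hν h1 h2)⟩,
      fun h2 hf => ⟨hf.difference_eq hν h0 h2,
        fun hα => act_injective_generic hα h (hf.difference_eq hν h0 h2)⟩⟩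
  · obtain ⟨hν, h0, h1⟩ := hsub h
    refine ⟨fun h2 hf => ⟨fun hα => ?_, fun hk => ?_, hf.act_eq_zero hν h1 h2⟩,
      fun h2 hf => ⟨fun hα => ?_, fun hk => ?_, hf.act_eq_zero hν h0 h2⟩⟩
    · obtain ⟨c, hc, g, hg, hfg⟩ := hf.hypergeometric hν h1 h2 fun n hn => absurd hn (hα n)
      rw [act_injective_generic hα h hfg]
      exact ⟨c, hc, hg⟩
    · obtain ⟨-, -, -, hn⟩ := mem_Qplus_iff.1 hk
      exact hf.hypergeometric hν h1 h2 fun n hα => by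
        have := (hn n hα).1
        rwa [(shift31 ν k).1] at this
    · obtain ⟨c, hc, g, hg, hfg⟩ := hf.hypergeometric hν h0 h2 fun n hn => absurd hn (hα n)
      rw [act_injective_generic hα h hfg]
      exact ⟨c, hc, hg⟩
    · obtain ⟨-, -, -, hn⟩ := mem_Qplus_iff.1 hk
      exact hf.hypergeometric hν h0 h2 fun n hα => by
        have := (hn n hα).2
        rw [(shift23 ν k).2.1] at this
        omega
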